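/- Let $$\mathcal R(s)=\int_{0\swarrow 1}\frac{x^{-s}e^{\pi i x^2}}{e^{\pi i x}-e^{-\pi i x}}\,dx\qquad(s\in\mathbb C)$$ be Riemann's auxiliary function, where the path of integration is a straight line of direction $e^{i\pi/4}$ that crosses the real axis between $0$ and $1$ (say at $\tfrac12$), run through from the upper right to the lower left, and $x^{-s}=\exp(-s\log x)$ with the principal logarithm. There is a sequence $\rho_{-1},\rho_{-2},\rho_{-3},\dots$ of distinct zeros of $\mathcal R$ in the open fourth quadrant $\{\operatorname{Re}s>0,\ \operatorname{Im}s<0\}$, with strictly decreasing imaginary parts, such that: 1. the sequence is computable: there is an algorithm which, given integers $n\ge1$ and $k\ge0$, outputs integers $a,b$ with $\bigl|\rho_{-n}-(a+bi)/2^{k}\bigr|\le 2^{-k}$; 2. as $n\to\infty$, $$\rho_{-n}\sim\frac{4\pi^2n}{\log^2n}-\frac{4\pi i n}{\log n},$$ as complex numbers, and also separately for the real and imaginary parts: $\operatorname{Re}\rho_{-n}\sim 4\pi^2n/\log^2n$ and $\operatorname{Im}\rho_{-n}\sim-4\pi n/\log n$. -/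

import Mathlib

open Filter Asymptotics

/-- The point with parameter `u` on the straight line through `1/2` of direction `e^{iπ/4}`.
The path of integration `0 ↙ 1` is this line, run through from the upper right
(`u = +∞`) to the lower left (`u = -∞`); it crosses the real axis only at `1/2`. -/
noncomputable def auxLine (u : ℝ) : ℂ :=
  1 / 2 + (u : ℂ) * Complex.exp (Real.pi * Complex.I / 4)

/-- The integrand `x^{-s} e^{πi x²} / (e^{πi x} - e^{-πi x})`, where `x^{-s} = exp (-s log x)`
with the principal logarithm (the line `auxLine` does not meet the cut `(-∞, 0]`). -/
noncomputable def auxIntegrand (s x : ℂ) : ℂ :=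
  x ^ (-s) * Complex.exp (Real.pi * Complex.I * x ^ 2) /
    (Complex.exp (Real.pi * Complex.I * x) - Complex.exp (-(Real.pi * Complex.I * x)))

/-- Riemann's auxiliary function
`R(s) = ∫_{0↙1} x^{-s} e^{πi x²} / (e^{πi x} - e^{-πi x}) dx`.
In terms of the parameter `u` of `auxLine` one has `dx = e^{iπ/4} du`, and the minus sign
accounts for the orientation, `u` going from `+∞` to `-∞`. -/
noncomputable def riemannAux (s : ℂ) : ℂ :=
  -∫ u : ℝ, auxIntegrand s (auxLine u) * Complex.exp (Real.pi * Complex.I / 4)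

/-- A sequence of complex numbers is computable: there is an algorithm (a total recursive
function) that for input `n`, `k` produces integers `a`, `b` such that the dyadic Gaussian
rational `(a + b i) / 2 ^ k` approximates `z n` with error at most `2 ^ (-k)`. -/
def IsComputableSeq (z : ℕ → ℂ) : Prop :=
  ∃ f : ℕ → ℕ → ℤ × ℤ, Computable₂ f ∧
    ∀ n k : ℕ,
      ‖z n - (((f n k).1 : ℂ) + ((f n k).2 : ℂ) * Complex.I) / 2 ^ k‖ ≤ 1 / (2 : ℝ) ^ k

/-! ### Computable arithmetic on integers -/

section IntArith

variable {α : Type*} [Primcodable α]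

/-! Put s = -2πi z² (`sOf`). The exponent -s log x + πi x² has a critical point at x = -iz. Move the
line of integration to the line through a half-integer N + 1/2 within 1/2 of the line through that
saddle. This crosses the poles 1, ..., N, and the residues give R(s) = ∑_{n ≤ N} n^(-s) - `lineInt`
(`riemannAux_eq_sum_sub_lineInt`). Near the saddle 1/(e^{πix} - e^{-πix}) is close to e^{-πix}, and
Laplace's method (`tendsto_lineInt_div`) evaluates the new integral as (`saddleConst` + o(1))
exp(2πi `phase` z). When Re s → ∞ the sum tends to 1. Hence, where `phase` z is within 1 of n +
`phaseConst`, R(s) is close to 1 - exp(2πi(`phase` z - n - `phaseConst`))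
(`eventually_riemannAux_form`).

The derivative of `phase` has large positive real part far out in the sector |Im z| < Re z. So
`phase` is injective there and takes every value n + `phaseConst` with n large (`exists_phase_eq`).
A perturbation argument gives a true zero of R nearby, together with the inequality |s₀ - s| ≤
|R(s)| on an explicit region (`exists_isolated_zeros`). This inequality makes the zeros computable.
R can be evaluated by Riemann sums with explicit error (`CompC.riemannAux`), membership in the
region can be confirmed by an algorithm, and a search for a point of the region with |R| < 2^(-k)
finds an approximation of the zero (`compC_isolated_zeros`).

For the asymptotics, `phase` z = n + O(1) reads z²(log z - 1/2 - iπ/2) = n + O(|z|). This yields Re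
z² ~ n / log|z|, then from imaginary parts Im z² ~ (π/2) n / log²|z|, and log n ~ 2 log|z|; the
claim follows from s = -2πi z². Comparing the phases of consecutive zeros gives the order of the
imaginary parts (`im_sOf_lt_of_mem_zeroRegion`). Finitely many initial n are skipped by shifting the
index by a fixed N, which affects neither computability nor the asymptotics. -/

theorem Computable.nat_add' {f g : α → ℕ} (hf : Computable f) (hg : Computable g) :
    Computable fun a => f a + g a :=
  Primrec.nat_add.to_comp.comp hf hg

theorem Computable.nat_mul' {f g : α → ℕ} (hf : Computable f) (hg : Computable g) :
    Computable fun a => f a * g a :=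
  Primrec.nat_mul.to_comp.comp hf hg

theorem Computable.nat_pow' {f g : α → ℕ} (hf : Computable f) (hg : Computable g) :
    Computable fun a => f a ^ g a :=
  (Primrec₂.unpaired'.1 Nat.Primrec.pow).to_comp.comp hf hg

theorem Computable.nat_div' {f g : α → ℕ} (hf : Computable f) (hg : Computable g) :
    Computable fun a => f a / g a :=
  Primrec.nat_div.to_comp.comp hf hg

/-- Integer codes interleave: even for nonnegative, odd for negative integers. All integer
arithmetic is reduced to natural numbers by writing a = a⁺ - a⁻ and forming one such difference at
the end. -/
theorem encode_natCast_sub (p q : ℕ) :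
    Encodable.encode ((p : ℤ) - q) = if q ≤ p then 2 * (p - q) else 2 * (q - p - 1) + 1 := by
  have h1 : ∀ n : ℕ, Encodable.encode (n : ℤ) = 2 * n := fun n => rfl
  have h2 : ∀ n : ℕ, Encodable.encode (Int.negSucc n) = 2 * n + 1 := fun n => rfl
  split_ifs with h
  · rw [← h1]; congr 1; omega
  · rw [← h2]; congr 1; omega

theorem Computable.int_sub_nat {f g : α → ℕ} (hf : Computable f) (hg : Computable g) :
    Computable fun a => (f a : ℤ) - g a := by
  have : Primrec₂ fun p q : ℕ => (p : ℤ) - q := by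
    refine Primrec₂.encode_iff.1 ?_
    refine Primrec₂.of_eq (f := fun p q : ℕ => if q ≤ p then 2 * (p - q) else 2 * (q - p - 1) + 1)
      ?_ fun p q => (encode_natCast_sub p q).symm
    exact Primrec.ite (Primrec.nat_le.comp Primrec.snd Primrec.fst)
      (Primrec.nat_double.comp (Primrec.nat_sub.comp Primrec.fst Primrec.snd))
      (Primrec.nat_double_succ.comp (Primrec.nat_sub.comp
        (Primrec.nat_sub.comp Primrec.snd Primrec.fst) (Primrec.const 1)))
  exact this.to_comp.comp hf hg

theorem Computable.int_toNat {f : α → ℤ} (hf : Computable f) :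
    Computable fun a => (f a).toNat := by
  have : Primrec Int.toNat := by
    refine Primrec.of_eq (f := fun z : ℤ =>
      if Encodable.encode z % 2 = 0 then Encodable.encode z / 2 else 0) ?_ ?_
    · exact Primrec.ite (Primrec.eq.comp (Primrec.nat_mod.comp Primrec.encode (Primrec.const 2))
        (Primrec.const 0)) (Primrec.nat_div.comp Primrec.encode (Primrec.const 2))
        (Primrec.const 0)
    · rintro (n | n)
      · have : Encodable.encode (Int.ofNat n) = 2 * n := rfl
        rw [this]; simp
      · have : Encodable.encode (Int.negSucc n) = 2 * n + 1 := rfl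
        rw [this]; simp
  exact this.to_comp.comp hf

theorem Computable.int_toNat_neg {f : α → ℤ} (hf : Computable f) :
    Computable fun a => (-f a).toNat := by
  have : Primrec fun z : ℤ => (-z).toNat := by
    refine Primrec.of_eq (f := fun z : ℤ =>
      if Encodable.encode z % 2 = 0 then 0 else Encodable.encode z / 2 + 1) ?_ ?_
    · exact Primrec.ite (Primrec.eq.comp (Primrec.nat_mod.comp Primrec.encode (Primrec.const 2))
        (Primrec.const 0)) (Primrec.const 0)
        (Primrec.succ.comp (Primrec.nat_div.comp Primrec.encode (Primrec.const 2)))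
    · rintro (n | n)
      · have : Encodable.encode (Int.ofNat n) = 2 * n := rfl
        rw [this]; simp
      · have : Encodable.encode (Int.negSucc n) = 2 * n + 1 := rfl
        rw [this]; simp; omega
  exact this.to_comp.comp hf

theorem Computable.int_add {f g : α → ℤ} (hf : Computable f) (hg : Computable g) :
    Computable fun a => f a + g a :=
  (Computable.int_sub_nat (hf.int_toNat.nat_add' hg.int_toNat)
    (hf.int_toNat_neg.nat_add' hg.int_toNat_neg)).of_eq fun a => by
      omega

theorem Computable.int_neg {f : α → ℤ} (hf : Computable f) : Computable fun a => -f a :=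
  (Computable.int_sub_nat hf.int_toNat_neg hf.int_toNat).of_eq fun a => by omega

theorem Computable.int_sub {f g : α → ℤ} (hf : Computable f) (hg : Computable g) :
    Computable fun a => f a - g a :=
  (hf.int_add hg.int_neg).of_eq fun _ => (sub_eq_add_neg _ _).symm

theorem Computable.int_mul {f g : α → ℤ} (hf : Computable f) (hg : Computable g) :
    Computable fun a => f a * g a :=
  (Computable.int_sub_nat
    ((hf.int_toNat.nat_mul' hg.int_toNat).nat_add' (hf.int_toNat_neg.nat_mul' hg.int_toNat_neg))
    ((hf.int_toNat.nat_mul' hg.int_toNat_neg).nat_add'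
      (hf.int_toNat_neg.nat_mul' hg.int_toNat))).of_eq fun a => by
      push_cast
      have h1 : f a = (f a).toNat - (-f a).toNat := by omega
      have h2 : g a = (g a).toNat - (-g a).toNat := by omega
      conv_rhs => rw [h1, h2]
      ring

theorem Computable.int_natCast {f : α → ℕ} (hf : Computable f) : Computable fun a => (f a : ℤ) :=
  (Computable.int_sub_nat hf (Computable.const 0)).of_eq fun a => by simp

/-- The integer nearest to `p / d`. -/
def roundDiv (p : ℤ) (d : ℕ) : ℤ :=
  ((2 * p.toNat + d) / (2 * d) : ℕ) - ((2 * (-p).toNat + d) / (2 * d) : ℕ)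

theorem Computable.roundDiv {f : α → ℤ} {g : α → ℕ} (hf : Computable f) (hg : Computable g) :
    Computable fun a => roundDiv (f a) (g a) :=
  have h2 := Computable.const (α := α) 2
  Computable.int_sub_nat
    (((h2.nat_mul' hf.int_toNat).nat_add' hg).nat_div' (h2.nat_mul' hg))
    (((h2.nat_mul' hf.int_toNat_neg).nat_add' hg).nat_div' (h2.nat_mul' hg))

/-- The natural quotient `(2 * p + d) / (2 * d)` is ⌊p/d + 1/2⌋. -/
theorem abs_natCast_div_sub_le (p d : ℕ) (hd : 0 < d) :
    |(p : ℝ) / d - ((2 * p + d) / (2 * d) : ℕ)| ≤ 1 / 2 := by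
  have hd' : (0 : ℝ) < d := by exact_mod_cast hd
  set q := (2 * p + d) / (2 * d) with hq
  have h1 : q * (2 * d) ≤ 2 * p + d := Nat.div_mul_le_self _ _
  have h2 : 2 * p + d < (q + 1) * (2 * d) := by
    exact Nat.lt_mul_of_div_lt (Nat.lt_succ_self _) (by omega)
  have h1' : (q : ℝ) * (2 * d) ≤ 2 * p + d := by exact_mod_cast h1
  have h2' : 2 * (p : ℝ) + d < (q + 1) * (2 * d) := by exact_mod_cast h2
  rw [abs_le]
  constructor
  · rw [le_sub_iff_add_le, le_div_iff₀ hd']; nlinarith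
  · rw [sub_le_iff_le_add, div_le_iff₀ hd']; nlinarith

theorem abs_div_sub_roundDiv_le (p : ℤ) (d : ℕ) (hd : 0 < d) :
    |(p : ℝ) / d - roundDiv p d| ≤ 1 / 2 := by
  -- The part of `p` of the wrong sign is 0 and is rounded to 0, so only one of the two quotients in
  -- `roundDiv` survives.
  have hz : (2 * 0 + d) / (2 * d) = 0 := Nat.div_eq_of_lt (by omega)
  rw [roundDiv, Int.cast_sub, Int.cast_natCast, Int.cast_natCast]
  rcases le_total 0 p with h | h
  · have h0 : (-p).toNat = 0 := by omega
    obtain ⟨n, rfl⟩ := Int.eq_ofNat_of_zero_le h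
    rw [h0, hz, Int.toNat_natCast, Nat.cast_zero, sub_zero, Int.cast_natCast]
    exact abs_natCast_div_sub_le n d hd
  · have h0 : p.toNat = 0 := by omega
    obtain ⟨n, hn⟩ := Int.eq_ofNat_of_zero_le (neg_nonneg.2 h)
    obtain rfl : p = -n := by omega
    rw [h0, hz, neg_neg, Int.toNat_natCast, Nat.cast_zero, zero_sub, Int.cast_neg,
      Int.cast_natCast, neg_div, ← neg_sub', abs_neg]
    exact abs_natCast_div_sub_le n d hd

end IntArith

/-! ### Computable families of complex numbers -/

section CompC

/-- The Gaussian integer with given real and imaginary parts, as a complex number. -/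
noncomputable def gaussVal (p : ℤ × ℤ) : ℂ := (p.1 : ℂ) + (p.2 : ℂ) * Complex.I

theorem gaussVal_re (p : ℤ × ℤ) : (gaussVal p).re = p.1 := by simp [gaussVal]
theorem gaussVal_im (p : ℤ × ℤ) : (gaussVal p).im = p.2 := by simp [gaussVal]

variable {α β : Type*} [Primcodable α] [Primcodable β]

/-- A family of complex numbers that can be approximated to any precision by an algorithm. -/
def CompC (z : α → ℂ) : Prop :=
  ∃ f : α → ℕ → ℤ × ℤ, Computable₂ f ∧ ∀ a k, ‖z a - gaussVal (f a k) / 2 ^ k‖ ≤ 1 / (2 : ℝ) ^ k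

/-- The true bound is 1/√2; the value 3/4 leaves a quarter of the error budget for the approximation
in `CompC.of_approx`. -/
theorem norm_le_of_abs_le_half {w : ℂ} (h1 : |w.re| ≤ 1 / 2) (h2 : |w.im| ≤ 1 / 2) :
    ‖w‖ ≤ 3 / 4 := by
  refine abs_le_of_sq_le_sq' ?_ (by norm_num) |>.2
  rw [Complex.sq_norm, Complex.normSq_apply]
  have := sq_le_sq' (abs_le.1 h1).1 (abs_le.1 h1).2
  have := sq_le_sq' (abs_le.1 h2).1 (abs_le.1 h2).2
  nlinarith

/-- Arbitrary denominators are allowed: rounding 2^k times the approximation to a Gaussian integer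
costs at most 3/4 · 2^(-k), which fits with the 1/4 · 2^(-k) assumed. -/
theorem CompC.of_approx {z : α → ℂ} (f : α → ℕ → ℤ × ℤ) (d : α → ℕ → ℕ) (hf : Computable₂ f)
    (hd : Computable₂ d) (hd0 : ∀ a k, 0 < d a k)
    (h : ∀ a k, ‖z a - gaussVal (f a k) / d a k‖ ≤ 1 / 4 / 2 ^ k) : CompC z := by
  have hp : Computable fun p : α × ℕ => 2 ^ p.2 :=
    Computable.nat_pow' (Computable.const 2) Computable.snd
  have hf' : Computable fun p : α × ℕ => f p.1 p.2 := hf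
  refine ⟨fun a k => (roundDiv ((f a k).1 * ((2 ^ k : ℕ) : ℤ)) (d a k),
    roundDiv ((f a k).2 * ((2 ^ k : ℕ) : ℤ)) (d a k)), ?_, fun a k => ?_⟩
  · exact Computable.pair
      (Computable.roundDiv ((Computable.fst.comp hf').int_mul hp.int_natCast) hd)
      (Computable.roundDiv ((Computable.snd.comp hf').int_mul hp.int_natCast) hd)
  · have e1 := abs_div_sub_roundDiv_le ((f a k).1 * ((2 ^ k : ℕ) : ℤ)) _ (hd0 a k)
    have e2 := abs_div_sub_roundDiv_le ((f a k).2 * ((2 ^ k : ℕ) : ℤ)) _ (hd0 a k)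
    set r1 := roundDiv ((f a k).1 * ((2 ^ k : ℕ) : ℤ)) (d a k)
    set r2 := roundDiv ((f a k).2 * ((2 ^ k : ℕ) : ℤ)) (d a k)
    have hdC : (d a k : ℂ) ≠ 0 := by exact_mod_cast (hd0 a k).ne'
    have hdR : (d a k : ℝ) ≠ 0 := by exact_mod_cast (hd0 a k).ne'
    have key : ‖gaussVal (f a k) * 2 ^ k / d a k - gaussVal (r1, r2)‖ ≤ 3 / 4 := by
      have hcast : gaussVal (f a k) * 2 ^ k / d a k
          = (((((f a k).1 * 2 ^ k : ℤ) : ℝ) / d a k : ℝ) : ℂ)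
            + (((((f a k).2 * 2 ^ k : ℤ) : ℝ) / d a k : ℝ) : ℂ) * Complex.I := by
        simp only [gaussVal]; push_cast; ring
      rw [hcast]
      push_cast at e1 e2
      apply norm_le_of_abs_le_half
      · rw [Complex.sub_re, gaussVal_re, Complex.add_re, Complex.ofReal_re, Complex.re_ofReal_mul,
          Complex.I_re, mul_zero, add_zero]
        push_cast; exact e1
      · rw [Complex.sub_im, gaussVal_im, Complex.add_im, Complex.ofReal_im, Complex.im_ofReal_mul,
          Complex.I_im, mul_one, zero_add]
        push_cast; exact e2
    have h2 : (0 : ℝ) < 2 ^ k := by positivity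
    have : z a - gaussVal (r1, r2) / 2 ^ k = (z a - gaussVal (f a k) / d a k)
        + (gaussVal (f a k) * 2 ^ k / d a k - gaussVal (r1, r2)) / 2 ^ k := by
      field_simp; ring
    rw [this]
    refine (norm_add_le _ _).trans ?_
    rw [norm_div, norm_pow, Complex.norm_ofNat]
    calc _ ≤ 1 / 4 / (2 : ℝ) ^ k + 3 / 4 / 2 ^ k := by gcongr; exact h a k
      _ = _ := by ring

theorem CompC.congr {z w : α → ℂ} (hz : CompC z) (h : ∀ a, z a = w a) : CompC w := by
  rwa [← funext h]

theorem CompC.comp {z : β → ℂ} (hz : CompC z) {g : α → β} (hg : Computable g) :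
    CompC fun a => z (g a) := by
  obtain ⟨f, hf, h⟩ := hz
  exact ⟨fun a k => f (g a) k, hf.comp (hg.comp Computable.fst) Computable.snd,
    fun a k => h _ _⟩

theorem CompC.gauss_div {p : α → ℤ × ℤ} {d : α → ℕ} (hp : Computable p) (hd : Computable d)
    (hd0 : ∀ a, 0 < d a) : CompC fun a => gaussVal (p a) / d a :=
  CompC.of_approx (fun a _ => p a) (fun a _ => d a) (hp.comp Computable.fst)
    (hd.comp Computable.fst) (fun a _ => hd0 a) fun a k => by rw [sub_self, norm_zero]; positivity

theorem CompC.natCast {f : α → ℕ} (hf : Computable f) : CompC fun a => (f a : ℂ) :=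
  (CompC.gauss_div (hf.int_natCast.pair (Computable.const 0)) (Computable.const 1)
    fun _ => one_pos).congr fun a => by simp [gaussVal]

theorem CompC.const_I : CompC fun _ : α => Complex.I :=
  (CompC.gauss_div (Computable.const ((0 : ℤ), (1 : ℤ))) (Computable.const 1)
    fun _ => one_pos).congr fun a => by simp [gaussVal]

theorem CompC.const_natCast (n : ℕ) : CompC fun _ : α => (n : ℂ) :=
  CompC.natCast (Computable.const n)

theorem CompC.const_ofNat (n : ℕ) [n.AtLeastTwo] : CompC fun _ : α => (OfNat.ofNat n : ℂ) :=
  (CompC.const_natCast n).congr fun _ => (Nat.cast_ofNat : ((OfNat.ofNat n : ℕ) : ℂ) = _)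

theorem CompC.const_one : CompC fun _ : α => (1 : ℂ) :=
  (CompC.const_natCast 1).congr fun _ => by simp

theorem Computable.two_pow {f : α → ℕ} (hf : Computable f) : Computable fun a => 2 ^ f a :=
  Computable.nat_pow' (Computable.const 2) hf

theorem CompC.add {z w : α → ℂ} (hz : CompC z) (hw : CompC w) : CompC fun a => z a + w a := by
  obtain ⟨f, hf, h⟩ := hz
  obtain ⟨g, hg, h'⟩ := hw
  -- Three extra bits: two errors of 2^(-k-3) make up exactly the allowed 1/4 · 2^(-k).
  have hk : Computable fun p : α × ℕ => p.2 + 3 :=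
    Computable.nat_add' Computable.snd (Computable.const 3)
  have hf' : Computable fun p : α × ℕ => f p.1 (p.2 + 3) := hf.comp Computable.fst hk
  have hg' : Computable fun p : α × ℕ => g p.1 (p.2 + 3) := hg.comp Computable.fst hk
  refine CompC.of_approx (fun a k => ((f a (k + 3)).1 + (g a (k + 3)).1,
    (f a (k + 3)).2 + (g a (k + 3)).2)) (fun a k => 2 ^ (k + 3)) ?_ (Computable.two_pow hk)
    (fun _ _ => by positivity) fun a k => ?_
  · exact ((Computable.fst.comp hf').int_add (Computable.fst.comp hg')).pair
      ((Computable.snd.comp hf').int_add (Computable.snd.comp hg'))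
  · have : z a + w a - gaussVal ((f a (k + 3)).1 + (g a (k + 3)).1,
        (f a (k + 3)).2 + (g a (k + 3)).2) / ((2 ^ (k + 3) : ℕ) : ℂ)
        = (z a - gaussVal (f a (k + 3)) / 2 ^ (k + 3))
          + (w a - gaussVal (g a (k + 3)) / 2 ^ (k + 3)) := by
      simp only [gaussVal]; push_cast; ring
    rw [this]
    refine (norm_add_le _ _).trans ((add_le_add (h _ _) (h' _ _)).trans (le_of_eq ?_))
    rw [pow_add]; field_simp; norm_num

theorem CompC.neg {z : α → ℂ} (hz : CompC z) : CompC fun a => -z a := by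
  obtain ⟨f, hf, h⟩ := hz
  have hf' : Computable fun p : α × ℕ => f p.1 p.2 := hf
  refine ⟨fun a k => (-(f a k).1, -(f a k).2),
    ((Computable.fst.comp hf').int_neg).pair ((Computable.snd.comp hf').int_neg), fun a k => ?_⟩
  rw [← norm_neg]
  refine le_trans (le_of_eq ?_) (h a k)
  congr 1
  simp only [gaussVal]; push_cast; ring

theorem CompC.sub {z w : α → ℂ} (hz : CompC z) (hw : CompC w) : CompC fun a => z a - w a :=
  (hz.add hw.neg).congr fun _ => (sub_eq_add_neg _ _).symm

theorem norm_gaussVal_le (p : ℤ × ℤ) :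
    ‖gaussVal p‖ ≤ (p.1.toNat + (-p.1).toNat + (p.2.toNat + (-p.2).toNat) : ℕ) := by
  refine (Complex.norm_le_abs_re_add_abs_im _).trans ?_
  rw [gaussVal_re, gaussVal_im]
  have h0 : ∀ n : ℤ, |n| = (n.toNat + (-n).toNat : ℕ) := fun n => by
    rcases abs_cases n with h | h <;> omega
  have h1 := h0 p.1
  have h2 := h0 p.2
  rw [← Int.cast_abs, ← Int.cast_abs, h1, h2]
  push_cast; rfl

/-- The precision needed for products, exponentials and integrals depends on the size of the
arguments, so that size must itself be computable. -/
theorem CompC.exists_bound {z : α → ℂ} (hz : CompC z) :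
    ∃ B : α → ℕ, Computable B ∧ ∀ a, ‖z a‖ ≤ B a := by
  obtain ⟨f, hf, h⟩ := hz
  have hf' : Computable fun a : α => f a 0 := hf.comp Computable.id (Computable.const 0)
  have h1 := Computable.fst.comp hf'
  have h2 := Computable.snd.comp hf'
  refine ⟨fun a => (f a 0).1.toNat + (-(f a 0).1).toNat +
    ((f a 0).2.toNat + (-(f a 0).2).toNat) + 1,
    ((h1.int_toNat.nat_add' h1.int_toNat_neg).nat_add'
      (h2.int_toNat.nat_add' h2.int_toNat_neg)).nat_add' (Computable.const 1), fun a => ?_⟩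
  have e := h a 0
  simp only [pow_zero, div_one] at e
  have := norm_sub_norm_le (z a) (gaussVal (f a 0))
  have := norm_gaussVal_le (f a 0)
  rw [Nat.cast_add_one]
  linarith

/-- The product of two Gaussian integers given by pairs. -/
def gaussMul (p q : ℤ × ℤ) : ℤ × ℤ := (p.1 * q.1 - p.2 * q.2, p.1 * q.2 + p.2 * q.1)

theorem gaussVal_mul (p q : ℤ × ℤ) : gaussVal (gaussMul p q) = gaussVal p * gaussVal q := by
  apply Complex.ext <;> simp [gaussVal, gaussMul]

theorem Computable.gaussMul {f g : α → ℤ × ℤ} (hf : Computable f) (hg : Computable g) :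
    Computable fun a => gaussMul (f a) (g a) :=
  have f1 := Computable.fst.comp hf
  have f2 := Computable.snd.comp hf
  have g1 := Computable.fst.comp hg
  have g2 := Computable.snd.comp hg
  ((f1.int_mul g1).int_sub (f2.int_mul g2)).pair ((f1.int_mul g2).int_add (f2.int_mul g1))

/-- By B ≤ 2^B, spending B further bits absorbs a factor B; no logarithm of B is needed. -/
theorem natCast_mul_div_two_pow_le (B k : ℕ) :
    (B : ℝ) * (1 / 2 ^ (k + 2 + B)) ≤ 1 / 4 / 2 ^ k := by
  have h2 : (B : ℝ) ≤ 2 ^ B := by exact_mod_cast Nat.lt_two_pow_self.le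
  rw [pow_add, pow_add, mul_one_div, div_le_div_iff₀ (by positivity) (by positivity)]
  have : (0 : ℝ) < 2 ^ k := by positivity
  nlinarith

theorem CompC.mul {z w : α → ℂ} (hz : CompC z) (hw : CompC w) : CompC fun a => z a * w a := by
  obtain ⟨B, hB, hzB⟩ := hz.exists_bound
  obtain ⟨B', hB', hwB⟩ := hw.exists_bound
  obtain ⟨f, hf, h⟩ := hz
  obtain ⟨g, hg, h'⟩ := hw
  set K : α → ℕ → ℕ := fun a k => k + 2 + (B a + B' a + 1) with hK
  have hk : Computable fun p : α × ℕ => K p.1 p.2 :=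
    (Computable.snd.nat_add' (Computable.const 2)).nat_add'
      (((hB.comp Computable.fst).nat_add' (hB'.comp Computable.fst)).nat_add' (Computable.const 1))
  have hf' : Computable fun p : α × ℕ => f p.1 (K p.1 p.2) := hf.comp Computable.fst hk
  have hg' : Computable fun p : α × ℕ => g p.1 (K p.1 p.2) := hg.comp Computable.fst hk
  refine CompC.of_approx (fun a k => gaussMul (f a (K a k)) (g a (K a k)))
    (fun a k => 2 ^ K a k * 2 ^ K a k) (hf'.gaussMul hg')
    ((Computable.two_pow hk).nat_mul' (Computable.two_pow hk)) (fun _ _ => by positivity)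
    fun a k => ?_
  have hz1 := h a (K a k)
  have hw1 := h' a (K a k)
  set z' := gaussVal (f a (K a k)) / 2 ^ K a k
  set w' := gaussVal (g a (K a k)) / 2 ^ K a k
  have e : z a * w a - gaussVal (gaussMul (f a (K a k)) (g a (K a k))) /
      ((2 ^ K a k * 2 ^ K a k : ℕ) : ℂ) = z a * (w a - w') + (z a - z') * w' := by
    rw [gaussVal_mul]; push_cast; simp only [z', w']; ring
  have hpow : 1 / (2 : ℝ) ^ K a k ≤ 1 := by
    rw [div_le_one (by positivity)]; exact one_le_pow₀ (by norm_num)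
  have hw2 : ‖w'‖ ≤ B' a + 1 := by
    have := norm_sub_norm_le w' (w a)
    rw [norm_sub_rev] at this
    linarith [hwB a]
  have hpos : (0 : ℝ) ≤ 1 / 2 ^ K a k := by positivity
  rw [e]
  calc _ ≤ ‖z a‖ * ‖w a - w'‖ + ‖z a - z'‖ * ‖w'‖ := by
        refine (norm_add_le _ _).trans ?_
        rw [norm_mul, norm_mul]
    _ ≤ B a * (1 / 2 ^ K a k) + (1 / 2 ^ K a k) * (B' a + 1) := by
        gcongr
        exact hzB a
    _ = ((B a + B' a + 1 : ℕ) : ℝ) * (1 / 2 ^ K a k) := by push_cast; ring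
    _ ≤ _ := natCast_mul_div_two_pow_le _ _

theorem CompC.pow_two {z : α → ℂ} (hz : CompC z) : CompC fun a => z a ^ 2 :=
  (hz.mul hz).congr fun _ => (sq _).symm

theorem CompC.limit {y : α × ℕ → ℂ} {x : α → ℂ} (hy : CompC y)
    (h : ∀ a k, ‖x a - y (a, k)‖ ≤ 1 / 2 ^ k) : CompC x := by
  obtain ⟨f, hf, h'⟩ := hy
  have hk : Computable fun p : α × ℕ => p.2 + 3 :=
    Computable.nat_add' Computable.snd (Computable.const 3)
  refine CompC.of_approx (fun a k => f (a, k + 3) (k + 3)) (fun a k => 2 ^ (k + 3))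
    (hf.comp (Computable.fst.pair hk) hk) (Computable.two_pow hk) (fun _ _ => by positivity)
    fun a k => ?_
  have e : x a - gaussVal (f (a, k + 3) (k + 3)) / ((2 ^ (k + 3) : ℕ) : ℂ) = (x a - y (a, k + 3))
      + (y (a, k + 3) - gaussVal (f (a, k + 3) (k + 3)) / 2 ^ (k + 3)) := by push_cast; ring
  rw [e]
  refine (norm_add_le _ _).trans ((add_le_add (h _ _) (h' _ _)).trans (le_of_eq ?_))
  rw [pow_add]; field_simp; norm_num

theorem Computable.gaussSum {f : α × ℕ → ℤ × ℤ} (hf : Computable f) {N : α → ℕ}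
    (hN : Computable N) : Computable fun a =>
      ((∑ i ∈ Finset.range (N a), (f (a, i)).1, ∑ i ∈ Finset.range (N a), (f (a, i)).2) :
        ℤ × ℤ) := by
  have hfi : Computable fun p : α × (ℕ × (ℤ × ℤ)) => f (p.1, p.2.1) :=
    hf.comp (Computable.fst.pair (Computable.fst.comp Computable.snd))
  have hS : Computable fun p : α × (ℕ × (ℤ × ℤ)) => p.2.2 := Computable.snd.comp Computable.snd
  refine (Computable.nat_rec (h := fun a p => ((p.2.1 + (f (a, p.1)).1, p.2.2 + (f (a, p.1)).2) :
    ℤ × ℤ)) hN (Computable.const ((0 : ℤ), (0 : ℤ))) ?_).of_eq fun a => ?_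
  · exact ((Computable.fst.comp hS).int_add (Computable.fst.comp hfi)).pair
      ((Computable.snd.comp hS).int_add (Computable.snd.comp hfi))
  · induction N a with
    | zero => rfl
    | succ n ih => simp only [ih, Finset.sum_range_succ]

theorem gaussVal_sum (s : Finset ℕ) (f : ℕ → ℤ × ℤ) :
    gaussVal (∑ i ∈ s, (f i).1, ∑ i ∈ s, (f i).2) = ∑ i ∈ s, gaussVal (f i) := by
  simp [gaussVal, Finset.sum_add_distrib, Finset.sum_mul]

theorem CompC.sum {x : α × ℕ → ℂ} (hx : CompC x) {N : α → ℕ} (hN : Computable N) :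
    CompC fun a => ∑ i ∈ Finset.range (N a), x (a, i) := by
  obtain ⟨f, hf, h⟩ := hx
  set K : α → ℕ → ℕ := fun a k => k + 2 + N a with hK
  have hk : Computable fun p : α × ℕ => K p.1 p.2 :=
    (Computable.snd.nat_add' (Computable.const 2)).nat_add' (hN.comp Computable.fst)
  refine CompC.of_approx (fun a k => (∑ i ∈ Finset.range (N a), (f (a, i) (K a k)).1,
    ∑ i ∈ Finset.range (N a), (f (a, i) (K a k)).2)) (fun a k => 2 ^ K a k) ?_
    (Computable.two_pow hk) (fun _ _ => by positivity) fun a k => ?_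
  · exact Computable.gaussSum (α := α × ℕ) (f := fun p => f (p.1.1, p.2) (K p.1.1 p.1.2))
      (hf.comp ((Computable.fst.comp Computable.fst).pair Computable.snd)
        (hk.comp Computable.fst)) (hN.comp Computable.fst)
  · rw [gaussVal_sum (Finset.range (N a)) fun i => f (a, i) (K a k), Finset.sum_div,
      ← Finset.sum_sub_distrib]
    refine (norm_sum_le _ _).trans ?_
    calc _ ≤ ∑ _i ∈ Finset.range (N a), 1 / (2 : ℝ) ^ K a k := by
          refine Finset.sum_le_sum fun i _ => ?_
          have := h (a, i) (K a k)
          simpa using this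
      _ = N a * (1 / (2 : ℝ) ^ K a k) := by simp
      _ ≤ _ := natCast_mul_div_two_pow_le _ _

/-! ### Semidecidable conditions and search -/

/-- A property which can be confirmed by an algorithm whenever it holds. -/
def SemiDec (P : α → Prop) : Prop :=
  ∃ t : α → ℕ → Bool, Computable₂ t ∧ ∀ a, P a ↔ ∃ m, t a m = true

theorem SemiDec.and {P Q : α → Prop} (hP : SemiDec P) (hQ : SemiDec Q) :
    SemiDec fun a => P a ∧ Q a := by
  obtain ⟨t, ht, h⟩ := hP
  obtain ⟨u, hu, h'⟩ := hQ
  have hn : Computable fun p : α × ℕ => p.2.unpair := Computable.unpair.comp Computable.snd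
  refine ⟨fun a m => t a m.unpair.1 && u a m.unpair.2, ?_, fun a => ?_⟩
  · exact Primrec.and.to_comp.comp (ht.comp Computable.fst (Computable.fst.comp hn))
      (hu.comp Computable.fst (Computable.snd.comp hn))
  · change P a ∧ Q a ↔ _
    rw [h, h']
    constructor
    · rintro ⟨⟨m, hm⟩, n, hn⟩
      exact ⟨Nat.pair m n, by simp [hm, hn]⟩
    · rintro ⟨m, hm⟩
      rw [Bool.and_eq_true] at hm
      exact ⟨⟨_, hm.1⟩, _, hm.2⟩

/-- Numerator at least 2 at precision k certifies a real part of at least 2^(-k). Conversely a real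
part above 3 · 2^(-k) forces such a numerator. -/
theorem CompC.semiDec_re_pos {x : α → ℂ} (hx : CompC x) : SemiDec fun a => 0 < (x a).re := by
  obtain ⟨f, hf, h⟩ := hx
  have hf' : Computable fun p : α × ℕ => (f p.1 p.2).1 := Computable.fst.comp hf
  refine ⟨fun a k => decide (2 ≤ (f a k).1.toNat), ?_, fun a => ?_⟩
  · exact Primrec.nat_le.decide.to_comp.comp (Computable.const 2) hf'.int_toNat
  · have key : ∀ k, |(x a).re - (f a k).1 / 2 ^ k| ≤ 1 / 2 ^ k := fun k => by
      refine le_trans (le_of_eq ?_) ((Complex.abs_re_le_norm _).trans (h a k))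
      rw [Complex.sub_re]
      congr 2
      have : gaussVal (f a k) / 2 ^ k = gaussVal (f a k) / ((2 ^ k : ℝ) : ℂ) := by push_cast; rfl
      rw [this, Complex.div_ofReal_re, gaussVal_re]
    constructor
    · intro hpos
      obtain ⟨k, hk⟩ := exists_pow_lt_of_lt_one (show 0 < (x a).re / 3 by positivity)
        (show (1 / 2 : ℝ) < 1 by norm_num)
      refine ⟨k, ?_⟩
      have h2 : (0 : ℝ) < 2 ^ k := by positivity
      rw [one_div_pow] at hk
      have h3 : (2 : ℝ) / 2 ^ k < (f a k).1 / 2 ^ k := by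
        have := abs_le.1 (key k)
        have e : (2 : ℝ) / 2 ^ k = 2 * (1 / 2 ^ k) := by ring
        rw [e]; linarith
      rw [div_lt_div_iff_of_pos_right h2] at h3
      have h4 : 2 < (f a k).1 := by exact_mod_cast h3
      simp only [decide_eq_true_eq]; omega
    · rintro ⟨k, hk⟩
      simp only [decide_eq_true_eq] at hk
      have h4 : 2 ≤ (f a k).1 := by omega
      have h5 : (2 : ℝ) ≤ (f a k).1 := by exact_mod_cast h4
      have h3 : (2 : ℝ) / 2 ^ k ≤ (f a k).1 / 2 ^ k := by gcongr
      have := abs_le.1 (key k)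
      have e : (2 : ℝ) / 2 ^ k = 2 * (1 / 2 ^ k) := by ring
      have : (0 : ℝ) < 1 / 2 ^ k := by positivity
      rw [e] at h3; linarith

theorem CompC.conj {z : α → ℂ} (hz : CompC z) : CompC fun a => (starRingEnd ℂ) (z a) := by
  obtain ⟨f, hf, h⟩ := hz
  have hf' : Computable fun p : α × ℕ => f p.1 p.2 := hf
  refine ⟨fun a k => ((f a k).1, -(f a k).2),
    (Computable.fst.comp hf').pair ((Computable.snd.comp hf').int_neg), fun a k => ?_⟩
  rw [← RCLike.norm_conj]
  refine le_trans (le_of_eq ?_) (h a k)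
  congr 1
  have : (starRingEnd ℂ) 2 = 2 := Complex.conj_ofNat 2
  simp [gaussVal, this]

/-- Apply the positivity test to 1 - x x̄ = 1 - |x|². -/
theorem CompC.semiDec_norm_lt_one {x : α → ℂ} (hx : CompC x) : SemiDec fun a => ‖x a‖ < 1 := by
  obtain ⟨t, ht, h⟩ := (CompC.const_one.sub (hx.mul hx.conj)).semiDec_re_pos
  refine ⟨t, ht, fun a => ?_⟩
  rw [← h]
  change _ ↔ 0 < (1 - x a * (starRingEnd ℂ) (x a)).re
  rw [Complex.mul_conj, Complex.sub_re, Complex.one_re, Complex.ofReal_re,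
    Complex.normSq_eq_norm_sq, sub_pos, sq_lt_one_iff₀ (norm_nonneg _)]

/-- Unbounded search over pairs (candidate, stage of its confirmation), so that a candidate which is
never confirmed does not block the search. -/
theorem SemiDec.exists_computable {P : α × ℕ → Prop} (hP : SemiDec P) (h : ∀ a, ∃ q, P (a, q)) :
    ∃ g : α → ℕ, Computable g ∧ ∀ a, P (a, g a) := by
  obtain ⟨t, ht, hPt⟩ := hP
  have hn : Computable fun p : α × ℕ => p.2.unpair := Computable.unpair.comp Computable.snd
  have hT : Computable₂ fun (a : α) (m : ℕ) => t (a, m.unpair.1) m.unpair.2 :=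
    ht.comp (Computable.fst.pair (Computable.fst.comp hn)) (Computable.snd.comp hn)
  have hex : ∀ a, ∃ m, t (a, (Nat.unpair m).1) (Nat.unpair m).2 = true := fun a => by
    obtain ⟨q, hq⟩ := h a
    obtain ⟨m, hm⟩ := (hPt _).1 hq
    exact ⟨Nat.pair q m, by simpa using hm⟩
  classical
  have hfind : Computable fun a => Nat.find (hex a) := by
    refine Partrec.of_eq_tot (Partrec.rfind (p := fun (a : α) (m : ℕ) =>
      Part.some (t (a, m.unpair.1) m.unpair.2)) hT.partrec₂) fun a => ?_
    refine Nat.mem_rfind.2 ⟨by simpa using (Nat.find_spec (hex a)).symm, fun {m} hm => ?_⟩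
    have := Nat.find_min (hex a) hm
    simpa using this
  refine ⟨fun a => (Nat.unpair (Nat.find (hex a))).1,
    Computable.fst.comp (Computable.unpair.comp hfind), fun a => ?_⟩
  exact (hPt _).2 ⟨_, Nat.find_spec (hex a)⟩

/-- An enumeration of the dyadic Gaussian rationals. -/
noncomputable def dyadic (q : ℕ) : ℂ :=
  gaussVal (Denumerable.ofNat ((ℤ × ℤ) × ℕ) q).1 /
    ((2 ^ (Denumerable.ofNat ((ℤ × ℤ) × ℕ) q).2 : ℕ) : ℂ)

theorem compC_dyadic {q : α → ℕ} (hq : Computable q) : CompC fun a => dyadic (q a) :=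
  have h := (Computable.ofNat ((ℤ × ℤ) × ℕ)).comp hq
  CompC.gauss_div (Computable.fst.comp h) (Computable.two_pow (Computable.snd.comp h))
    fun _ => by positivity

theorem exists_dyadic_norm_sub_lt (z : ℂ) {ε : ℝ} (hε : 0 < ε) : ∃ q, ‖dyadic q - z‖ < ε := by
  obtain ⟨k, hk⟩ := exists_pow_lt_of_lt_one hε (show (1 / 2 : ℝ) < 1 by norm_num)
  have h2 : (0 : ℝ) < 2 ^ k := by positivity
  refine ⟨Encodable.encode (((round (z.re * 2 ^ k), round (z.im * 2 ^ k)), k) : (ℤ × ℤ) × ℕ), ?_⟩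
  rw [dyadic, Denumerable.ofNat_encode]
  have e : gaussVal (round (z.re * 2 ^ k), round (z.im * 2 ^ k)) / ((2 ^ k : ℕ) : ℂ) - z
      = (gaussVal (round (z.re * 2 ^ k), round (z.im * 2 ^ k)) - z * ((2 ^ k : ℝ) : ℂ)) / 2 ^ k := by
    push_cast; field_simp
  simp only [e]
  rw [norm_div, norm_pow, Complex.norm_ofNat, div_lt_iff₀ h2]
  have h3 : ‖gaussVal (round (z.re * 2 ^ k), round (z.im * 2 ^ k)) - z * ((2 ^ k : ℝ) : ℂ)‖
      ≤ 3 / 4 := by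
    apply norm_le_of_abs_le_half
    · rw [Complex.sub_re, gaussVal_re, Complex.re_mul_ofReal, abs_sub_comm]
      exact abs_sub_round _
    · rw [Complex.sub_im, gaussVal_im, Complex.im_mul_ofReal, abs_sub_comm]
      exact abs_sub_round _
  rw [one_div_pow, div_lt_iff₀ h2] at hk
  linarith

/-- A point is computable if approximations of it can be recognized by an algorithm. -/
theorem CompC.of_search {x : α → ℂ} {y : (α × ℕ) × ℕ → ℂ} {P : (α × ℕ) × ℕ → Prop}
    (hy : CompC y) (hP : SemiDec P) (hex : ∀ a k, ∃ q, P ((a, k), q))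
    (h : ∀ a k q, P ((a, k), q) → ‖x a - y ((a, k), q)‖ ≤ 1 / 2 ^ k) : CompC x := by
  obtain ⟨g, hg, hg'⟩ := hP.exists_computable fun p => hex p.1 p.2
  exact CompC.limit (hy.comp (Computable.id.pair hg)) fun a k => h a k _ (hg' _)

end CompC

/-! ### Elementary functions on computable families -/

section Elementary

variable {α : Type*} [Primcodable α]

theorem CompC.two_pow {f : α → ℕ} (hf : Computable f) : CompC fun a => (2 : ℂ) ^ f a :=
  (CompC.natCast (Computable.two_pow hf)).congr fun a => by push_cast; rfl

theorem norm_two_pow_mul_lt_one {k : ℕ} {w : ℂ} : ‖2 ^ k * w‖ < 1 ↔ ‖w‖ < 1 / 2 ^ k := by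
  rw [norm_mul, norm_pow, Complex.norm_ofNat, lt_div_iff₀' (by positivity)]

/-- If `w` is the only point where `f` vanishes in a region, then it can be found by search. -/
theorem CompC.of_search_zero {x : α → ℂ} {f : α × ℕ → ℂ} {P : α × ℕ → Prop}
    (hf : CompC f) (hP : SemiDec P)
    (hex : ∀ a, ∀ ε > 0, ∃ q, P (a, q) ∧ ‖f (a, q)‖ < ε)
    (h : ∀ a q, P (a, q) → ‖x a - dyadic q‖ ≤ ‖f (a, q)‖) : CompC x := by
  have hj : Computable fun p : (α × ℕ) × ℕ => (p.1.1, p.2) :=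
    (Computable.fst.comp Computable.fst).pair Computable.snd
  have hP' : SemiDec fun p : (α × ℕ) × ℕ => P (p.1.1, p.2) := by
    obtain ⟨t, ht, h⟩ := hP
    exact ⟨fun p m => t (p.1.1, p.2) m, ht.comp (hj.comp Computable.fst) Computable.snd,
      fun a => h _⟩
  have hN : CompC fun p : (α × ℕ) × ℕ => 2 ^ p.1.2 * f (p.1.1, p.2) :=
    (CompC.two_pow (Computable.snd.comp Computable.fst)).mul (hf.comp hj)
  refine CompC.of_search (compC_dyadic Computable.snd) (hP'.and hN.semiDec_norm_lt_one)
    (fun a k => ?_) fun a k q hq => ?_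
  · obtain ⟨q, hq, hq'⟩ := hex a (1 / 2 ^ k) (by positivity)
    exact ⟨q, hq, norm_two_pow_mul_lt_one.2 hq'⟩
  · exact (h a q hq.1).trans (norm_two_pow_mul_lt_one.1 hq.2).le

theorem exists_dyadic_of_eventually {z : ℂ} {p : ℂ → Prop} (h : ∀ᶠ w in nhds z, p w) :
    ∃ q, p (dyadic q) := by
  obtain ⟨ε, hε, h⟩ := Metric.eventually_nhds_iff.1 h
  obtain ⟨q, hq⟩ := exists_dyadic_norm_sub_lt z hε
  exact ⟨q, h (by rwa [dist_eq_norm])⟩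

/-- Search for q with |zq - 1| < 1/2. Then |z||q| ≥ 1/2, hence |1/z - q| = |zq - 1| / |z| ≤ 2|q||zq
- 1|, a bound free of division and thus already computable. -/
theorem CompC.inv {z : α → ℂ} (hz : CompC z) (h0 : ∀ a, z a ≠ 0) : CompC fun a => (z a)⁻¹ := by
  have hd : CompC fun p : α × ℕ => dyadic p.2 := compC_dyadic Computable.snd
  have hr : CompC fun p : α × ℕ => z p.1 * dyadic p.2 - 1 :=
    ((hz.comp Computable.fst).mul hd).sub CompC.const_one
  have h2 : CompC fun p : α × ℕ => 2 * (z p.1 * dyadic p.2 - 1) := (CompC.const_ofNat 2).mul hr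
  refine CompC.of_search_zero (f := fun p => 2 * dyadic p.2 * (z p.1 * dyadic p.2 - 1))
    (P := fun p => ‖2 * (z p.1 * dyadic p.2 - 1)‖ < 1) (((CompC.const_ofNat 2).mul hd).mul hr)
    h2.semiDec_norm_lt_one (fun a ε hε => ?_) fun a q hq => ?_
  · have hc : ContinuousAt (fun w => ‖2 * (z a * w - 1)‖) (z a)⁻¹ := by fun_prop
    have hc' : ContinuousAt (fun w => ‖2 * w * (z a * w - 1)‖) (z a)⁻¹ := by fun_prop
    exact exists_dyadic_of_eventually ((hc.eventually_lt_const (by simp [h0 a])).and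
      (hc'.eventually_lt_const (by simpa [h0 a] using hε)))
  · simp only [norm_mul, Complex.norm_ofNat] at hq ⊢
    set q' := dyadic q
    have hzq : 1 / 2 ≤ ‖z a‖ * ‖q'‖ := by
      have := norm_sub_norm_le (1 : ℂ) (-(z a * q' - 1))
      rw [norm_neg, norm_one, sub_neg_eq_add, add_sub_cancel, norm_mul] at this
      linarith
    have hza : 0 < ‖z a‖ := norm_pos_iff.2 (h0 a)
    have e : (z a)⁻¹ - q' = -(z a * q' - 1) / z a := by field_simp [h0 a]; ring
    rw [e, norm_div, norm_neg, div_le_iff₀ hza]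
    nlinarith [norm_nonneg (z a * q' - 1)]

theorem CompC.div {z w : α → ℂ} (hz : CompC z) (hw : CompC w) (h0 : ∀ a, w a ≠ 0) :
    CompC fun a => z a / w a :=
  (hz.mul (hw.inv h0)).congr fun _ => (div_eq_mul_inv _ _).symm

theorem Computable.factorial {f : α → ℕ} (hf : Computable f) :
    Computable fun a => (f a).factorial := by
  refine (Computable.nat_rec (h := fun _ p => (p.1 + 1) * p.2) hf (Computable.const 1) ?_).of_eq
    fun a => ?_
  · exact (Computable.nat_add' (Computable.fst.comp Computable.snd) (Computable.const 1)).nat_mul'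
      (Computable.snd.comp Computable.snd)
  · induction f a with
    | zero => rfl
    | succ n ih => simp only [ih, Nat.factorial_succ]

/-- Powers of a Gaussian integer given by a pair. -/
def gaussPow (p : ℤ × ℤ) : ℕ → ℤ × ℤ
  | 0 => (1, 0)
  | n + 1 => gaussMul (gaussPow p n) p

theorem gaussVal_pow (p : ℤ × ℤ) (n : ℕ) : gaussVal (gaussPow p n) = gaussVal p ^ n := by
  induction n with
  | zero => simp [gaussVal, gaussPow]
  | succ n ih => rw [pow_succ, ← ih, ← gaussVal_mul, gaussPow]

theorem Computable.gaussPow {f : α → ℤ × ℤ} {n : α → ℕ} (hf : Computable f) (hn : Computable n) :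
    Computable fun a => gaussPow (f a) (n a) := by
  refine (Computable.nat_rec (h := fun a p => _root_.gaussMul p.2 (f a)) hn
    (Computable.const ((1 : ℤ), (0 : ℤ))) ?_).of_eq fun a => ?_
  · exact Computable.gaussMul (f := fun p : α × (ℕ × (ℤ × ℤ)) => p.2.2)
      (Computable.snd.comp Computable.snd) (hf.comp Computable.fst)
  · induction n a with
    | zero => rfl
    | succ n ih => simp only [ih, _root_.gaussPow]

/-- From index 2B on, each term of ∑ B^m/m! is at most half its predecessor, and the term of index
2B is at most B^(2B) ≤ 2^(2B²). Another 2B² + k + 1 halvings suffice, since the remainder is at most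
twice the first omitted term. -/
theorem norm_exp_sub_sum_le {x : ℂ} {B k : ℕ} (hx : ‖x‖ ≤ B) :
    ‖Complex.exp x - ∑ m ∈ Finset.range (2 * B + (2 * B * B + k + 1)), x ^ m / m.factorial‖
      ≤ 1 / 2 ^ k := by
  have key : ∀ m : ℕ, (B : ℝ) ^ (2 * B + m) / (2 * B + m).factorial ≤ 2 ^ (2 * B * B) / 2 ^ m := by
    intro m
    induction m with
    | zero =>
      have h1 : (B : ℝ) ≤ 2 ^ B := by exact_mod_cast Nat.lt_two_pow_self.le
      have h2 : (1 : ℝ) ≤ (2 * B).factorial := by exact_mod_cast Nat.factorial_pos _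
      rw [pow_zero, div_one, add_zero]
      refine (div_le_self (by positivity) h2).trans ?_
      calc (B : ℝ) ^ (2 * B) ≤ (2 ^ B) ^ (2 * B) := by gcongr
        _ = _ := by rw [← pow_mul]; ring_nf
    | succ m ih =>
      rw [← add_assoc, pow_succ, Nat.factorial_succ, pow_succ]
      push_cast
      have hB : (0 : ℝ) < 2 * B + m + 1 := by positivity
      have e : (B : ℝ) ^ (2 * B + m) * B / ((2 * B + m + 1) * (2 * B + m).factorial)
          = (B : ℝ) ^ (2 * B + m) / (2 * B + m).factorial * (B / (2 * B + m + 1)) := by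
        field_simp
      rw [e]
      have hle : (B : ℝ) / (2 * B + m + 1) ≤ 1 / 2 := by
        rw [div_le_iff₀ hB]
        have : (0 : ℝ) ≤ m := by positivity
        linarith
      calc _ ≤ (2 : ℝ) ^ (2 * B * B) / 2 ^ m * (1 / 2) := by gcongr
        _ = _ := by field_simp
  set n := 2 * B + (2 * B * B + k + 1) with hn
  have hx2 : ‖x‖ / n.succ ≤ 1 / 2 := by
    rw [div_le_iff₀ (by positivity)]
    have : 2 * (B : ℝ) ≤ n.succ := by exact_mod_cast (by omega : 2 * B ≤ n.succ)
    linarith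
  refine (Complex.exp_bound' hx2).trans ?_
  calc ‖x‖ ^ n / n.factorial * 2 ≤ (B : ℝ) ^ n / n.factorial * 2 := by gcongr
    _ ≤ 2 ^ (2 * B * B) / 2 ^ (2 * B * B + k + 1) * 2 :=
        mul_le_mul_of_nonneg_right (key _) (by norm_num)
    _ = 1 / 2 ^ k := by rw [pow_add, pow_add]; field_simp

/-- Dyadic arguments come first because their Taylor terms are exact Gaussian rationals; `CompC.exp`
then perturbs the argument. -/
theorem CompC.exp_gauss : CompC fun p : (ℤ × ℤ) × ℕ => Complex.exp (gaussVal p.1 / 2 ^ p.2) := by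
  have hterm : CompC fun p : ((ℤ × ℤ) × ℕ) × ℕ =>
      (gaussVal p.1.1 / 2 ^ p.1.2) ^ p.2 / (p.2.factorial : ℂ) := by
    have h11 : Computable fun p : ((ℤ × ℤ) × ℕ) × ℕ => p.1.1 := Computable.fst.comp Computable.fst
    have h12 : Computable fun p : ((ℤ × ℤ) × ℕ) × ℕ => p.1.2 := Computable.snd.comp Computable.fst
    refine (CompC.gauss_div (p := fun p : ((ℤ × ℤ) × ℕ) × ℕ => gaussPow p.1.1 p.2)
      (d := fun p => (2 ^ p.1.2) ^ p.2 * p.2.factorial) (h11.gaussPow Computable.snd)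
      ((Computable.nat_pow' (Computable.two_pow h12) Computable.snd).nat_mul'
        (Computable.factorial Computable.snd))
      fun p => by positivity).congr fun p => ?_
    rw [gaussVal_pow]; push_cast; rw [div_pow, div_div]
  have hz : CompC fun p : (ℤ × ℤ) × ℕ => gaussVal p.1 / 2 ^ p.2 :=
    (CompC.gauss_div Computable.fst (Computable.two_pow Computable.snd)
      fun _ => by positivity).congr fun p => by push_cast; rfl
  obtain ⟨B, hB, hzB⟩ := hz.exists_bound
  have hB1 : Computable fun p : ((ℤ × ℤ) × ℕ) × ℕ => B p.1 := hB.comp Computable.fst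
  have h2B := (Computable.const 2).nat_mul' hB1
  refine CompC.limit (y := fun p : ((ℤ × ℤ) × ℕ) × ℕ =>
    ∑ m ∈ Finset.range (2 * B p.1 + (2 * B p.1 * B p.1 + p.2 + 1)),
      (gaussVal p.1.1 / 2 ^ p.1.2) ^ m / (m.factorial : ℂ)) ?_
    fun a k => norm_exp_sub_sum_le (hzB a)
  exact CompC.sum (α := ((ℤ × ℤ) × ℕ) × ℕ) (x := fun p =>
    (gaussVal p.1.1.1 / 2 ^ p.1.1.2) ^ p.2 / (p.2.factorial : ℂ))
    (hterm.comp ((Computable.fst.comp Computable.fst).pair Computable.snd))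
    (h2B.nat_add' (((h2B.nat_mul' hB1).nat_add' Computable.snd).nat_add' (Computable.const 1)))

theorem norm_exp_le_four_pow {z : ℂ} {B : ℕ} (h : ‖z‖ ≤ B) : ‖Complex.exp z‖ ≤ 4 ^ B := by
  rw [Complex.norm_exp]
  have h1 : z.re ≤ B := (Complex.re_le_norm z).trans h
  calc Real.exp z.re ≤ Real.exp B := Real.exp_le_exp.2 h1
    _ = Real.exp 1 ^ B := by rw [← Real.exp_nat_mul, mul_one]
    _ ≤ 4 ^ B := by gcongr; linarith [Real.exp_one_lt_d9]

theorem CompC.exp {z : α → ℂ} (hz : CompC z) : CompC fun a => Complex.exp (z a) := by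
  obtain ⟨B, hB, hzB⟩ := hz.exists_bound
  obtain ⟨f, hf, h⟩ := hz
  have hK : Computable fun p : α × ℕ => p.2 + 1 + 2 * B p.1 :=
    (Computable.snd.nat_add' (Computable.const 1)).nat_add'
      ((Computable.const 2).nat_mul' (hB.comp Computable.fst))
  refine CompC.limit (y := fun p : α × ℕ => Complex.exp (gaussVal (f p.1 (p.2 + 1 + 2 * B p.1)) /
    2 ^ (p.2 + 1 + 2 * B p.1)))
    (CompC.exp_gauss.comp (g := fun p : α × ℕ => (f p.1 (p.2 + 1 + 2 * B p.1),
      p.2 + 1 + 2 * B p.1)) ((hf.comp Computable.fst hK).pair hK)) fun a k => ?_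
  have e := h a (k + 1 + 2 * B a)
  simp only []
  set w := gaussVal (f a (k + 1 + 2 * B a)) / 2 ^ (k + 1 + 2 * B a)
  have h1 : 1 / (2 : ℝ) ^ (k + 1 + 2 * B a) ≤ 1 := by
    rw [div_le_one (by positivity)]; exact one_le_pow₀ (by norm_num)
  -- Factor out e^z, of size at most 4^B = 2^(2B). This is what the extra 2B bits of precision pay
  -- for.
  have e2 : Complex.exp (z a) - Complex.exp w
      = -(Complex.exp (z a) * (Complex.exp (w - z a) - 1)) := by
    rw [mul_sub, ← Complex.exp_add]; ring_nf
  rw [norm_sub_rev] at e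
  rw [e2, norm_neg, norm_mul]
  calc _ ≤ 4 ^ B a * (2 * (1 / (2 : ℝ) ^ (k + 1 + 2 * B a))) := by
        refine mul_le_mul (norm_exp_le_four_pow (hzB a)) ?_ (norm_nonneg _) (by positivity)
        exact (Complex.norm_exp_sub_one_le (e.trans h1)).trans (by gcongr)
    _ = 1 / 2 ^ k := by
        rw [pow_add, pow_add, pow_mul]; field_simp; norm_num

end Elementary

/-! ### The lines of direction `e^{iπ/4}` -/

section Line

/-- The direction `e^{iπ/4}` of the lines of integration. -/
noncomputable def rot : ℂ := Complex.exp (Real.pi * Complex.I / 4)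

theorem rot_eq : rot = ((√2 / 2 : ℝ) : ℂ) + ((√2 / 2 : ℝ) : ℂ) * Complex.I := by
  have : (Real.pi * Complex.I / 4 : ℂ) = ((Real.pi / 4 : ℝ) : ℂ) * Complex.I := by
    push_cast; ring
  rw [rot, this, Complex.exp_mul_I, ← Complex.ofReal_cos, ← Complex.ofReal_sin,
    Real.cos_pi_div_four, Real.sin_pi_div_four]

theorem rot_re : rot.re = √2 / 2 := by rw [rot_eq]; simp
theorem rot_im : rot.im = √2 / 2 := by rw [rot_eq]; simp

theorem rot_sq : rot ^ 2 = Complex.I := by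
  rw [rot, ← Complex.exp_nat_mul]
  convert Complex.exp_pi_div_two_mul_I using 2
  push_cast; ring

theorem rot_ne_zero : rot ≠ 0 := Complex.exp_ne_zero _

theorem norm_rot : ‖rot‖ = 1 := by
  have : (Real.pi * Complex.I / 4 : ℂ) = ((Real.pi / 4 : ℝ) : ℂ) * Complex.I := by
    push_cast; ring
  rw [rot, this, Complex.norm_exp_ofReal_mul_I]

/-- The line of direction `e^{iπ/4}` through the real point `c`. -/
noncomputable def lineAt (c u : ℝ) : ℂ := c + u * rot

theorem auxLine_eq (u : ℝ) : auxLine u = lineAt (1 / 2) u := by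
  simp [auxLine, lineAt, rot]

theorem lineAt_re (c u : ℝ) : (lineAt c u).re = c + u * (√2 / 2) := by
  simp [lineAt, rot_re]

theorem lineAt_im (c u : ℝ) : (lineAt c u).im = u * (√2 / 2) := by
  simp [lineAt, rot_im]

theorem re_lineAt_mul_rot (c u : ℝ) : (lineAt c u * rot).re = c * (√2 / 2) := by
  rw [Complex.mul_re, lineAt_re, lineAt_im, rot_re, rot_im]; ring

theorem normSq_lineAt (c u : ℝ) : ‖lineAt c u‖ ^ 2 = c ^ 2 + √2 * c * u + u ^ 2 := by
  have h2 : √2 * √2 = 2 := Real.mul_self_sqrt (by norm_num)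
  rw [Complex.sq_norm, Complex.normSq_apply, lineAt_re, lineAt_im]
  linear_combination (u ^ 2 / 2) * h2

theorem norm_lineAt_le {c : ℝ} (hc : 0 ≤ c) (u : ℝ) : ‖lineAt c u‖ ≤ c + |u| := by
  refine (norm_add_le _ _).trans ?_
  rw [norm_mul, norm_rot, mul_one, Complex.norm_real, Complex.norm_real, Real.norm_eq_abs,
    Real.norm_eq_abs, abs_of_nonneg hc]

theorem le_norm_lineAt (c u : ℝ) : c * (2 / 3) ≤ ‖lineAt c u‖ := by
  have h2 : √2 ^ 2 = 2 := Real.sq_sqrt (by norm_num)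
  refine abs_le_of_sq_le_sq' ?_ (norm_nonneg _) |>.2
  rw [normSq_lineAt]
  nlinarith [sq_nonneg (u + √2 / 2 * c), sq_nonneg c]

/-- Multiplication by `rot` turns the line through 0 of direction e^{iπ/4} into the imaginary axis,
so the condition says Re x > Im x. This half plane contains all the lines of integration and avoids
the cut. -/
theorem mem_slitPlane_of_re_mul_rot_pos {x : ℂ} (h : 0 < (x * rot).re) : x ∈ Complex.slitPlane := by
  rw [Complex.mul_re, rot_re, rot_im] at h
  rw [Complex.mem_slitPlane_iff]
  by_contra! hx
  rw [hx.2, zero_mul, sub_zero] at h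
  have : 0 < √2 / 2 := by positivity
  nlinarith [hx.1]

/-- This moves the logarithm on a line of integration into the right half plane, where `CompC.log`
applies. -/
theorem log_eq_log_mul_rot_sub {x : ℂ} (h : 0 < (x * rot).re) :
    Complex.log x = Complex.log (x * rot) - Real.pi * Complex.I / 4 := by
  have hx0 : x ≠ 0 := by rintro rfl; simp at h
  have hr : x * rot ≠ 0 := mul_ne_zero hx0 rot_ne_zero
  have him : (Complex.log (x * rot) - Real.pi * Complex.I / 4).im
      = (x * rot).arg - Real.pi / 4 := by
    rw [Complex.sub_im, Complex.log_im]
    congr 1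
    have : (Real.pi * Complex.I / 4 : ℂ) = ((Real.pi / 4 : ℝ) : ℂ) * Complex.I := by
      push_cast; ring
    rw [this]; simp
  have harg := abs_lt.1 (Complex.abs_arg_lt_pi_div_two_iff.2 (Or.inl h))
  have hpi := Real.pi_pos
  refine Complex.exp_inj_of_neg_pi_lt_of_le_pi ?_ ?_ ?_ ?_ ?_
  · rw [Complex.log_im]; exact Complex.neg_pi_lt_arg x
  · rw [Complex.log_im]; exact Complex.arg_le_pi x
  · rw [him]; linarith
  · rw [him]; linarith
  · rw [Complex.exp_sub, Complex.exp_log hx0, Complex.exp_log hr, ← rot, mul_div_assoc,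
      div_self rot_ne_zero, mul_one]

theorem re_lineAt_mul_rot_pos {c : ℝ} (hc : 0 < c) (u : ℝ) : 0 < (lineAt c u * rot).re := by
  rw [re_lineAt_mul_rot]; positivity

theorem lineAt_mem_slitPlane {c : ℝ} (hc : 0 < c) (u : ℝ) : lineAt c u ∈ Complex.slitPlane :=
  mem_slitPlane_of_re_mul_rot_pos (re_lineAt_mul_rot_pos hc u)

theorem lineAt_ne_zero {c : ℝ} (hc : 0 < c) (u : ℝ) : lineAt c u ≠ 0 :=
  Complex.slitPlane_ne_zero (lineAt_mem_slitPlane hc u)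

theorem norm_log_lineAt_le {c : ℝ} (hc : 1 / 2 ≤ c) (u : ℝ) :
    ‖Complex.log (lineAt c u)‖ ≤ c + |u| + 5 := by
  have hc0 : 0 ≤ c := by linarith
  have h1 := norm_lineAt_le hc0 u
  have h2 := le_norm_lineAt c u
  have hpos : 0 < ‖lineAt c u‖ := by linarith
  refine (Complex.norm_le_abs_re_add_abs_im _).trans ?_
  have him : |(Complex.log (lineAt c u)).im| ≤ 3.15 := by
    rw [Complex.log_im]
    exact (Complex.abs_arg_le_pi _).trans Real.pi_lt_d2.le
  have hre : |(Complex.log (lineAt c u)).re| ≤ c + |u| + 3 / 2 := by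
    rw [Complex.log_re, abs_le]
    constructor
    · have h3 : -Real.log ‖lineAt c u‖ ≤ ‖lineAt c u‖⁻¹ - 1 := by
        rw [← Real.log_inv]; exact Real.log_le_sub_one_of_pos (inv_pos.2 hpos)
      have h4 : ‖lineAt c u‖⁻¹ ≤ 3 := by
        rw [inv_le_comm₀ hpos (by norm_num)]; linarith
      linarith [abs_nonneg u]
    · have := Real.log_le_sub_one_of_pos hpos
      linarith
  linarith

theorem norm_lineAt_cpow_le {c : ℝ} (hc : 1 / 2 ≤ c) (u : ℝ) (s : ℂ) :
    ‖lineAt c u ^ (-s)‖ ≤ Real.exp (‖s‖ * (c + |u| + 5)) := by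
  rw [Complex.cpow_def_of_ne_zero (lineAt_ne_zero (by linarith) u), Complex.norm_exp]
  refine Real.exp_le_exp.2 ((Complex.re_le_norm _).trans ?_)
  rw [norm_mul, norm_neg, mul_comm]
  exact mul_le_mul_of_nonneg_left (norm_log_lineAt_le hc u) (norm_nonneg _)

/-- The exponent is t - it with t = √2 π u. For |t| ≤ 1 the exponential has positive real part
because cos t > 0; otherwise its modulus e^t is at least 2 or at most 1/2. This controls the
denominator on every line through a half-integer. -/
theorem half_le_norm_one_add_exp (u : ℝ) :
    1 / 2 ≤ ‖1 + Complex.exp (-(2 * Real.pi * Complex.I * rot * u))‖ := by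
  set t : ℝ := √2 * Real.pi * u with ht
  have e : -(2 * Real.pi * Complex.I * rot * u) = (t : ℂ) - (t : ℂ) * Complex.I := by
    rw [rot_eq, ht]; push_cast
    linear_combination -(Real.pi * √2 * u : ℂ) * Complex.I_sq
  rw [e]
  have hn : ‖Complex.exp ((t : ℂ) - (t : ℂ) * Complex.I)‖ = Real.exp t := by
    rw [Complex.norm_exp]; simp
  rcases le_or_gt (|t|) 1 with h | h
  · refine le_trans ?_ (Complex.re_le_norm _)
    rw [Complex.add_re, Complex.one_re, Complex.exp_re]
    have h1 : 0 < Real.cos t := Real.cos_pos_of_le_one h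
    have h2 : ((t : ℂ) - (t : ℂ) * Complex.I).im = -t := by simp
    rw [h2, Real.cos_neg]
    have := mul_pos (Real.exp_pos ((t : ℂ) - (t : ℂ) * Complex.I).re) h1
    linarith
  · rcases lt_abs.1 h with h | h
    · have := norm_sub_norm_le (Complex.exp ((t : ℂ) - (t : ℂ) * Complex.I)) (-1)
      rw [sub_neg_eq_add, norm_neg, norm_one, hn, add_comm _ (1 : ℂ)] at this
      have := Real.add_one_le_exp t
      linarith
    · have := norm_sub_norm_le (1 : ℂ) (-Complex.exp ((t : ℂ) - (t : ℂ) * Complex.I))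
      rw [sub_neg_eq_add, norm_neg, norm_one, hn] at this
      have h3 : Real.exp t ≤ 1 / 2 := by
        have := Real.add_one_le_exp (-t)
        rw [← neg_neg t, Real.exp_neg, one_div]
        exact inv_anti₀ (by norm_num) (by linarith)
      linarith

end Line

/-! ### The integral of a Lipschitz function on the real line by Riemann sums -/

section RiemannSum

open MeasureTheory intervalIntegral

theorem norm_integral_sub_riemannSum_le {f : ℝ → ℂ} {L : ℝ} (hf : Continuous f)
    (hL : ∀ u v, ‖f u - f v‖ ≤ L * |u - v|) (hL0 : 0 ≤ L) (a : ℝ) {h : ℝ} (hh : 0 ≤ h) (n : ℕ) :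
    ‖(∫ u in a..(a + n * h), f u) - ∑ i ∈ Finset.range n, (h : ℂ) * f (a + i * h)‖
      ≤ n * (L * h * h) := by
  induction n with
  | zero => simp
  | succ n ih =>
    have hint : ∀ p q : ℝ, IntervalIntegrable f volume p q := fun p q => hf.intervalIntegrable p q
    have hstep : ‖(∫ u in (a + n * h)..(a + (n + 1 : ℕ) * h), f u) - (h : ℂ) * f (a + n * h)‖
        ≤ L * h * h := by
      have e : (h : ℂ) * f (a + n * h) = ∫ _u in (a + n * h)..(a + (n + 1 : ℕ) * h), f (a + n * h) := by
        rw [intervalIntegral.integral_const]; push_cast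
        rw [Complex.real_smul]; push_cast; ring
      rw [e, ← intervalIntegral.integral_sub (hint _ _) (by simp)]
      have hlen : |a + (n + 1 : ℕ) * h - (a + n * h)| = h := by
        rw [show a + (n + 1 : ℕ) * h - (a + n * h) = h by push_cast; ring, abs_of_nonneg hh]
      have := norm_integral_le_of_norm_le_const (a := a + n * h) (b := a + (n + 1 : ℕ) * h)
        (f := fun u => f u - f (a + n * h)) (C := L * h) fun u hu => by
          rw [Set.uIoc_of_le (by push_cast; nlinarith)] at hu
          refine (hL _ _).trans (mul_le_mul_of_nonneg_left ?_ hL0)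
          rw [abs_of_pos (by linarith [hu.1])]
          have := hu.2; push_cast at this; linarith
      rwa [hlen] at this
    rw [← intervalIntegral.integral_add_adjacent_intervals (hint a (a + n * h)) (hint _ _),
      Finset.sum_range_succ, add_sub_add_comm]
    refine (norm_add_le _ _).trans ((add_le_add ih hstep).trans (le_of_eq ?_))
    push_cast; ring

theorem norm_integral_sub_interval_le {f : ℝ → ℂ} {L : ℝ} (hf : Continuous f)
    (hL : ∀ u, ‖f u‖ ≤ L * Real.exp (-|u|)) {U : ℝ} (hU : 0 ≤ U) :
    Integrable f ∧ ‖(∫ u, f u) - ∫ u in (-U)..U, f u‖ ≤ 2 * L * Real.exp (-U) := by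
  have i1 : ∀ a : ℝ, 0 ≤ a → IntegrableOn f (Set.Ioi a) := fun a ha => by
    refine Integrable.mono' ((integrableOn_exp_neg_Ioi a).const_mul L)
      hf.aestronglyMeasurable ?_
    filter_upwards [ae_restrict_mem measurableSet_Ioi] with u hu
    have := hL u
    rwa [abs_of_pos (lt_of_le_of_lt ha hu)] at this
  have i2 : ∀ a : ℝ, a ≤ 0 → IntegrableOn f (Set.Iic a) := fun a ha => by
    refine Integrable.mono' ((integrableOn_exp_Iic a).const_mul L) hf.aestronglyMeasurable ?_
    filter_upwards [ae_restrict_mem measurableSet_Iic] with u hu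
    have := hL u
    rwa [abs_of_nonpos (hu.trans ha), neg_neg] at this
  have hint : Integrable f := by
    rw [← integrableOn_univ, ← Set.Iic_union_Ioi (a := (0 : ℝ))]
    exact (i2 0 le_rfl).union (i1 0 le_rfl)
  refine ⟨hint, ?_⟩
  have e1 : (∫ u in Set.Iic (-U), f u) + ∫ u in Set.Ioi (-U), f u = ∫ u, f u :=
    integral_Iic_add_Ioi hint.integrableOn hint.integrableOn
  have e2 : (∫ u in (-U)..U, f u) + ∫ u in Set.Ioi U, f u = ∫ u in Set.Ioi (-U), f u :=
    integral_interval_add_Ioi hint.integrableOn hint.integrableOn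
  have b1 : ‖∫ u in Set.Ioi U, f u‖ ≤ L * Real.exp (-U) := by
    rw [← integral_exp_neg_Ioi, ← MeasureTheory.integral_const_mul]
    refine norm_integral_le_of_norm_le ((integrableOn_exp_neg_Ioi U).const_mul L) ?_
    filter_upwards [ae_restrict_mem measurableSet_Ioi] with u hu
    have := hL u
    rwa [abs_of_pos (lt_of_le_of_lt hU hu)] at this
  have b2 : ‖∫ u in Set.Iic (-U), f u‖ ≤ L * Real.exp (-U) := by
    rw [← integral_exp_Iic, ← MeasureTheory.integral_const_mul]
    refine norm_integral_le_of_norm_le ((integrableOn_exp_Iic (-U)).const_mul L) ?_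
    filter_upwards [ae_restrict_mem measurableSet_Iic] with u hu
    have := hL u
    have hu' : u ≤ 0 := le_trans hu (by linarith)
    rwa [abs_of_nonpos hu', neg_neg] at this
  have e : (∫ u, f u) - ∫ u in (-U)..U, f u
      = (∫ u in Set.Iic (-U), f u) + ∫ u in Set.Ioi U, f u := by
    rw [← e1, ← e2]; ring
  rw [e]
  exact (norm_add_le _ _).trans (by linarith)

end RiemannSum

/-! ### The auxiliary function as an integral over the real line -/

section AuxKernel

/-- The integrand of Riemann's auxiliary function in terms of the real parameter. -/
noncomputable def auxKernel (s : ℂ) (u : ℝ) : ℂ :=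
  Complex.exp (-s * Complex.log (lineAt (1 / 2) u) - Real.pi * (u : ℂ) ^ 2) /
    (1 + Complex.exp (-(2 * Real.pi * Complex.I * rot * u)))

theorem one_add_exp_ne_zero (u : ℝ) :
    1 + Complex.exp (-(2 * Real.pi * Complex.I * rot * u)) ≠ 0 := by
  rw [← norm_pos_iff]
  linarith [half_le_norm_one_add_exp u]

/-- On this line x² - x = i u² - 1/4, so e^{πi(x² - x)} is e^{-πu²} e^{-πi/4}, and the last factor
cancels against `rot`. -/
theorem auxIntegrand_mul_rot (s : ℂ) (u : ℝ) :
    auxIntegrand s (auxLine u) * rot = auxKernel s u := by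
  rw [auxLine_eq, auxIntegrand, Complex.cpow_def_of_ne_zero (lineAt_ne_zero (by norm_num) u)]
  set x := lineAt (1 / 2) u with hx
  have hx' : x = 1 / 2 + u * rot := by rw [hx, lineAt]; push_cast; rfl
  have e1 : Complex.exp (-(Real.pi * Complex.I * x))
      = -(Complex.exp (Real.pi * Complex.I * x) *
        Complex.exp (-(2 * Real.pi * Complex.I * rot * u))) := by
    have : -(Real.pi * Complex.I * x) = Real.pi * Complex.I * x +
        -(2 * Real.pi * Complex.I * rot * u) - Real.pi * Complex.I := by rw [hx']; ring
    rw [this, Complex.exp_sub, Complex.exp_add, Complex.exp_pi_mul_I]; ring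
  have e2 : Complex.exp (Real.pi * Complex.I * x) - Complex.exp (-(Real.pi * Complex.I * x))
      = Complex.exp (Real.pi * Complex.I * x) *
        (1 + Complex.exp (-(2 * Real.pi * Complex.I * rot * u))) := by rw [e1]; ring
  rw [e2, auxKernel, div_mul_eq_mul_div, div_eq_div_iff (mul_ne_zero (Complex.exp_ne_zero _)
    (one_add_exp_ne_zero u)) (one_add_exp_ne_zero u), ← mul_assoc (Complex.exp _)]
  congr 1
  rw [rot, ← Complex.exp_add, ← Complex.exp_add, ← Complex.exp_add]
  congr 1
  rw [← hx, hx']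
  linear_combination (Real.pi * Complex.I * u ^ 2) * rot_sq + Real.pi * u ^ 2 * Complex.I_sq

theorem riemannAux_eq (s : ℂ) : riemannAux s = -∫ u : ℝ, auxKernel s u := by
  rw [riemannAux]
  congr 1
  exact MeasureTheory.integral_congr_ae (Eventually.of_forall (auxIntegrand_mul_rot s))

theorem hasDerivAt_lineAt (c u : ℝ) : HasDerivAt (lineAt c) rot u := by
  have h : HasDerivAt (fun u : ℝ => (u : ℂ)) 1 u := Complex.ofRealCLM.hasDerivAt
  have := (h.mul_const rot).const_add (c : ℂ)
  rwa [one_mul] at this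

theorem hasDerivAt_auxKernel (s : ℂ) (u : ℝ) : HasDerivAt (auxKernel s)
    (auxKernel s u * (-s * (rot / lineAt (1 / 2) u) - 2 * Real.pi * u
      + 2 * Real.pi * Complex.I * rot * Complex.exp (-(2 * Real.pi * Complex.I * rot * u)) /
        (1 + Complex.exp (-(2 * Real.pi * Complex.I * rot * u))))) u := by
  have h : HasDerivAt (fun u : ℝ => (u : ℂ)) 1 u := Complex.ofRealCLM.hasDerivAt
  have hl := (hasDerivAt_lineAt (1 / 2) u).clog_real (lineAt_mem_slitPlane (by norm_num) u)
  have hn := ((hl.const_mul (-s)).sub ((h.pow 2).const_mul (Real.pi : ℂ))).cexp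
  have hd := ((h.const_mul (2 * Real.pi * Complex.I * rot)).neg.cexp).const_add (1 : ℂ)
  have hD := one_add_exp_ne_zero u
  refine (hn.div hd hD).congr_deriv ?_
  simp only [auxKernel, Pi.pow_apply, Pi.sub_apply, Pi.neg_apply]
  generalize Complex.exp (-(2 * Real.pi * Complex.I * rot * u)) = E at hD ⊢
  generalize rot / lineAt (1 / 2) u = r
  generalize Complex.exp (-s * Complex.log (lineAt (1 / 2) u) - Real.pi * (u : ℂ) ^ 2) = N
  field_simp
  push_cast
  ring

theorem norm_auxKernel_le (s : ℂ) (u : ℝ) :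
    ‖auxKernel s u‖ ≤ 2 * Real.exp (‖s‖ * (|u| + 6) - 3 * u ^ 2) := by
  rw [auxKernel, norm_div, div_le_iff₀ (norm_pos_iff.2 (one_add_exp_ne_zero u)), Complex.norm_exp]
  have h1 := half_le_norm_one_add_exp u
  have h2 : (-s * Complex.log (lineAt (1 / 2) u) - Real.pi * (u : ℂ) ^ 2).re
      ≤ ‖s‖ * (|u| + 6) - 3 * u ^ 2 := by
    have e : (Real.pi * (u : ℂ) ^ 2).re = Real.pi * u ^ 2 := by norm_cast
    rw [Complex.sub_re, e]
    have h3 : (-s * Complex.log (lineAt (1 / 2) u)).re ≤ ‖s‖ * (|u| + 6) := by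
      refine (Complex.re_le_norm _).trans ?_
      rw [norm_mul, norm_neg]
      have := norm_log_lineAt_le le_rfl u
      exact mul_le_mul_of_nonneg_left (by linarith) (norm_nonneg _)
    nlinarith [Real.pi_gt_three, sq_nonneg u]
  calc _ ≤ Real.exp (‖s‖ * (|u| + 6) - 3 * u ^ 2) * 1 := by
        rw [mul_one]; exact Real.exp_le_exp.2 h2
    _ ≤ Real.exp (‖s‖ * (|u| + 6) - 3 * u ^ 2) *
        (2 * ‖1 + Complex.exp (-(2 * Real.pi * Complex.I * rot * u))‖) := by gcongr; linarith
    _ = _ := by ring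

/-- An upper bound for the integrand and its Lipschitz constant when `‖s‖ ≤ S`. -/
def auxBound (S : ℕ) : ℕ := 2 * 4 ^ (9 * S + 19 + (S + 7) ^ 2)

theorem exp_le_four_pow (n : ℕ) : Real.exp n ≤ 4 ^ n := by
  rw [← mul_one (n : ℝ), Real.exp_nat_mul]
  gcongr; linarith [Real.exp_one_lt_d9]

/-- Replacing e by 4 gives a natural number computable from S, as the algorithm for R requires. -/
theorem two_mul_exp_le_auxBound {S : ℕ} {x : ℝ} (h : x ≤ 9 * S + 19 + (S + 7) ^ 2) :
    2 * Real.exp x ≤ auxBound S := by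
  rw [auxBound]; push_cast
  refine mul_le_mul_of_nonneg_left ?_ (by norm_num)
  refine le_trans (Real.exp_le_exp.2 h) ?_
  exact_mod_cast exp_le_four_pow (9 * S + 19 + (S + 7) ^ 2)

theorem norm_auxKernel_le_auxBound {s : ℂ} {S : ℕ} (hs : ‖s‖ ≤ S) (u : ℝ) :
    ‖auxKernel s u‖ ≤ auxBound S * Real.exp (-|u|) := by
  refine (norm_auxKernel_le s u).trans ?_
  have e : ‖s‖ * (|u| + 6) - 3 * u ^ 2 = (‖s‖ * (|u| + 6) - 3 * u ^ 2 + |u|) + -|u| := by ring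
  rw [e, Real.exp_add, ← mul_assoc]
  refine mul_le_mul_of_nonneg_right (two_mul_exp_le_auxBound ?_) (Real.exp_pos _).le
  have h0 := abs_nonneg u
  have h1 : ‖s‖ * (|u| + 6) ≤ S * (|u| + 6) := by gcongr
  rw [← sq_abs u]
  nlinarith [sq_nonneg (|u| - (S + 1))]

theorem norm_deriv_auxKernel_le {s : ℂ} {S : ℕ} (hs : ‖s‖ ≤ S) (u : ℝ) :
    ‖auxKernel s u * (-s * (rot / lineAt (1 / 2) u) - 2 * Real.pi * u
      + 2 * Real.pi * Complex.I * rot * Complex.exp (-(2 * Real.pi * Complex.I * rot * u)) /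
        (1 + Complex.exp (-(2 * Real.pi * Complex.I * rot * u))))‖ ≤ auxBound S := by
  have hp : ‖(Real.pi : ℂ)‖ = Real.pi := by
    rw [Complex.norm_real, Real.norm_eq_abs, abs_of_pos Real.pi_pos]
  have hpi := Real.pi_lt_d2
  have h0 := abs_nonneg u
  have hx := le_norm_lineAt (1 / 2) u
  have b1 : ‖-s * (rot / lineAt (1 / 2) u)‖ ≤ 3 * S := by
    rw [norm_mul, norm_neg, norm_div, norm_rot, mul_comm]
    refine mul_le_mul ?_ hs (norm_nonneg _) (by norm_num)
    rw [div_le_iff₀ (by linarith)]; linarith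
  have b2 : ‖(2 * Real.pi * u : ℂ)‖ ≤ 7 * |u| := by
    rw [norm_mul, norm_mul, hp, Complex.norm_ofNat, Complex.norm_real, Real.norm_eq_abs]
    nlinarith
  have b3 : ‖2 * Real.pi * Complex.I * rot * Complex.exp (-(2 * Real.pi * Complex.I * rot * u)) /
        (1 + Complex.exp (-(2 * Real.pi * Complex.I * rot * u)))‖ ≤ 19 := by
    set D := 1 + Complex.exp (-(2 * Real.pi * Complex.I * rot * u)) with hD
    have hD2 : 1 / 2 ≤ ‖D‖ := half_le_norm_one_add_exp u
    have hE : Complex.exp (-(2 * Real.pi * Complex.I * rot * u)) = D - 1 := by rw [hD]; ring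
    rw [hE, norm_div, norm_mul, norm_mul, norm_mul, norm_mul, hp, Complex.norm_ofNat,
      Complex.norm_I, norm_rot, div_le_iff₀ (by linarith)]
    have := norm_sub_le D 1
    rw [norm_one] at this
    nlinarith [norm_nonneg (D - 1), Real.pi_pos]
  rw [norm_mul]
  -- The logarithmic derivative grows only linearly in |u|; bounding it by an exponential merges it
  -- into one exponent with the Gaussian decay.
  have b : ‖(-s * (rot / lineAt (1 / 2) u) - 2 * Real.pi * u
      + 2 * Real.pi * Complex.I * rot * Complex.exp (-(2 * Real.pi * Complex.I * rot * u)) /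
        (1 + Complex.exp (-(2 * Real.pi * Complex.I * rot * u))))‖
      ≤ Real.exp (3 * S + 7 * |u| + 18) := by
    refine (norm_add_le _ _).trans ((add_le_add ((norm_sub_le _ _).trans (add_le_add b1 b2))
      b3).trans ?_)
    have := Real.add_one_le_exp (3 * S + 7 * |u| + 18)
    linarith
  calc _ ≤ 2 * Real.exp (‖s‖ * (|u| + 6) - 3 * u ^ 2) * Real.exp (3 * S + 7 * |u| + 18) :=
        mul_le_mul (norm_auxKernel_le s u) b (norm_nonneg _) (by positivity)
    _ = 2 * Real.exp (‖s‖ * (|u| + 6) - 3 * u ^ 2 + (3 * S + 7 * |u| + 18)) := by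
        rw [mul_assoc, ← Real.exp_add]
    _ ≤ _ := by
        refine two_mul_exp_le_auxBound ?_
        have h1 : ‖s‖ * (|u| + 6) ≤ S * (|u| + 6) := by gcongr
        rw [← sq_abs u]
        nlinarith [sq_nonneg (2 * |u| - (S + 7))]

theorem continuous_auxKernel (s : ℂ) : Continuous (auxKernel s) :=
  continuous_iff_continuousAt.2 fun u => (hasDerivAt_auxKernel s u).continuousAt

theorem norm_auxKernel_sub_le {s : ℂ} {S : ℕ} (hs : ‖s‖ ≤ S) (u v : ℝ) :
    ‖auxKernel s u - auxKernel s v‖ ≤ auxBound S * |u - v| := by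
  have := Convex.norm_image_sub_le_of_norm_hasDerivWithin_le (f := auxKernel s) (s := Set.univ)
    (fun x _ => (hasDerivAt_auxKernel s x).hasDerivWithinAt)
    (fun x _ => norm_deriv_auxKernel_le hs x) convex_univ (Set.mem_univ v) (Set.mem_univ u)
  rwa [Real.norm_eq_abs] at this

end AuxKernel

/-! ### Computability of the logarithm and of the auxiliary function -/

section CompAux

variable {α : Type*} [Primcodable α]

/-- Write e^q = z(1 + w). Since |Im q| < 2 and both arguments on the right are below π/2 in modulus,
no multiple of 2πi intervenes and q = log z + log(1 + w), where |log(1 + w)| ≤ (3/2)|w|. -/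
theorem norm_log_sub_le_of_exp_close {z q : ℂ} (hz : 0 < z.re) (hq : |q.im| < 2)
    (h : ‖2 * (Complex.exp q / z - 1)‖ < 1) :
    ‖Complex.log z - q‖ ≤ ‖2 * (Complex.exp q / z - 1)‖ := by
  have hz0 : z ≠ 0 := by rintro rfl; simp at hz
  set w := Complex.exp q / z - 1 with hw
  rw [norm_mul, Complex.norm_ofNat] at h ⊢
  have hw2 : ‖w‖ ≤ 1 / 2 := by linarith
  have hlog := Complex.norm_log_one_add_half_le_self hw2
  have hre : 0 < (1 + w).re := by
    have := (abs_le.1 ((Complex.abs_re_le_norm w).trans hw2)).1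
    rw [Complex.add_re, Complex.one_re]; linarith
  have h1w : 1 + w ≠ 0 := by intro h0; rw [h0] at hre; simp at hre
  have harg := abs_lt.1 (Complex.abs_arg_lt_pi_div_two_iff.2 (Or.inl hz))
  have harg' := abs_lt.1 (Complex.abs_arg_lt_pi_div_two_iff.2 (Or.inl hre))
  have hpi := Real.pi_gt_three
  have e : q = Complex.log z + Complex.log (1 + w) := by
    refine Complex.exp_inj_of_neg_pi_lt_of_le_pi ?_ ?_ ?_ ?_ ?_
    · linarith [(abs_lt.1 hq).1]
    · linarith [(abs_lt.1 hq).2]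
    · rw [Complex.add_im, Complex.log_im, Complex.log_im]; linarith
    · rw [Complex.add_im, Complex.log_im, Complex.log_im]; linarith
    · rw [Complex.exp_add, Complex.exp_log hz0, Complex.exp_log h1w, hw]; field_simp; ring
  have e' : Complex.log z - q = -Complex.log (1 + w) := by rw [e]; ring
  rw [e', norm_neg]
  linarith [norm_nonneg w]

theorem CompC.log {z : α → ℂ} (hz : CompC z) (h0 : ∀ a, 0 < (z a).re) :
    CompC fun a => Complex.log (z a) := by
  have hz0 : ∀ a, z a ≠ 0 := fun a h => by have := h0 a; rw [h] at this; simp at this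
  have hd : CompC fun p : α × ℕ => dyadic p.2 := compC_dyadic Computable.snd
  have hw : CompC fun p : α × ℕ => 2 * (Complex.exp (dyadic p.2) / z p.1 - 1) :=
    (CompC.const_ofNat 2).mul ((hd.exp.div (hz.comp Computable.fst) fun _ => hz0 _).sub
      CompC.const_one)
  have h1 : CompC fun p : α × ℕ => 2 + Complex.I * dyadic p.2 :=
    (CompC.const_ofNat 2).add (CompC.const_I.mul hd)
  have h2 : CompC fun p : α × ℕ => 2 - Complex.I * dyadic p.2 :=
    (CompC.const_ofNat 2).sub (CompC.const_I.mul hd)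
  have him : ∀ q : ℂ, (0 < (2 + Complex.I * q).re ∧ 0 < (2 - Complex.I * q).re) ↔ |q.im| < 2 := by
    intro q
    rw [abs_lt]
    simp only [Complex.add_re, Complex.sub_re, Complex.mul_re, Complex.I_re, Complex.I_im,
      Complex.re_ofNat]
    constructor
    · rintro ⟨h, h'⟩; constructor <;> linarith
    · rintro ⟨h, h'⟩; constructor <;> linarith
  refine CompC.of_search_zero (x := fun a => Complex.log (z a)) hw
    (hw.semiDec_norm_lt_one.and (h1.semiDec_re_pos.and h2.semiDec_re_pos))
    (fun a ε hε => ?_) fun a q hq => ?_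
  · have hc : ContinuousAt (fun w => ‖2 * (Complex.exp w / z a - 1)‖) (Complex.log (z a)) := by
      fun_prop
    have hc2 : ContinuousAt (fun w : ℂ => |w.im|) (Complex.log (z a)) := by fun_prop
    have hv : ‖2 * (Complex.exp (Complex.log (z a)) / z a - 1)‖ = 0 := by
      rw [Complex.exp_log (hz0 a), div_self (hz0 a)]; simp
    have hv2 : |(Complex.log (z a)).im| < 2 := by
      rw [Complex.log_im]
      have := Complex.abs_arg_lt_pi_div_two_iff.2 (Or.inl (h0 a))
      linarith [Real.pi_lt_d2]
    obtain ⟨q, ⟨hq1, hq2⟩, hq3⟩ := exists_dyadic_of_eventually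
      (((hc.eventually_lt_const (u := 1) (by simp only [hv]; norm_num)).and
        (hc.eventually_lt_const (u := ε) (by simp only [hv]; exact hε))).and
        (hc2.eventually_lt_const hv2))
    exact ⟨q, ⟨hq1, (him _).2 hq3⟩, hq2⟩
  · exact norm_log_sub_le_of_exp_close (h0 a) ((him _).1 hq.2) hq.1

/-- From log(1 + i) - log(1 - i) = πi/2. -/
theorem compC_pi : CompC fun _ : α => (Real.pi : ℂ) := by
  have h : CompC fun _ : α => Complex.log (Complex.I + 1) :=
    (CompC.const_I.add CompC.const_one).log fun _ => by simp
  have h' : CompC fun _ : α => Complex.log (1 - Complex.I) :=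
    (CompC.const_one.sub CompC.const_I).log fun _ => by simp
  refine ((CompC.const_I.neg.mul (CompC.const_ofNat 2)).mul (h.sub h')).congr fun _ => ?_
  have hp : (Complex.I + 1 : ℂ) = (√2 : ℝ) * rot := by
    have h2 : ((√2 : ℝ) : ℂ) * ((√2 : ℝ) : ℂ) = 2 := by
      rw [← Complex.ofReal_mul, Real.mul_self_sqrt (by norm_num)]; norm_num
    rw [rot_eq]; push_cast; linear_combination -(1 + Complex.I) / 2 * h2
  have hI : (1 - Complex.I : ℂ) * rot = (√2 : ℝ) := by
    rw [rot_eq]; push_cast; linear_combination -(√2 / 2 : ℂ) * Complex.I_sq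
  have l1 := log_eq_log_mul_rot_sub (x := 1 - Complex.I) (by rw [hI]; simp)
  have l2 : Complex.log (Complex.I + 1) = Complex.log (√2 : ℝ) + Real.pi * Complex.I / 4 := by
    have hs : (0 : ℝ) < √2 := by positivity
    have e : Complex.log rot = Real.pi * Complex.I / 4 := by
      have : (Real.pi * Complex.I / 4 : ℂ).im = Real.pi / 4 := by
        have : (Real.pi * Complex.I / 4 : ℂ) = ((Real.pi / 4 : ℝ) : ℂ) * Complex.I := by
          push_cast; ring
        rw [this]; simp
      exact Complex.log_exp (by rw [this]; linarith [Real.pi_pos])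
        (by rw [this]; linarith [Real.pi_pos])
    rw [hp, Complex.log_ofReal_mul hs rot_ne_zero, e, Complex.ofReal_log hs.le]
  rw [l1, hI, l2]
  linear_combination -(Real.pi : ℂ) * Complex.I_sq

theorem compC_rot : CompC fun _ : α => rot :=
  ((compC_pi.mul CompC.const_I).div (CompC.const_ofNat 4) fun _ => by norm_num).exp

theorem CompC.auxKernel {s : α → ℂ} (hs : CompC s) {u : α → ℝ} (hu : CompC fun a => (u a : ℂ)) :
    CompC fun a => auxKernel (s a) (u a) := by
  have hx : CompC fun a => lineAt (1 / 2) (u a) :=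
    (((CompC.const_ofNat 2).inv fun _ => two_ne_zero).add (hu.mul compC_rot)).congr fun a => by
      rw [lineAt]; push_cast; rw [one_div]
  have hlog : CompC fun a => Complex.log (lineAt (1 / 2) (u a)) :=
    (((hx.mul compC_rot).log fun a => re_lineAt_mul_rot_pos (by norm_num) _).sub
      ((compC_pi.mul CompC.const_I).div (CompC.const_ofNat 4) fun _ => by norm_num)).congr
      fun a => (log_eq_log_mul_rot_sub (re_lineAt_mul_rot_pos (by norm_num) _)).symm
  exact ((hs.neg.mul hlog).sub (compC_pi.mul hu.pow_two)).exp.div (CompC.const_one.add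
    ((((((CompC.const_ofNat 2).mul compC_pi).mul CompC.const_I).mul compC_rot).mul hu).neg.exp))
    fun a => one_add_exp_ne_zero (u a)

theorem Computable.auxBound {f : α → ℕ} (hf : Computable f) :
    Computable fun a => auxBound (f a) := by
  have h7 := hf.nat_add' (Computable.const 7)
  exact (Computable.const 2).nat_mul' ((Computable.const 4).nat_pow'
    ((((Computable.const 9).nat_mul' hf).nat_add' (Computable.const 19)).nat_add'
      (h7.nat_pow' (Computable.const 2))))

/-- Riemann sums for the auxiliary function over `[-U, U]` with mesh `2⁻ᵐ`. -/
theorem norm_riemannAux_sub_sum_le {s : ℂ} {S : ℕ} (hs : ‖s‖ ≤ S) (k : ℕ) {U m : ℕ}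
    (hU : U = k + 2 + auxBound S) (hm : m = k + 2 + U * auxBound S) :
    ‖riemannAux s - -∑ i ∈ Finset.range (2 * U * 2 ^ m),
      (2 ^ m : ℂ)⁻¹ * auxKernel s (-U + i * ((2 : ℝ) ^ m)⁻¹)‖ ≤ 1 / 2 ^ k := by
  set L := auxBound S with hL
  obtain ⟨-, h1⟩ := norm_integral_sub_interval_le (continuous_auxKernel s)
    (norm_auxKernel_le_auxBound hs) (Nat.cast_nonneg (α := ℝ) U)
  have h2 := norm_integral_sub_riemannSum_le (continuous_auxKernel s) (norm_auxKernel_sub_le hs)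
    (Nat.cast_nonneg _) (-U) (h := ((2 : ℝ) ^ m)⁻¹) (by positivity) (2 * U * 2 ^ m)
  have hp : (0 : ℝ) < 2 ^ m := by positivity
  have e1 : -(U : ℝ) + (2 * U * 2 ^ m : ℕ) * ((2 : ℝ) ^ m)⁻¹ = U := by
    push_cast; field_simp; ring
  rw [e1] at h2
  -- Half of the error budget goes to the tails beyond ±U, half to the mesh 2^(-m); both are met
  -- through n ≤ 2^n.
  have b1 : 2 * (L : ℝ) * Real.exp (-U) ≤ 1 / 2 ^ (k + 1) := by
    have h3 : (L : ℝ) ≤ 2 ^ L := by exact_mod_cast Nat.lt_two_pow_self.le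
    have h4 : Real.exp (-U) ≤ 1 / 2 ^ U := by
      rw [Real.exp_neg, ← one_div]
      refine one_div_le_one_div_of_le (by positivity) ?_
      rw [← mul_one (U : ℝ), Real.exp_nat_mul]
      gcongr; linarith [Real.exp_one_gt_d9]
    calc 2 * (L : ℝ) * Real.exp (-U) ≤ 2 * 2 ^ L * (1 / 2 ^ U) := by gcongr
      _ = 1 / 2 ^ (k + 1) := by rw [hU, pow_add, pow_add, pow_add]; field_simp
  have b2 : ((2 * U * 2 ^ m : ℕ) : ℝ) * (L * ((2 : ℝ) ^ m)⁻¹ * ((2 : ℝ) ^ m)⁻¹)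
      ≤ 1 / 2 ^ (k + 1) := by
    have h3 : ((U * L : ℕ) : ℝ) ≤ 2 ^ (U * L) := by exact_mod_cast Nat.lt_two_pow_self.le
    calc ((2 * U * 2 ^ m : ℕ) : ℝ) * (L * ((2 : ℝ) ^ m)⁻¹ * ((2 : ℝ) ^ m)⁻¹)
        = 2 * (U * L : ℕ) * ((2 : ℝ) ^ m)⁻¹ := by push_cast; field_simp
      _ ≤ 2 * 2 ^ (U * L) * ((2 : ℝ) ^ m)⁻¹ := by gcongr
      _ = 1 / 2 ^ (k + 1) := by rw [hm, pow_add, pow_add, pow_add]; field_simp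
  have e2 : ((((2 : ℝ) ^ m)⁻¹ : ℝ) : ℂ) = (2 ^ m : ℂ)⁻¹ := by push_cast; rfl
  rw [e2] at h2
  set T := ∑ i ∈ Finset.range (2 * U * 2 ^ m),
      (2 ^ m : ℂ)⁻¹ * auxKernel s (-U + i * ((2 : ℝ) ^ m)⁻¹)
  have e3 : riemannAux s - -T = -(((∫ u, auxKernel s u) - ∫ u in (-(U : ℝ))..U, auxKernel s u)
      + ((∫ u in (-(U : ℝ))..U, auxKernel s u) - T)) := by rw [riemannAux_eq]; ring
  rw [e3, norm_neg]
  refine (norm_add_le _ _).trans ((add_le_add (h1.trans b1) (h2.trans b2)).trans (le_of_eq ?_))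
  rw [pow_succ]; field_simp; norm_num

theorem CompC.riemannAux {s : α → ℂ} (hs : CompC s) : CompC fun a => riemannAux (s a) := by
  obtain ⟨S, hS, hsS⟩ := hs.exists_bound
  set U : α × ℕ → ℕ := fun p => p.2 + 2 + _root_.auxBound (S p.1) with hU
  set m : α × ℕ → ℕ := fun p => p.2 + 2 + U p * _root_.auxBound (S p.1) with hm
  have hB : Computable fun p : α × ℕ => _root_.auxBound (S p.1) := (hS.comp Computable.fst).auxBound
  have hk2 : Computable fun p : α × ℕ => p.2 + 2 := Computable.snd.nat_add' (Computable.const 2)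
  have hUc : Computable U := hk2.nat_add' hB
  have hmc : Computable m := hk2.nat_add' (hUc.nat_mul' hB)
  have hpow : CompC fun p : (α × ℕ) × ℕ => (2 ^ m p.1 : ℂ)⁻¹ :=
    (CompC.two_pow (hmc.comp Computable.fst)).inv fun _ => pow_ne_zero _ two_ne_zero
  have hu : CompC fun p : (α × ℕ) × ℕ => ((-U p.1 + p.2 * ((2 : ℝ) ^ m p.1)⁻¹ : ℝ) : ℂ) :=
    ((CompC.natCast (hUc.comp Computable.fst)).neg.add
      ((CompC.natCast Computable.snd).mul hpow)).congr fun p => by push_cast; rfl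
  have hterm := hpow.mul
    (CompC.auxKernel (hs.comp (Computable.fst.comp Computable.fst)) hu)
  have hsum := (CompC.sum hterm (N := fun p => 2 * U p * 2 ^ m p)
    (((Computable.const 2).nat_mul' hUc).nat_mul' (Computable.two_pow hmc))).neg
  exact CompC.limit hsum fun a k => norm_riemannAux_sub_sum_le (hsS a) k rfl rfl

end CompAux

/-! ### Moving the line of integration across a pole -/

section Shift

open MeasureTheory intervalIntegral

theorem integral_div_sq_add_sq_symm {h : ℝ} (hh : 0 < h) (L : ℝ) :
    ∫ u in (-L)..L, 2 * h / (u ^ 2 + h ^ 2) = 4 * Real.arctan (L / h) := by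
  have hd : ∀ u : ℝ, HasDerivAt (fun u => 2 * Real.arctan (u / h)) (2 * h / (u ^ 2 + h ^ 2)) u := by
    intro u
    have := ((Real.hasDerivAt_arctan (u / h)).comp u ((hasDerivAt_id u).div_const h)).const_mul 2
    refine this.congr_deriv ?_
    have : u ^ 2 + h ^ 2 ≠ 0 := by positivity
    have : 1 + (u / h) ^ 2 ≠ 0 := by positivity
    field_simp; ring
  rw [integral_eq_sub_of_hasDerivAt (fun u _ => hd u)]
  · rw [neg_div, Real.arctan_neg]; ring
  · refine Continuous.intervalIntegrable ?_ _ _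
    exact continuous_const.div (by fun_prop) fun u => by positivity

/-- The residue of 1/ζ computed by hand: the horizontal sides give 4i arctan(L/h), the vertical ones
4i arctan(h/L), and the two angles add up to π/2. -/
theorem rect_integral_inv {L h : ℝ} (hL : 0 < L) (hh : 0 < h) :
    (((∫ u : ℝ in (-L)..L, ((u : ℂ) + ((-h : ℝ) : ℂ) * Complex.I)⁻¹)
      - ∫ u : ℝ in (-L)..L, ((u : ℂ) + (h : ℂ) * Complex.I)⁻¹)
      + Complex.I • ∫ v : ℝ in (-h)..h, ((L : ℂ) + (v : ℂ) * Complex.I)⁻¹)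
      - Complex.I • ∫ v : ℝ in (-h)..h, (((-L : ℝ) : ℂ) + (v : ℂ) * Complex.I)⁻¹
      = 2 * Real.pi * Complex.I := by
  have hne : ∀ a b : ℝ, (a ≠ 0 ∨ b ≠ 0) → (a : ℂ) + (b : ℂ) * Complex.I ≠ 0 := by
    intro a b hab h0
    have h1 := congrArg Complex.re h0
    have h2 := congrArg Complex.im h0
    simp at h1 h2
    tauto
  have c1 : ∀ b : ℝ, b ≠ 0 → Continuous fun u : ℝ => ((u : ℂ) + (b : ℂ) * Complex.I)⁻¹ :=
    fun b hb => Continuous.inv₀ (by fun_prop) fun u => hne u b (Or.inr hb)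
  have c2 : ∀ a : ℝ, a ≠ 0 → Continuous fun v : ℝ => ((a : ℂ) + (v : ℂ) * Complex.I)⁻¹ :=
    fun a ha => Continuous.inv₀ (by fun_prop) fun v => hne a v (Or.inl ha)
  have e1 : (∫ u : ℝ in (-L)..L, ((u : ℂ) + ((-h : ℝ) : ℂ) * Complex.I)⁻¹)
      - ∫ u : ℝ in (-L)..L, ((u : ℂ) + (h : ℂ) * Complex.I)⁻¹
      = Complex.I * (4 * Real.arctan (L / h) : ℝ) := by
    rw [← integral_div_sq_add_sq_symm hh L, ← intervalIntegral.integral_sub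
      ((c1 _ (neg_ne_zero.2 hh.ne')).intervalIntegrable _ _) ((c1 _ hh.ne').intervalIntegrable _ _),
      ← intervalIntegral.integral_ofReal, ← intervalIntegral.integral_const_mul]
    refine intervalIntegral.integral_congr fun u _ => ?_
    have h1 := hne u h (Or.inr hh.ne')
    have h2 := hne u (-h) (Or.inr (neg_ne_zero.2 hh.ne'))
    have h3 : ((u : ℂ) ^ 2 + (h : ℂ) ^ 2) ≠ 0 := by
      have : u ^ 2 + h ^ 2 ≠ 0 := by positivity
      exact_mod_cast this
    rw [inv_sub_inv h2 h1]
    push_cast at h2 ⊢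
    rw [mul_div_assoc', div_eq_div_iff (mul_ne_zero h2 h1) h3]
    linear_combination (2 * (h : ℂ) ^ 3 * Complex.I) * Complex.I_sq
  have e2 : (Complex.I • ∫ v : ℝ in (-h)..h, ((L : ℂ) + (v : ℂ) * Complex.I)⁻¹)
      - Complex.I • ∫ v : ℝ in (-h)..h, (((-L : ℝ) : ℂ) + (v : ℂ) * Complex.I)⁻¹
      = Complex.I * (4 * Real.arctan (h / L) : ℝ) := by
    rw [← integral_div_sq_add_sq_symm hL h, ← smul_sub, ← intervalIntegral.integral_sub
      ((c2 _ hL.ne').intervalIntegrable _ _) ((c2 _ (neg_ne_zero.2 hL.ne')).intervalIntegrable _ _),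
      ← intervalIntegral.integral_ofReal, smul_eq_mul]
    congr 1
    refine intervalIntegral.integral_congr fun v _ => ?_
    have h1 := hne L v (Or.inl hL.ne')
    have h2 := hne (-L) v (Or.inl (neg_ne_zero.2 hL.ne'))
    have h3 : ((v : ℂ) ^ 2 + (L : ℂ) ^ 2) ≠ 0 := by
      have : v ^ 2 + L ^ 2 ≠ 0 := by positivity
      exact_mod_cast this
    rw [inv_sub_inv h1 h2]
    push_cast at h2 ⊢
    rw [div_eq_div_iff (mul_ne_zero h1 h2) h3]
    linear_combination -(2 * (L : ℂ) * v ^ 2) * Complex.I_sq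
  rw [add_sub_assoc, e1, e2]
  have h4 : Real.arctan (h / L) = Real.pi / 2 - Real.arctan (L / h) := by
    rw [← Real.arctan_inv_of_pos (div_pos hL hh), inv_div]
  rw [h4]; push_cast; ring

/-- The integral of the integrand of the auxiliary function along the line through `c`. -/
noncomputable def lineInt (s : ℂ) (c : ℝ) : ℂ := ∫ u : ℝ, auxIntegrand s (lineAt c u) * rot

theorem riemannAux_eq_neg_lineInt (s : ℂ) : riemannAux s = -lineInt s (1 / 2) := by
  simp only [riemannAux, lineInt, auxLine_eq, rot]

theorem auxIntegrand_lineAt_half (s : ℂ) (N : ℕ) (u : ℝ) :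
    auxIntegrand s (lineAt (N + 1 / 2) u) = lineAt (N + 1 / 2) u ^ (-s) *
      Complex.exp (Real.pi * Complex.I * (lineAt (N + 1 / 2) u ^ 2 - lineAt (N + 1 / 2) u)) /
      (1 + Complex.exp (-(2 * Real.pi * Complex.I * rot * u))) := by
  set x := lineAt (N + 1 / 2) u with hx
  have hx' : x = N + 1 / 2 + u * rot := by rw [hx, lineAt]; push_cast; rfl
  have e1 : Complex.exp (-(Real.pi * Complex.I * x))
      = -(Complex.exp (Real.pi * Complex.I * x) *
        Complex.exp (-(2 * Real.pi * Complex.I * rot * u))) := by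
    have : -(Real.pi * Complex.I * x) = Real.pi * Complex.I * x +
        -(2 * Real.pi * Complex.I * rot * u) - Real.pi * Complex.I
        - N * (2 * Real.pi * Complex.I) := by rw [hx']; ring
    rw [this, Complex.exp_sub, Complex.exp_sub, Complex.exp_add, Complex.exp_pi_mul_I,
      Complex.exp_nat_mul_two_pi_mul_I]; ring
  have e2 : Complex.exp (Real.pi * Complex.I * x) - Complex.exp (-(Real.pi * Complex.I * x))
      = Complex.exp (Real.pi * Complex.I * x) *
        (1 + Complex.exp (-(2 * Real.pi * Complex.I * rot * u))) := by rw [e1]; ring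
  rw [auxIntegrand, e2, mul_sub, Complex.exp_sub, ← mul_div_assoc, div_div]

theorem re_pi_mul_I_mul_lineAt (c u : ℝ) :
    (Real.pi * Complex.I * lineAt c u ^ 2).re = -Real.pi * u ^ 2 - Real.pi * √2 * c * u := by
  have h2 : √2 * √2 = 2 := Real.mul_self_sqrt (by norm_num)
  rw [mul_assoc, Complex.re_ofReal_mul, Complex.I_mul_re, sq, Complex.mul_im, lineAt_re, lineAt_im]
  linear_combination (-Real.pi * u ^ 2 / 2) * h2

/-- Completing the square: the Gaussian absorbs the growth of x^(-s) and of the cross term,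
uniformly for c ≤ C. -/
theorem exp_bound_aux {S C c u : ℝ} (hS : 0 ≤ S) (hC : c ≤ C) :
    S * (c + |u| + 5) + (-Real.pi * u ^ 2 + 8 * c * |u|)
      ≤ S * (C + 5) + (S + 8 * C + 1) ^ 2 + -|u| := by
  have h0 := abs_nonneg u
  have h1 : S * (c + |u| + 5) ≤ S * (C + |u| + 5) := by gcongr
  have h2 : 8 * c * |u| ≤ 8 * C * |u| := by gcongr
  rw [← sq_abs u]
  nlinarith [sq_nonneg (|u| - (S + 8 * C + 1)), Real.pi_gt_three, sq_nonneg (|u|)]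

theorem norm_auxIntegrand_half_le (s : ℂ) (N : ℕ) (u : ℝ) :
    ‖auxIntegrand s (lineAt (N + 1 / 2) u)‖ ≤
      2 * Real.exp (‖s‖ * (N + 1 / 2 + 5) + (‖s‖ + 8 * (N + 1 / 2) + 1) ^ 2) *
        Real.exp (-|u|) := by
  have hc : (1 / 2 : ℝ) ≤ N + 1 / 2 := by linarith [Nat.cast_nonneg (α := ℝ) N]
  have hN := Nat.cast_nonneg (α := ℝ) N
  have hD := half_le_norm_one_add_exp u
  rw [auxIntegrand_lineAt_half, norm_div, div_le_iff₀ (by linarith), norm_mul]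
  have h1 := norm_lineAt_cpow_le hc u s
  have h2 : ‖Complex.exp (Real.pi * Complex.I * (lineAt (N + 1 / 2) u ^ 2 - lineAt (N + 1 / 2) u))‖
      ≤ Real.exp (-Real.pi * u ^ 2 + 8 * (N + 1 / 2) * |u|) := by
    rw [Complex.norm_exp]
    refine Real.exp_le_exp.2 ?_
    rw [mul_sub, Complex.sub_re, re_pi_mul_I_mul_lineAt, mul_assoc (Real.pi : ℂ),
      Complex.re_ofReal_mul, Complex.I_mul_re, lineAt_im]
    have h2 : √2 ≤ 1.5 := by rw [Real.sqrt_le_left (by norm_num)]; norm_num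
    have hpi := Real.pi_lt_d2
    have hps : Real.pi * √2 ≤ 5 := by nlinarith [Real.pi_pos, Real.sqrt_nonneg 2]
    have hps0 : 0 ≤ Real.pi * √2 := by positivity
    have hu : -(u * (Real.pi * √2 * N)) ≤ |u| * (Real.pi * √2 * N) := by
      rw [← neg_mul]; exact mul_le_mul_of_nonneg_right (neg_le_abs u) (by positivity)
    have : |u| * (Real.pi * √2 * N) ≤ |u| * (5 * N) := by gcongr
    nlinarith [abs_nonneg u]
  calc _ ≤ Real.exp (‖s‖ * (N + 1 / 2 + |u| + 5)) *
        Real.exp (-Real.pi * u ^ 2 + 8 * (N + 1 / 2) * |u|) := by gcongr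
    _ ≤ Real.exp (‖s‖ * (N + 1 / 2 + 5) + (‖s‖ + 8 * (N + 1 / 2) + 1) ^ 2) *
        Real.exp (-|u|) * 1 := by
        rw [← Real.exp_add, ← Real.exp_add, mul_one]
        exact Real.exp_le_exp.2 (exp_bound_aux (norm_nonneg s) le_rfl)
    _ ≤ Real.exp (‖s‖ * (N + 1 / 2 + 5) + (‖s‖ + 8 * (N + 1 / 2) + 1) ^ 2) *
        Real.exp (-|u|) * (2 * ‖1 + Complex.exp (-(2 * Real.pi * Complex.I * rot * u))‖) := by
        gcongr; linarith
    _ = _ := by ring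

theorem continuous_lineAt (c : ℝ) : Continuous (lineAt c) :=
  continuous_iff_continuousAt.2 fun u => (hasDerivAt_lineAt c u).continuousAt

theorem continuous_auxIntegrand_half (s : ℂ) (N : ℕ) :
    Continuous fun u => auxIntegrand s (lineAt (N + 1 / 2) u) := by
  simp_rw [auxIntegrand_lineAt_half]
  have hl := continuous_lineAt (N + 1 / 2)
  refine Continuous.div ?_ (by fun_prop) fun u => one_add_exp_ne_zero u
  exact (hl.cpow continuous_const fun u => lineAt_mem_slitPlane (by positivity) u).mul
    (by fun_prop)

theorem integrable_auxIntegrand_half (s : ℂ) (N : ℕ) :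
    Integrable fun u => auxIntegrand s (lineAt (N + 1 / 2) u) :=
  (norm_integral_sub_interval_le (continuous_auxIntegrand_half s N)
    (norm_auxIntegrand_half_le s N) le_rfl).1

/-- Here c need not be a half-integer. For |u| ≥ 1 the point is far enough from the real axis that
one exponential dominates the denominator. This is for the short sides of the rectangles, which join
two neighbouring lines. -/
theorem norm_auxIntegrand_le_of_one_le {c C u : ℝ} (s : ℂ) (hc : 1 / 2 ≤ c) (hC : c ≤ C)
    (hu : 1 ≤ |u|) : ‖auxIntegrand s (lineAt c u)‖ ≤
      Real.exp (‖s‖ * (C + 5) + (‖s‖ + 8 * C + 1) ^ 2) * Real.exp (-|u|) := by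
  have h2 : √2 ≤ 1.5 := by rw [Real.sqrt_le_left (by norm_num)]; norm_num
  have h2' : 1.4 ≤ √2 := by rw [Real.le_sqrt' (by norm_num)]; norm_num
  have hpi := Real.pi_lt_d2
  have hpi' := Real.pi_gt_three
  have hc0 : 0 ≤ c := by linarith
  have hden : 1 ≤ ‖Complex.exp (Real.pi * Complex.I * lineAt c u) -
      Complex.exp (-(Real.pi * Complex.I * lineAt c u))‖ := by
    set t := Real.pi * (u * (√2 / 2)) with ht
    have hre : (Real.pi * Complex.I * lineAt c u).re = -t := by
      rw [mul_assoc, Complex.re_ofReal_mul, Complex.I_mul_re, lineAt_im, ht]; ring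
    have n1 : ‖Complex.exp (Real.pi * Complex.I * lineAt c u)‖ = Real.exp (-t) := by
      rw [Complex.norm_exp, hre]
    have n2 : ‖Complex.exp (-(Real.pi * Complex.I * lineAt c u))‖ = Real.exp t := by
      rw [Complex.norm_exp, Complex.neg_re, hre, neg_neg]
    have htu : |t| = |u| * (Real.pi * (√2 / 2)) := by
      rw [ht, abs_mul, abs_mul, abs_of_pos Real.pi_pos, abs_of_pos (show 0 < √2 / 2 by positivity)]
      ring
    have hp2 : 2 ≤ Real.pi * (√2 / 2) := by nlinarith
    have ht2 : 2 ≤ |t| := by rw [htu]; nlinarith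
    rcases le_abs.1 ht2 with h | h
    · have := norm_sub_norm_le (Complex.exp (-(Real.pi * Complex.I * lineAt c u)))
        (Complex.exp (Real.pi * Complex.I * lineAt c u))
      rw [n1, n2, norm_sub_rev] at this
      have := Real.add_one_le_exp t
      have : Real.exp (-t) ≤ 1 := Real.exp_le_one_iff.2 (by linarith)
      linarith
    · have := norm_sub_norm_le (Complex.exp (Real.pi * Complex.I * lineAt c u))
        (Complex.exp (-(Real.pi * Complex.I * lineAt c u)))
      rw [n1, n2] at this
      have := Real.add_one_le_exp (-t)
      have : Real.exp t ≤ 1 := Real.exp_le_one_iff.2 (by linarith)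
      linarith
  have hnum : ‖Complex.exp (Real.pi * Complex.I * lineAt c u ^ 2)‖
      ≤ Real.exp (-Real.pi * u ^ 2 + 8 * c * |u|) := by
    rw [Complex.norm_exp, re_pi_mul_I_mul_lineAt]
    refine Real.exp_le_exp.2 ?_
    have hps : Real.pi * √2 ≤ 8 := by nlinarith [Real.pi_pos, Real.sqrt_nonneg 2]
    have hu : -(u * (Real.pi * √2 * c)) ≤ |u| * (Real.pi * √2 * c) := by
      rw [← neg_mul]; exact mul_le_mul_of_nonneg_right (neg_le_abs u) (by positivity)
    have : |u| * (Real.pi * √2 * c) ≤ |u| * (8 * c) := by gcongr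
    linarith
  rw [auxIntegrand, norm_div, norm_mul]
  calc _ ≤ ‖lineAt c u ^ (-s)‖ * ‖Complex.exp (Real.pi * Complex.I * lineAt c u ^ 2)‖ :=
        div_le_self (by positivity) hden
    _ ≤ Real.exp (‖s‖ * (c + |u| + 5)) * Real.exp (-Real.pi * u ^ 2 + 8 * c * |u|) := by
        gcongr; exact norm_lineAt_cpow_le hc u s
    _ ≤ _ := by
        rw [← Real.exp_add, ← Real.exp_add]
        exact Real.exp_le_exp.2 (exp_bound_aux (norm_nonneg s) hC)

end Shift

/-! ### The residue at a positive integer and the resulting Dirichlet sum -/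

section Residue

open MeasureTheory intervalIntegral Topology

/-- In the coordinate ζ = u + iv about n, horizontal lines are lines of integration; v = ±√2/4 gives
those through n ∓ 1/2. -/
theorem natCast_add_rot_mul (n u v : ℝ) :
    (n : ℂ) + rot * (u + v * Complex.I) = lineAt (n - √2 * v) (u + v) := by
  rw [lineAt, rot_eq]; push_cast
  linear_combination (√2 / 2 * v : ℂ) * Complex.I_sq

/-- The open strip in which `n + e^{iπ/4} ζ` stays between the neighbouring integers. -/
def poleStrip : Set ℂ := {ζ | |ζ.im| < √2 / 2}

theorem isOpen_poleStrip : IsOpen poleStrip :=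
  isOpen_lt (continuous_abs.comp Complex.continuous_im) continuous_const

theorem re_mul_rot_pos_of_mem_poleStrip {n : ℕ} (hn : 1 ≤ n) {ζ : ℂ} (hζ : ζ ∈ poleStrip) :
    0 < (((n : ℂ) + rot * ζ) * rot).re := by
  have h := natCast_add_rot_mul n ζ.re ζ.im
  rw [Complex.re_add_im, Complex.ofReal_natCast] at h
  rw [h]
  refine re_lineAt_mul_rot_pos ?_ _
  have h1 : |ζ.im| < √2 / 2 := hζ
  have h2 : √2 * √2 = 2 := Real.mul_self_sqrt (by norm_num)
  have h3 : √2 * ζ.im ≤ √2 * |ζ.im| := by gcongr; exact le_abs_self _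
  have h4 : √2 * |ζ.im| < √2 * (√2 / 2) := by gcongr
  have h5 : (1 : ℝ) ≤ n := by exact_mod_cast hn
  linarith

/-- The denominator of the integrand in the coordinate `ζ` around the pole `n`. -/
noncomputable def poleDen (n : ℕ) (ζ : ℂ) : ℂ :=
  Complex.exp (Real.pi * Complex.I * (n + rot * ζ)) -
    Complex.exp (-(Real.pi * Complex.I * (n + rot * ζ)))

theorem hasDerivAt_poleDen (n : ℕ) (ζ : ℂ) : HasDerivAt (poleDen n)
    (Real.pi * Complex.I * rot * (Complex.exp (Real.pi * Complex.I * (n + rot * ζ)) +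
      Complex.exp (-(Real.pi * Complex.I * (n + rot * ζ))))) ζ := by
  have h := (((hasDerivAt_id ζ).const_mul rot).const_add (n : ℂ)).const_mul (Real.pi * Complex.I)
  exact (h.cexp.sub h.neg.cexp).congr_deriv (by simp only [id, Pi.neg_apply]; ring)

theorem exp_pi_mul_I_mul_natCast (n : ℕ) :
    Complex.exp (Real.pi * Complex.I * n) = (-1) ^ n := by
  rw [mul_comm, Complex.exp_nat_mul, Complex.exp_pi_mul_I]

theorem exp_neg_pi_mul_I_mul_natCast (n : ℕ) :
    Complex.exp (-(Real.pi * Complex.I * n)) = (-1) ^ n := by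
  rw [Complex.exp_neg, exp_pi_mul_I_mul_natCast, ← inv_pow]; norm_num

theorem poleDen_zero (n : ℕ) : poleDen n 0 = 0 := by
  rw [poleDen, mul_zero, add_zero, exp_pi_mul_I_mul_natCast, exp_neg_pi_mul_I_mul_natCast, sub_self]

theorem deriv_poleDen_zero (n : ℕ) :
    deriv (poleDen n) 0 = 2 * Real.pi * Complex.I * rot * (-1) ^ n := by
  rw [(hasDerivAt_poleDen n 0).deriv, mul_zero, add_zero, exp_pi_mul_I_mul_natCast,
    exp_neg_pi_mul_I_mul_natCast]; ring

theorem two_pi_I_ne_zero : (2 * Real.pi * Complex.I : ℂ) ≠ 0 := Complex.two_pi_I_ne_zero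

/-- The zeros correspond to integers m, at ζ = (m - n) e^{-iπ/4}; for m ≠ n these have |Im ζ| ≥
√2/2. -/
theorem poleDen_ne_zero {n : ℕ} {ζ : ℂ} (hζ : ζ ∈ poleStrip) (h0 : ζ ≠ 0) : poleDen n ζ ≠ 0 := by
  intro h
  rw [poleDen, sub_eq_zero, Complex.exp_eq_exp_iff_exists_int] at h
  obtain ⟨m, hm⟩ := h
  have e : (n : ℂ) + rot * ζ = m := by
    refine mul_left_cancel₀ two_pi_I_ne_zero ?_
    linear_combination hm
  have e2 : ζ = ((m - n : ℤ) : ℂ) * (starRingEnd ℂ) rot := by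
    have hr : rot * (starRingEnd ℂ) rot = 1 := by
      rw [Complex.mul_conj, Complex.normSq_eq_norm_sq, norm_rot]; norm_num
    push_cast
    linear_combination (starRingEnd ℂ rot) * e - ζ * hr
  have h1 : |ζ.im| < √2 / 2 := hζ
  have h2 : ζ.im = -((m - n : ℤ) : ℝ) * (√2 / 2) := by
    have : ((m - n : ℤ) : ℂ) = (((m - n : ℤ) : ℝ) : ℂ) := by push_cast; rfl
    rw [e2, this, Complex.im_ofReal_mul, Complex.conj_im, rot_im]; ring
  have hk : m - n ≠ 0 := by
    intro hk; rw [hk] at e2; simp at e2; exact h0 e2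
  have h3 : (1 : ℝ) ≤ |((m - n : ℤ) : ℝ)| := by
    rw [← Int.cast_abs]; exact_mod_cast Int.one_le_abs hk
  rw [h2, abs_mul, abs_neg, abs_of_pos (show 0 < √2 / 2 by positivity)] at h1
  have : 0 < √2 / 2 := by positivity
  nlinarith

theorem dslope_poleDen_ne_zero {n : ℕ} {ζ : ℂ} (hζ : ζ ∈ poleStrip) :
    dslope (poleDen n) 0 ζ ≠ 0 := by
  rcases eq_or_ne ζ 0 with rfl | h0
  · rw [dslope_same, deriv_poleDen_zero]
    exact mul_ne_zero (mul_ne_zero two_pi_I_ne_zero rot_ne_zero) (pow_ne_zero _ (by norm_num))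
  · rw [dslope_of_ne _ h0, slope_def_field, poleDen_zero, sub_zero, sub_zero]
    exact div_ne_zero (poleDen_ne_zero hζ h0) h0

/-- The integrand multiplied by `ζ`, where `ζ` is the coordinate around the pole `n`. -/
noncomputable def poleNum (s : ℂ) (n : ℕ) (ζ : ℂ) : ℂ :=
  ((n : ℂ) + rot * ζ) ^ (-s) * Complex.exp (Real.pi * Complex.I * (n + rot * ζ) ^ 2) * rot /
    dslope (poleDen n) 0 ζ

theorem zero_mem_poleStrip : (0 : ℂ) ∈ poleStrip := by
  change |(0 : ℂ).im| < √2 / 2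
  simp

theorem differentiableOn_poleNum (s : ℂ) {n : ℕ} (hn : 1 ≤ n) :
    DifferentiableOn ℂ (poleNum s n) poleStrip := by
  have hd : DifferentiableOn ℂ (dslope (poleDen n) 0) poleStrip :=
    (Complex.differentiableOn_dslope (isOpen_poleStrip.mem_nhds zero_mem_poleStrip)).2
      fun ζ _ => (hasDerivAt_poleDen n ζ).differentiableAt.differentiableWithinAt
  refine DifferentiableOn.div ?_ hd fun ζ hζ => dslope_poleDen_ne_zero hζ
  refine DifferentiableOn.mul (DifferentiableOn.mul ?_ (by fun_prop)) (differentiableOn_const _)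
  exact DifferentiableOn.cpow (by fun_prop) (differentiableOn_const _)
    fun ζ hζ => mem_slitPlane_of_re_mul_rot_pos (re_mul_rot_pos_of_mem_poleStrip hn hζ)

/-- Since n² and n have the same parity, e^{πi n²} = (-1)^n cancels the sign in the derivative of
the denominator. -/
theorem poleNum_zero (s : ℂ) (n : ℕ) :
    poleNum s n 0 = (n : ℂ) ^ (-s) / (2 * Real.pi * Complex.I) := by
  have h1 : Complex.exp (Real.pi * Complex.I * (n : ℂ) ^ 2) = (-1) ^ n := by
    have : (Real.pi * Complex.I * (n : ℂ) ^ 2) = Real.pi * Complex.I * ((n ^ 2 : ℕ) : ℂ) := by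
      push_cast; rfl
    rw [this, exp_pi_mul_I_mul_natCast]
    rcases Nat.even_or_odd n with h | h
    · rw [h.neg_one_pow, (h.pow_of_ne_zero two_ne_zero).neg_one_pow]
    · rw [h.neg_one_pow, (h.pow).neg_one_pow]
  rw [poleNum, dslope_same, deriv_poleDen_zero, mul_zero, add_zero, h1]
  have h2 : ((-1 : ℂ)) ^ n ≠ 0 := pow_ne_zero _ (by norm_num)
  have h3 := rot_ne_zero
  have h4 : (Real.pi : ℂ) ≠ 0 := by exact_mod_cast Real.pi_ne_zero
  field_simp

/-- The regular part of the integrand at the pole `n`. -/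
noncomputable def poleReg (s : ℂ) (n : ℕ) : ℂ → ℂ := dslope (poleNum s n) 0

theorem differentiableOn_poleReg (s : ℂ) {n : ℕ} (hn : 1 ≤ n) :
    DifferentiableOn ℂ (poleReg s n) poleStrip :=
  (Complex.differentiableOn_dslope (isOpen_poleStrip.mem_nhds zero_mem_poleStrip)).2
    (differentiableOn_poleNum s hn)

/-- The principal part is split off: Cauchy's theorem handles `poleReg`, and `rect_integral_inv`
handles ζ⁻¹. -/
theorem poleReg_eq (s : ℂ) (n : ℕ) {ζ : ℂ} (h0 : ζ ≠ 0) :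
    poleReg s n ζ = auxIntegrand s (n + rot * ζ) * rot
      - (n : ℂ) ^ (-s) / (2 * Real.pi * Complex.I) * ζ⁻¹ := by
  rw [poleReg, dslope_of_ne _ h0, slope_def_field, sub_zero, poleNum_zero, poleNum,
    dslope_of_ne _ h0, slope_def_field, poleDen_zero, sub_zero, sub_zero, auxIntegrand, ← poleDen]
  rw [div_div_eq_mul_div, sub_div, div_mul_eq_mul_div, div_right_comm,
    mul_div_cancel_right₀ _ h0, div_eq_mul_inv _ ζ]

theorem tendsto_side (s : ℂ) {n : ℕ} (hn : 1 ≤ n) (e : ℝ → ℝ) (he : ∀ L, |e L| = |L|) :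
    Tendsto (fun L : ℝ => ∫ v : ℝ in (-(√2 / 4))..(√2 / 4),
      auxIntegrand s (n + rot * ((e L : ℂ) + v * Complex.I)) * rot) atTop (𝓝 0) := by
  set K := Real.exp (‖s‖ * ((n + 1 / 2 : ℝ) + 5) + (‖s‖ + 8 * (n + 1 / 2) + 1) ^ 2) with hK
  have h2 : √2 * √2 = 2 := Real.mul_self_sqrt (by norm_num)
  have h15 : √2 ≤ 2 := by rw [Real.sqrt_le_left (by norm_num)]; norm_num
  have hs0 : 0 < √2 := by positivity
  have hn' : (1 : ℝ) ≤ n := by exact_mod_cast hn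
  have hbound : ∀ᶠ L : ℝ in atTop, ‖∫ v : ℝ in (-(√2 / 4))..(√2 / 4),
      auxIntegrand s (n + rot * ((e L : ℂ) + v * Complex.I)) * rot‖
      ≤ K * Real.exp (-(L - 1)) * |√2 / 4 - -(√2 / 4)| := by
    filter_upwards [eventually_ge_atTop 2] with L hL
    refine norm_integral_le_of_norm_le_const fun v hv => ?_
    rw [Set.uIoc_of_le (by linarith)] at hv
    have hv1 : |v| ≤ √2 / 4 := abs_le.2 ⟨hv.1.le, hv.2⟩
    rw [norm_mul, norm_rot, mul_one]
    have hx := natCast_add_rot_mul n (e L) v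
    rw [Complex.ofReal_natCast] at hx
    rw [hx]
    have habs : L - 1 ≤ |e L + v| := by
      have := abs_sub_abs_le_abs_sub (e L) (-v)
      rw [abs_neg, sub_neg_eq_add, he, abs_of_nonneg (by linarith : (0 : ℝ) ≤ L)] at this
      linarith
    have hsv := abs_le.1 hv1
    refine (norm_auxIntegrand_le_of_one_le (C := n + 1 / 2) s ?_ ?_ (by linarith)).trans ?_
    · nlinarith
    · nlinarith
    · rw [hK]
      gcongr
  refine squeeze_zero_norm' hbound ?_
  have h0 : Tendsto (fun L : ℝ => Real.exp (-(L - 1))) atTop (𝓝 0) :=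
    Real.tendsto_exp_neg_atTop_nhds_zero.comp (tendsto_atTop_add_const_right _ (-1) tendsto_id)
  simpa using (h0.const_mul K).mul_const |√2 / 4 - -(√2 / 4)|

theorem tendsto_horizontal (s : ℂ) (n N : ℕ) (v : ℝ) (h : (n : ℝ) - √2 * v = N + 1 / 2) :
    Tendsto (fun L : ℝ => ∫ u : ℝ in (-L)..L,
      auxIntegrand s (n + rot * ((u : ℂ) + (v : ℂ) * Complex.I)) * rot) atTop
      (𝓝 (lineInt s (N + 1 / 2))) := by
  have e : ∀ u : ℝ, auxIntegrand s (n + rot * ((u : ℂ) + (v : ℂ) * Complex.I)) * rot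
      = auxIntegrand s (lineAt (N + 1 / 2) (u + v)) * rot := fun u => by
    have hx := natCast_add_rot_mul n u v
    rw [Complex.ofReal_natCast] at hx
    rw [hx, h]
  simp_rw [e]
  have hi := ((integrable_auxIntegrand_half s N).mul_const rot).comp_add_right v
  have := intervalIntegral_tendsto_integral hi tendsto_neg_atTop_atBot tendsto_id
  rwa [integral_add_right_eq_self fun u => auxIntegrand s (lineAt (N + 1 / 2) u) * rot] at this

/-- The residue theorem at n = N + 1 on the rectangles |Re ζ| ≤ L, |Im ζ| ≤ √2/4, with L → ∞. The
lower side is the line through n + 1/2, the upper side the line through n - 1/2, and the short sides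
vanish in the limit. -/
theorem lineInt_sub_lineInt (s : ℂ) (N : ℕ) :
    lineInt s ((N + 1 : ℕ) + 1 / 2) - lineInt s (N + 1 / 2) = ((N + 1 : ℕ) : ℂ) ^ (-s) := by
  set n := N + 1 with hn
  have hn1 : 1 ≤ n := by omega
  set h : ℝ := √2 / 4 with hh
  have hs0 : 0 < √2 := by positivity
  have hh0 : 0 < h := by positivity
  have h2 : √2 * √2 = 2 := Real.mul_self_sqrt (by norm_num)
  set f : ℂ → ℂ := fun ζ => auxIntegrand s (n + rot * ζ) * rot with hf
  set r : ℂ := (n : ℂ) ^ (-s) / (2 * Real.pi * Complex.I) with hr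
  have key : ∀ L : ℝ, 0 < L →
      (((∫ u : ℝ in (-L)..L, f ((u : ℂ) + ((-h : ℝ) : ℂ) * Complex.I))
      - ∫ u : ℝ in (-L)..L, f ((u : ℂ) + (h : ℂ) * Complex.I))
      + Complex.I • ∫ v : ℝ in (-h)..h, f ((L : ℂ) + (v : ℂ) * Complex.I))
      - Complex.I • ∫ v : ℝ in (-h)..h, f (((-L : ℝ) : ℂ) + (v : ℂ) * Complex.I)
      = (n : ℂ) ^ (-s) := by
    intro L hL
    have hsub : Set.uIcc (-L) L ×ℂ Set.uIcc (-h) h ⊆ poleStrip := by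
      rintro ζ ⟨-, hζ⟩
      simp only [Set.mem_preimage] at hζ
      rw [Set.uIcc_of_le (by linarith)] at hζ
      change |ζ.im| < √2 / 2
      rw [abs_lt]; constructor <;> linarith [hζ.1, hζ.2]
    have hrect := Complex.integral_boundary_rect_eq_zero_of_differentiableOn (poleReg s n)
      (⟨-L, -h⟩ : ℂ) (⟨L, h⟩ : ℂ) ((differentiableOn_poleReg s hn1).mono hsub)
    have hrect2 := rect_integral_inv hL hh0
    simp only [] at hrect
    have hne : ∀ a b : ℝ, (a ≠ 0 ∨ b ≠ 0) → (a : ℂ) + (b : ℂ) * Complex.I ≠ 0 := by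
      intro a b hab h0
      have h1 := congrArg Complex.re h0
      have h2 := congrArg Complex.im h0
      simp at h1 h2
      tauto
    have hcont : ContinuousOn (poleReg s n) poleStrip := (differentiableOn_poleReg s hn1).continuousOn
    have hmem : ∀ u v : ℝ, |v| ≤ h → (u : ℂ) + (v : ℂ) * Complex.I ∈ poleStrip := by
      intro u v hv
      change |((u : ℂ) + (v : ℂ) * Complex.I).im| < √2 / 2
      simp; linarith
    have eH : ∀ v : ℝ, |v| = h → ∫ u : ℝ in (-L)..L, f ((u : ℂ) + (v : ℂ) * Complex.I)
        = (∫ u : ℝ in (-L)..L, poleReg s n ((u : ℂ) + (v : ℂ) * Complex.I))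
          + r * ∫ u : ℝ in (-L)..L, ((u : ℂ) + (v : ℂ) * Complex.I)⁻¹ := by
      intro v hv
      have hv0 : v ≠ 0 := by rintro rfl; simp at hv; linarith
      rw [← intervalIntegral.integral_const_mul, ← intervalIntegral.integral_add]
      · refine intervalIntegral.integral_congr fun u _ => ?_
        simp only [poleReg_eq s n (hne u v (Or.inr hv0)), f, r]; ring
      · refine Continuous.intervalIntegrable ?_ _ _
        exact hcont.comp_continuous (by fun_prop) fun u => hmem u v hv.le
      · refine Continuous.intervalIntegrable ?_ _ _
        exact continuous_const.mul (Continuous.inv₀ (by fun_prop) fun u => hne u v (Or.inr hv0))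
    have eV : ∀ u : ℝ, u ≠ 0 → ∫ v : ℝ in (-h)..h, f ((u : ℂ) + (v : ℂ) * Complex.I)
        = (∫ v : ℝ in (-h)..h, poleReg s n ((u : ℂ) + (v : ℂ) * Complex.I))
          + r * ∫ v : ℝ in (-h)..h, ((u : ℂ) + (v : ℂ) * Complex.I)⁻¹ := by
      intro u hu0
      rw [← intervalIntegral.integral_const_mul, ← intervalIntegral.integral_add]
      · refine intervalIntegral.integral_congr fun v _ => ?_
        simp only [poleReg_eq s n (hne u v (Or.inl hu0)), f, r]; ring
      · refine ContinuousOn.intervalIntegrable ?_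
        refine hcont.comp (by fun_prop) fun v hv => hmem u v ?_
        rw [Set.uIcc_of_le (by linarith)] at hv
        exact abs_le.2 hv
      · refine Continuous.intervalIntegrable ?_ _ _
        exact continuous_const.mul (Continuous.inv₀ (by fun_prop) fun v => hne u v (Or.inl hu0))
    rw [eH (-h) (by rw [abs_neg, abs_of_pos hh0]), eH h (abs_of_pos hh0), eV L hL.ne',
      eV (-L) (neg_ne_zero.2 hL.ne')]
    simp only [smul_eq_mul] at hrect hrect2 ⊢
    have hrr : r * (2 * Real.pi * Complex.I) = (n : ℂ) ^ (-s) := by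
      rw [hr, div_mul_cancel₀ _ two_pi_I_ne_zero]
    linear_combination hrect + r * hrect2 + hrr
  have t1 := tendsto_horizontal s n n (-h) (by rw [hh]; linarith)
  have t2 := tendsto_horizontal s n N h (by rw [hh, hn]; push_cast; linarith)
  have t3 := (tendsto_side s hn1 (fun L => L) fun L => rfl).const_smul Complex.I
  have t4 := (tendsto_side s hn1 (fun L => -L) fun L => abs_neg L).const_smul Complex.I
  have t := ((t1.sub t2).add t3).sub t4
  rw [smul_zero, add_zero, sub_zero] at t
  refine tendsto_nhds_unique t (tendsto_const_nhds.congr' ?_)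
  filter_upwards [eventually_gt_atTop 0] with L hL
  exact (key L hL).symm

theorem riemannAux_eq_sum_sub_lineInt (s : ℂ) (N : ℕ) :
    riemannAux s = ∑ n ∈ Finset.range N, ((n + 1 : ℕ) : ℂ) ^ (-s) - lineInt s (N + 1 / 2) := by
  induction N with
  | zero => simp [riemannAux_eq_neg_lineInt]
  | succ N ih =>
    rw [Finset.sum_range_succ, ← lineInt_sub_lineInt s N, ih]; ring

end Residue

/-! ### The saddle point -/

section Saddle

open MeasureTheory Topology

/-- The logarithm, divided by `2πi`, of the main term at the saddle point. -/
noncomputable def phase (z : ℂ) : ℂ :=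
  z ^ 2 * (Complex.log z - 1 / 2 - Complex.I * Real.pi / 2) + Complex.I / 2 * z

/-- The variable `s` in terms of the saddle point `-iz`. -/
noncomputable def sOf (z : ℂ) : ℂ := -(2 * Real.pi * Complex.I) * z ^ 2

theorem log_neg_I_mul {z : ℂ} (hz : 0 < z.re) :
    Complex.log (-Complex.I * z) = Complex.log z - Complex.I * Real.pi / 2 := by
  have hz0 : z ≠ 0 := by rintro rfl; simp at hz
  have hI : -Complex.I ≠ 0 := neg_ne_zero.2 Complex.I_ne_zero
  have harg := abs_lt.1 (Complex.abs_arg_lt_pi_div_two_iff.2 (Or.inl hz))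
  have e := Complex.log_neg_I
  rw [(Complex.log_mul_eq_add_log_iff hI hz0).2, e]
  · ring
  · rw [Complex.arg_neg_I]
    have := Real.pi_pos
    constructor <;> linarith

/-- The right side is the logarithm of x^(-s) e^{πi x²} e^{-πi x} at x = -iz. The last factor stands
for the kernel 1/(e^{πix} - e^{-πix}), whose first exponential dominates when Im x → -∞. -/
theorem exp_two_pi_I_mul_phase {z : ℂ} (hz : 0 < z.re) :
    2 * Real.pi * Complex.I * phase z = -sOf z * Complex.log (-Complex.I * z)
      + Real.pi * Complex.I * (-Complex.I * z) ^ 2 - Real.pi * Complex.I * (-Complex.I * z) := by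
  rw [log_neg_I_mul hz, phase, sOf]
  linear_combination (-(Real.pi : ℂ) * Complex.I * z ^ 2) * Complex.I_sq

/-- The distance along the real axis from the saddle line to the line of integration. -/
noncomputable def lineShift (z : ℂ) : ℝ := ⌊z.re + z.im⌋₊ + 1 / 2 - (z.re + z.im)

theorem abs_lineShift_le {z : ℂ} (hz : 0 ≤ z.re + z.im) : |lineShift z| ≤ 1 / 2 := by
  have h1 := Nat.floor_le hz
  have h2 := Nat.lt_floor_add_one (z.re + z.im)
  rw [lineShift, abs_le]; constructor <;> linarith

/-- The line of direction e^{iπ/4} through -iz meets the real axis at Re z + Im z, at distance √2 Re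
z from -iz. With v as parameter the integral is centred at the saddle. -/
theorem lineAt_saddle (z : ℂ) (v : ℝ) :
    lineAt (⌊z.re + z.im⌋₊ + 1 / 2) (v - z.re * √2) = -Complex.I * z + lineAt (lineShift z) v := by
  apply Complex.ext
  · have h2 : √2 * √2 = 2 := Real.mul_self_sqrt (by norm_num)
    rw [Complex.add_re, lineAt_re, lineAt_re, lineShift]
    simp
    linear_combination (-z.re / 2) * h2
  · have h2 : √2 * √2 = 2 := Real.mul_self_sqrt (by norm_num)
    rw [Complex.add_im, lineAt_im, lineAt_im]
    simp
    linear_combination (-z.re / 2) * h2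

/-- The exponent of the integrand relative to the saddle point. -/
noncomputable def relPhase (z : ℂ) (v : ℝ) : ℂ :=
  -sOf z * (Complex.log (-Complex.I * z + lineAt (lineShift z) v) - Complex.log (-Complex.I * z))
    + Real.pi * Complex.I * ((-Complex.I * z + lineAt (lineShift z) v) ^ 2 - (-Complex.I * z) ^ 2)

theorem norm_log_one_add_sub_le {w : ℂ} (hw : ‖w‖ ≤ 1 / 2) :
    ‖Complex.log (1 + w) - w + w ^ 2 / 2‖ ≤ ‖w‖ ^ 3 := by
  have h := Complex.norm_log_sub_logTaylor_le 2 (z := w) (by linarith)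
  have e : Complex.logTaylor (2 + 1) w = w - w ^ 2 / 2 := by
    simp [Complex.logTaylor, Finset.sum_range_succ]; ring
  rw [e, ← sub_add] at h
  refine h.trans ?_
  have h1 : (1 - ‖w‖)⁻¹ ≤ 2 := by
    rw [inv_le_comm₀ (by linarith) (by norm_num)]; linarith
  have h3 : 0 ≤ ‖w‖ ^ 3 := by positivity
  rw [div_le_iff₀ (by norm_num)]
  norm_num
  nlinarith

theorem log_add_sub_log {x y : ℂ} (hx : 0 < x.re) (hy : ‖y‖ ≤ ‖x‖ / 2) :
    Complex.log (x + y) - Complex.log x = Complex.log (1 + y / x) := by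
  have hx0 : x ≠ 0 := by rintro rfl; simp at hx
  have hxn : 0 < ‖x‖ := norm_pos_iff.2 hx0
  have hw : ‖y / x‖ ≤ 1 / 2 := by rw [norm_div, div_le_iff₀ hxn]; linarith
  have hre : 0 < (1 + y / x).re := by
    have := (abs_le.1 ((Complex.abs_re_le_norm (y / x)).trans hw)).1
    rw [Complex.add_re, Complex.one_re]; linarith
  have h1w : 1 + y / x ≠ 0 := by intro h0; rw [h0] at hre; simp at hre
  have a1 := abs_lt.1 (Complex.abs_arg_lt_pi_div_two_iff.2 (Or.inl hx))
  have a2 := abs_lt.1 (Complex.abs_arg_lt_pi_div_two_iff.2 (Or.inl hre))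
  have e : x + y = x * (1 + y / x) := by field_simp
  rw [e, (Complex.log_mul_eq_add_log_iff hx0 h1w).2 ⟨by linarith, by linarith⟩]
  ring

theorem neg_I_mul_re (z : ℂ) : (-Complex.I * z).re = z.im := by simp
theorem neg_I_mul_im (z : ℂ) : (-Complex.I * z).im = -z.re := by simp
theorem norm_neg_I_mul (z : ℂ) : ‖-Complex.I * z‖ = ‖z‖ := by simp

/-- With x = -iz, w = y/x and s = 2πi x², expand log(1 + w). The linear terms cancel because x is a
saddle, and the two quadratic terms add up to 2πi y². Only the cubic remainder of the logarithm is
left. -/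
theorem norm_relPhase_sub_le {z : ℂ} (hz : 0 < z.im) {v : ℝ}
    (hv : ‖lineAt (lineShift z) v‖ ≤ ‖z‖ / 2) :
    ‖relPhase z v - 2 * Real.pi * Complex.I * lineAt (lineShift z) v ^ 2‖
      ≤ 2 * Real.pi * ‖lineAt (lineShift z) v‖ ^ 3 / ‖z‖ := by
  set x := -Complex.I * z with hx
  set y := lineAt (lineShift z) v with hy
  have hxn : ‖x‖ = ‖z‖ := norm_neg_I_mul z
  have hx0 : x ≠ 0 := by
    intro h; have := neg_I_mul_re z; rw [← hx, h] at this; simp at this; linarith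
  have hzn : 0 < ‖z‖ := by rw [← hxn]; exact norm_pos_iff.2 hx0
  have hs : sOf z = 2 * Real.pi * Complex.I * x ^ 2 := by
    rw [sOf, hx]; linear_combination (-2 * Real.pi * Complex.I * z ^ 2) * Complex.I_sq
  have e : relPhase z v - 2 * Real.pi * Complex.I * y ^ 2
      = -(2 * Real.pi * Complex.I * x ^ 2) *
        (Complex.log (1 + y / x) - y / x + (y / x) ^ 2 / 2) := by
    rw [relPhase, ← hx, ← hy, log_add_sub_log (by rw [hx, neg_I_mul_re]; exact hz)
      (by rw [hxn]; exact hv), hs]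
    field_simp; ring
  have hw : ‖y / x‖ ≤ 1 / 2 := by rw [norm_div, hxn, div_le_iff₀ hzn]; linarith
  rw [e, norm_mul, norm_neg, norm_mul, norm_mul, norm_mul, Complex.norm_ofNat, Complex.norm_I,
    Complex.norm_real, Real.norm_eq_abs, abs_of_pos Real.pi_pos, mul_one, norm_pow, hxn]
  calc _ ≤ 2 * Real.pi * ‖z‖ ^ 2 * ‖y / x‖ ^ 3 := by
        gcongr; exact norm_log_one_add_sub_le hw
    _ = _ := by rw [norm_div, hxn]; field_simp

theorem sq_re_sub_im_le (w : ℂ) : (w.re - w.im) ^ 2 ≤ 2 * ‖w‖ ^ 2 := by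
  rw [Complex.sq_norm, Complex.normSq_apply]
  nlinarith [sq_nonneg (w.re + w.im)]

/-- The hypothesis expands to |y|² + 2 Re(y x̄) ≥ 0. -/
theorem half_le_one_add_re_div {x y : ℂ} (hy : y ≠ 0) (h : ‖x‖ ^ 2 ≤ ‖y + x‖ ^ 2) :
    1 / 2 ≤ (1 + x / y).re := by
  have hn : 0 < Complex.normSq y := Complex.normSq_pos.2 hy
  rw [Complex.sq_norm, Complex.sq_norm, Complex.normSq_add] at h
  have e : (x / y).re = (y * (starRingEnd ℂ) x).re / Complex.normSq y := by
    rw [Complex.div_re]; simp [Complex.mul_re]; ring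
  rw [Complex.add_re, Complex.one_re, e]
  have : -(1 / 2) ≤ (y * (starRingEnd ℂ) x).re / Complex.normSq y := by
    rw [le_div_iff₀ hn]; linarith
  linarith

/-- The region in which the saddle point approximation is considered. -/
structure SaddleRegion (z : ℂ) : Prop where
  one_le_re : 1 ≤ z.re
  im_pos : 0 < z.im
  im_le : z.im ≤ z.re

theorem SaddleRegion.norm_le {z : ℂ} (hz : SaddleRegion z) : ‖z‖ ≤ z.re + z.im := by
  have := Complex.norm_le_abs_re_add_abs_im z
  rwa [abs_of_pos (by linarith [hz.one_le_re]), abs_of_pos hz.im_pos] at this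

theorem re_saddle_mul_rot_pos (z : ℂ) (v : ℝ) :
    0 < ((-Complex.I * z + lineAt (lineShift z) v) * rot).re := by
  rw [← lineAt_saddle]
  exact re_lineAt_mul_rot_pos (by positivity) _

/-- Needed for Gaussian decay on the whole line, not only near the saddle. The sum of the moving
point and the saddle runs on a line through a real point of size at least (3/2)(Re z + Im z). Its
squared distance from 0 is at least (9/8)(Re z + Im z)² ≥ |z|². -/
theorem SaddleRegion.half_le {z : ℂ} (hz : SaddleRegion z) (v : ℝ) :
    1 / 2 ≤ (1 + -Complex.I * z / (-Complex.I * z + lineAt (lineShift z) v)).re := by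
  have hX := Complex.slitPlane_ne_zero (mem_slitPlane_of_re_mul_rot_pos (re_saddle_mul_rot_pos z v))
  refine half_le_one_add_re_div hX ?_
  have h1 := sq_re_sub_im_le (-Complex.I * z + lineAt (lineShift z) v + -Complex.I * z)
  have e : (-Complex.I * z + lineAt (lineShift z) v + -Complex.I * z).re -
      (-Complex.I * z + lineAt (lineShift z) v + -Complex.I * z).im
      = 2 * (z.re + z.im) + lineShift z := by
    simp only [Complex.add_re, Complex.add_im, neg_I_mul_re, neg_I_mul_im, lineAt_re, lineAt_im]
    ring
  rw [e] at h1
  have ha := hz.one_le_re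
  have hb := hz.im_pos
  have hd := (abs_le.1 (abs_lineShift_le (by linarith : 0 ≤ z.re + z.im))).1
  rw [norm_neg_I_mul]
  have h2 : ‖z‖ ^ 2 = z.re ^ 2 + z.im ^ 2 := by
    rw [Complex.sq_norm, Complex.normSq_apply]; ring
  rw [h2]
  have h3 : 3 / 2 * (z.re + z.im) ≤ 2 * (z.re + z.im) + lineShift z := by linarith
  have h4 : (3 / 2 * (z.re + z.im)) ^ 2 ≤ (2 * (z.re + z.im) + lineShift z) ^ 2 := by gcongr
  nlinarith [mul_pos (show 0 < z.re by linarith) hb, sq_nonneg z.re, sq_nonneg z.im]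

theorem SaddleRegion.norm_one_add_le {z : ℂ} (hz : SaddleRegion z) (v : ℝ) :
    ‖1 + -Complex.I * z / (-Complex.I * z + lineAt (lineShift z) v)‖ ≤ 4 := by
  have ha := hz.one_le_re
  have hb := hz.im_pos
  have hX : (z.re + z.im) / 3 ≤ ‖-Complex.I * z + lineAt (lineShift z) v‖ := by
    rw [← lineAt_saddle]
    have h1 := le_norm_lineAt (⌊z.re + z.im⌋₊ + 1 / 2) (v - z.re * √2)
    have h2 := Nat.lt_floor_add_one (z.re + z.im)
    linarith
  refine (norm_add_le _ _).trans ?_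
  rw [norm_one, norm_div, norm_neg_I_mul]
  have : ‖z‖ / ‖-Complex.I * z + lineAt (lineShift z) v‖ ≤ 3 := by
    rw [div_le_iff₀ (by linarith)]; linarith [hz.norm_le]
  linarith

/-- With x = -iz and X = x + y, the derivative -s/X + 2πiX factors as 2πi y (1 + x/X), because s =
2πi x². -/
theorem hasDerivAt_relPhase (z : ℂ) (v : ℝ) :
    HasDerivAt (relPhase z) (2 * Real.pi * Complex.I * rot * lineAt (lineShift z) v *
      (1 + -Complex.I * z / (-Complex.I * z + lineAt (lineShift z) v))) v := by
  have hs := mem_slitPlane_of_re_mul_rot_pos (re_saddle_mul_rot_pos z v)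
  have hX := Complex.slitPlane_ne_zero hs
  have hl := (hasDerivAt_lineAt (lineShift z) v).const_add (-Complex.I * z)
  have h := (((hl.clog_real hs).sub_const (Complex.log (-Complex.I * z))).const_mul (-sOf z)).add
    (((hl.pow 2).sub_const ((-Complex.I * z) ^ 2)).const_mul (Real.pi * Complex.I))
  refine h.congr_deriv ?_
  have hs : sOf z = 2 * Real.pi * Complex.I * (-Complex.I * z) ^ 2 := by
    rw [sOf]; linear_combination (-2 * Real.pi * Complex.I * z ^ 2) * Complex.I_sq
  rw [hs]
  generalize lineAt (lineShift z) v = y at hX ⊢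
  generalize -Complex.I * z = x at hX ⊢
  field_simp
  push_cast
  ring

/-- Split y into the shift d, with |d| ≤ 1/2, and tv · `rot`. The shift costs at most 4π|v|, while
the second part contributes -2πtv² Re(1 + x/X) ≤ -πtv². -/
theorem SaddleRegion.deriv_re_le {z : ℂ} (hz : SaddleRegion z) (v : ℝ) {t : ℝ} (ht : 0 ≤ t) :
    v * (2 * Real.pi * Complex.I * rot * lineAt (lineShift z) (t * v) *
      (1 + -Complex.I * z / (-Complex.I * z + lineAt (lineShift z) (t * v)))).re
      ≤ 4 * Real.pi * |v| - Real.pi * v ^ 2 * t := by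
  have h1 := hz.half_le (t * v)
  have h2 := hz.norm_one_add_le (t * v)
  set p := 1 + -Complex.I * z / (-Complex.I * z + lineAt (lineShift z) (t * v))
  have hd := abs_lineShift_le (z := z) (by linarith [hz.one_le_re, hz.im_pos])
  have e : 2 * Real.pi * Complex.I * rot * lineAt (lineShift z) (t * v) * p
      = ((2 * Real.pi * lineShift z : ℝ) : ℂ) * (Complex.I * rot * p)
        + ((-(2 * Real.pi * (t * v)) : ℝ) : ℂ) * p := by
    rw [lineAt]; push_cast
    linear_combination (2 * Real.pi * Complex.I * (t * v) * p) * rot_sq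
      + (2 * Real.pi * (t * v) * p) * Complex.I_sq
  rw [e, Complex.add_re, Complex.re_ofReal_mul, Complex.re_ofReal_mul]
  have h3 : |(Complex.I * rot * p).re| ≤ 4 := by
    refine (Complex.abs_re_le_norm _).trans ?_
    rw [norm_mul, norm_mul, Complex.norm_I, norm_rot, one_mul, one_mul]; exact h2
  have h4 : v * (2 * Real.pi * lineShift z * (Complex.I * rot * p).re) ≤ 4 * Real.pi * |v| := by
    refine (le_abs_self _).trans ?_
    rw [abs_mul, abs_mul, abs_mul, abs_mul, abs_of_pos Real.pi_pos, abs_two]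
    have : |lineShift z| * |(Complex.I * rot * p).re| ≤ 1 / 2 * 4 := by gcongr
    nlinarith [mul_nonneg (abs_nonneg v) Real.pi_pos.le]
  have h5 : 0 ≤ Real.pi * v ^ 2 * t := by positivity
  nlinarith

theorem norm_le_of_one_le_re {z : ℂ} (h : 1 ≤ z.re) : 1 ≤ ‖z‖ := h.trans (Complex.re_le_norm z)

/-- Integrate the derivative bound from 0 to v; at v = 0 the cubic estimate applies. -/
theorem SaddleRegion.re_relPhase_le {z : ℂ} (hz : SaddleRegion z) (v : ℝ) :
    (relPhase z v).re ≤ 7 + 4 * Real.pi * |v| - Real.pi * v ^ 2 / 2 := by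
  have hd := abs_lineShift_le (z := z) (by linarith [hz.one_le_re, hz.im_pos])
  have hn := norm_le_of_one_le_re hz.one_le_re
  have hl0 : ‖lineAt (lineShift z) 0‖ ≤ 1 / 2 := by simpa [lineAt] using hd
  have h0 : (relPhase z 0).re ≤ 7 := by
    refine (Complex.re_le_norm _).trans ?_
    have h1 := norm_relPhase_sub_le hz.im_pos (v := 0) (by linarith)
    have h2 := norm_sub_norm_le (relPhase z 0)
      (2 * Real.pi * Complex.I * lineAt (lineShift z) 0 ^ 2)
    rw [norm_mul, norm_mul, norm_mul, norm_pow, Complex.norm_I, Complex.norm_ofNat,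
      Complex.norm_real, Real.norm_eq_abs, abs_of_pos Real.pi_pos] at h2
    set l := ‖lineAt (lineShift z) 0‖
    have hl : 0 ≤ l := norm_nonneg _
    have h3 : 2 * Real.pi * l ^ 3 / ‖z‖ ≤ 2 * Real.pi * l ^ 3 := div_le_self (by positivity) hn
    have h4 : l ^ 3 ≤ (1 / 2) ^ 3 := by gcongr
    have h5 : l ^ 2 ≤ (1 / 2) ^ 2 := by gcongr
    nlinarith [Real.pi_pos, Real.pi_lt_d2]
  set g : ℝ → ℝ := fun t => (relPhase z (t * v)).re - 4 * Real.pi * |v| * t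
    + Real.pi * v ^ 2 / 2 * t ^ 2 with hg
  have hderiv : ∀ t, HasDerivAt g (v * (2 * Real.pi * Complex.I * rot *
      lineAt (lineShift z) (t * v) *
      (1 + -Complex.I * z / (-Complex.I * z + lineAt (lineShift z) (t * v)))).re
      - 4 * Real.pi * |v| + Real.pi * v ^ 2 * t) t := by
    intro t
    have h1 := (hasDerivAt_relPhase z (t * v)).scomp t ((hasDerivAt_id t).mul_const v)
    have h2 := (Complex.reCLM.hasFDerivAt.comp_hasDerivAt t h1)
    have h3 := (h2.sub ((hasDerivAt_id t).const_mul (4 * Real.pi * |v|))).add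
      (((hasDerivAt_id t).pow 2).const_mul (Real.pi * v ^ 2 / 2))
    refine h3.congr_deriv ?_
    simp only [one_mul, Complex.reCLM_apply, Complex.real_smul, Complex.re_ofReal_mul, id]
    push_cast; ring
  have hanti : AntitoneOn g (Set.Icc 0 1) := by
    refine antitoneOn_of_deriv_nonpos (convex_Icc 0 1)
      (fun t _ => (hderiv t).continuousAt.continuousWithinAt)
      (fun t _ => (hderiv t).differentiableAt.differentiableWithinAt) fun t ht => ?_
    rw [interior_Icc] at ht
    rw [(hderiv t).deriv]
    linarith [hz.deriv_re_le v ht.1.le]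
  have := hanti (Set.left_mem_Icc.2 zero_le_one) (Set.right_mem_Icc.2 zero_le_one) zero_le_one
  simp only [hg, zero_mul, one_mul, mul_zero, mul_one, one_pow, sub_zero, add_zero,
    ne_eq, OfNat.ofNat_ne_zero, not_false_eq_true, zero_pow] at this
  linarith

end Saddle

/-! ### Laplace's method at the saddle -/

section SaddleLimit

open MeasureTheory Topology

/-- The integrand on the saddle line divided by the main term. -/
noncomputable def saddleRatio (z : ℂ) (v : ℝ) : ℂ :=
  auxIntegrand (sOf z) (lineAt (⌊z.re + z.im⌋₊ + 1 / 2) (v - z.re * √2)) * rot /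
    Complex.exp (2 * Real.pi * Complex.I * phase z)

/-- The limit of the integrand at the saddle point. -/
noncomputable def saddleGauss (z : ℂ) (v : ℝ) : ℂ :=
  Complex.exp (2 * Real.pi * Complex.I * lineAt (lineShift z) v ^ 2
    - Real.pi * Complex.I * lineAt (lineShift z) v) * rot

theorem saddleRatio_eq {z : ℂ} (hz : SaddleRegion z) (v : ℝ) :
    saddleRatio z v = Complex.exp (relPhase z v - Real.pi * Complex.I * lineAt (lineShift z) v)
      * rot / (1 + Complex.exp (-(2 * Real.pi * Complex.I * rot * (v - z.re * √2 : ℝ)))) := by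
  have hX := Complex.slitPlane_ne_zero (mem_slitPlane_of_re_mul_rot_pos (re_saddle_mul_rot_pos z v))
  rw [saddleRatio, auxIntegrand_lineAt_half, lineAt_saddle, Complex.cpow_def_of_ne_zero hX,
    exp_two_pi_I_mul_phase (by linarith [hz.one_le_re]), ← Complex.exp_add, div_mul_eq_mul_div,
    div_div, mul_comm (1 + _), ← div_div, mul_div_right_comm, ← Complex.exp_sub]
  congr 3
  rw [relPhase]; ring

theorem norm_exp_neg_rot (u : ℝ) :
    ‖Complex.exp (-(2 * Real.pi * Complex.I * rot * u))‖ = Real.exp (√2 * Real.pi * u) := by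
  rw [Complex.norm_exp]
  congr 1
  have : -(2 * Real.pi * Complex.I * rot * u) = ((-(2 * Real.pi * u) : ℝ) : ℂ) * (Complex.I * rot) := by
    push_cast; ring
  rw [this, Complex.re_ofReal_mul, Complex.I_mul_re, rot_im]; ring

theorem norm_lineAt_shift_le {z : ℂ} (hz : SaddleRegion z) (v : ℝ) :
    ‖lineAt (lineShift z) v‖ ≤ 1 / 2 + |v| := by
  refine (norm_add_le _ _).trans ?_
  rw [norm_mul, norm_rot, mul_one, Complex.norm_real, Complex.norm_real, Real.norm_eq_abs,
    Real.norm_eq_abs]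
  have := abs_lineShift_le (z := z) (by linarith [hz.one_le_re, hz.im_pos])
  linarith

theorem re_neg_pi_I_mul_le (y : ℂ) : (-(Real.pi * Complex.I * y)).re ≤ Real.pi * ‖y‖ := by
  refine (Complex.re_le_norm _).trans ?_
  rw [norm_neg, norm_mul, norm_mul, Complex.norm_I, Complex.norm_real, Real.norm_eq_abs,
    abs_of_pos Real.pi_pos, mul_one]

theorem norm_saddleRatio_le {z : ℂ} (hz : SaddleRegion z) (v : ℝ) :
    ‖saddleRatio z v‖ ≤ 2 * Real.exp (80 - 1 / 2 * v ^ 2) := by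
  have hD := half_le_norm_one_add_exp (v - z.re * √2)
  rw [saddleRatio_eq hz, norm_div, norm_mul, norm_rot, mul_one, div_le_iff₀ (by linarith),
    Complex.norm_exp]
  have h1 := hz.re_relPhase_le v
  have h2 := re_neg_pi_I_mul_le (lineAt (lineShift z) v)
  have h3 : Real.pi * ‖lineAt (lineShift z) v‖ ≤ Real.pi * (1 / 2 + |v|) := by
    gcongr; exact norm_lineAt_shift_le hz v
  have h4 : (relPhase z v - Real.pi * Complex.I * lineAt (lineShift z) v).re
      ≤ 80 - 1 / 2 * v ^ 2 := by
    rw [sub_eq_add_neg, Complex.add_re, ← sq_abs v]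
    rw [← sq_abs v] at h1
    nlinarith [sq_nonneg (|v| - 8), abs_nonneg v, Real.pi_lt_d2, Real.pi_gt_three]
  have h5 := Real.exp_le_exp.2 h4
  have h6 := Real.exp_pos (80 - 1 / 2 * v ^ 2)
  nlinarith

theorem re_two_pi_lineAt_le {d v : ℝ} (hd : |d| ≤ 1 / 2) :
    (2 * Real.pi * Complex.I * lineAt d v ^ 2).re ≤ 80 - 1 / 2 * v ^ 2 - Real.pi * (1 / 2 + |v|) := by
  have e : 2 * Real.pi * Complex.I * lineAt d v ^ 2
      = ((2 : ℝ) : ℂ) * (Real.pi * Complex.I * lineAt d v ^ 2) := by push_cast; ring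
  rw [e, Complex.re_ofReal_mul, re_pi_mul_I_mul_lineAt]
  have h2 : √2 ≤ 1.5 := by rw [Real.sqrt_le_left (by norm_num)]; norm_num
  have h3 : -(d * v) ≤ 1 / 2 * |v| := by
    refine (neg_le_abs _).trans ?_
    rw [abs_mul]; gcongr
  have h4 : Real.pi * √2 ≤ 5 := by nlinarith [Real.pi_pos, Real.pi_lt_d2, Real.sqrt_nonneg 2]
  have h5 : Real.pi * √2 * -(d * v) ≤ Real.pi * √2 * (1 / 2 * |v|) := by gcongr
  have h6 : Real.pi * √2 * (1 / 2 * |v|) ≤ 5 * (1 / 2 * |v|) := by gcongr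
  rw [← sq_abs v]
  nlinarith [sq_nonneg (|v| - 8), abs_nonneg v, Real.pi_lt_d2, Real.pi_gt_three, sq_nonneg (|v|)]

theorem norm_saddleGauss_le {z : ℂ} (hz : SaddleRegion z) (v : ℝ) :
    ‖saddleGauss z v‖ ≤ Real.exp (80 - 1 / 2 * v ^ 2) := by
  rw [saddleGauss, norm_mul, norm_rot, mul_one, Complex.norm_exp]
  refine Real.exp_le_exp.2 ?_
  have hd := abs_lineShift_le (z := z) (by linarith [hz.one_le_re, hz.im_pos])
  have h1 := re_two_pi_lineAt_le (v := v) hd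
  have h2 := re_neg_pi_I_mul_le (lineAt (lineShift z) v)
  have h3 : Real.pi * ‖lineAt (lineShift z) v‖ ≤ Real.pi * (1 / 2 + |v|) := by
    gcongr; exact norm_lineAt_shift_le hz v
  rw [sub_eq_add_neg, Complex.add_re]
  linarith

theorem integrable_saddleBound : Integrable fun v : ℝ => 3 * Real.exp (80 - 1 / 2 * v ^ 2) := by
  have h := (integrable_exp_neg_mul_sq (show (0 : ℝ) < 1 / 2 by norm_num)).const_mul
    (3 * Real.exp 80)
  refine h.congr (Eventually.of_forall fun v => ?_)
  simp only [mul_assoc, ← Real.exp_add]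
  congr 2; ring

/-- The limit of the saddle point integral. -/
noncomputable def saddleConst : ℂ :=
  (2 : ℂ)⁻¹ ^ (1 / 2 : ℂ) * Complex.exp (-(Real.pi * Complex.I / 8)) * rot

/-- The exponent 2πi y² - πi y equals 2πi(y - 1/4)² - πi/8, so the shift d merely translates the
contour and drops out. -/
theorem integral_saddleGauss (z : ℂ) : ∫ v, saddleGauss z v = saddleConst := by
  have hpi : (Real.pi : ℂ) ≠ 0 := by exact_mod_cast Real.pi_ne_zero
  set d := lineShift z with hd
  have h := integral_cexp_quadratic (b := -(2 * Real.pi)) (by simp [Real.pi_pos])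
    ((4 * d - 1) * (Real.pi * Complex.I * rot))
    (2 * Real.pi * Complex.I * d ^ 2 - Real.pi * Complex.I * d)
  have e : ∀ v : ℝ, saddleGauss z v = Complex.exp (-(2 * Real.pi) * (v : ℂ) ^ 2 +
      (4 * d - 1) * (Real.pi * Complex.I * rot) * v +
      (2 * Real.pi * Complex.I * d ^ 2 - Real.pi * Complex.I * d)) * rot := by
    intro v
    rw [saddleGauss, ← hd, lineAt]
    congr 2
    linear_combination (2 * Real.pi * Complex.I * v ^ 2) * rot_sq
      + (2 * Real.pi * v ^ 2) * Complex.I_sq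
  simp_rw [e]
  rw [MeasureTheory.integral_mul_const, h, saddleConst]
  congr 2
  · congr 1
    field_simp
  · congr 1
    have : ((4 * (d : ℂ) - 1) * (Real.pi * Complex.I * rot)) ^ 2
        = -((4 * d - 1) ^ 2 * Real.pi ^ 2 * Complex.I) := by
      linear_combination ((4 * (d : ℂ) - 1) ^ 2 * Real.pi ^ 2 * rot ^ 2) * Complex.I_sq
        - ((4 * (d : ℂ) - 1) ^ 2 * Real.pi ^ 2) * rot_sq
    rw [this]
    field_simp
    ring

/-- The filter describing `z → ∞` in the saddle region. -/
noncomputable def saddleFilter : Filter ℂ := comap Complex.re atTop ⊓ 𝓟 {z | SaddleRegion z}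

/-- Dominated convergence along a filter requires countable generation. -/
instance : saddleFilter.IsCountablyGenerated := by unfold saddleFilter; infer_instance

theorem tendsto_re_saddleFilter : Tendsto Complex.re saddleFilter atTop :=
  tendsto_comap.mono_left inf_le_left

theorem eventually_saddleRegion : ∀ᶠ z in saddleFilter, SaddleRegion z :=
  mem_inf_of_right (mem_principal_self _)

/-- Only the difference has a limit: `lineShift z` keeps oscillating, so `saddleGauss z v` need not
converge pointwise, although its integral is constant. The denominator tends to 1 because Re z → ∞.
-/
theorem tendsto_saddleRatio_sub (v : ℝ) :
    Tendsto (fun z => saddleRatio z v - saddleGauss z v) saddleFilter (𝓝 0) := by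
  have hre := tendsto_re_saddleFilter
  have hE : Tendsto (fun z : ℂ => Complex.exp (-(2 * Real.pi * Complex.I * rot *
      (v - z.re * √2 : ℝ)))) saddleFilter (𝓝 0) := by
    rw [tendsto_zero_iff_norm_tendsto_zero]
    simp_rw [norm_exp_neg_rot]
    refine Real.tendsto_exp_atBot.comp ?_
    have h1 : Tendsto (fun z : ℂ => v - z.re * √2) saddleFilter atBot := by
      simp_rw [sub_eq_add_neg]
      exact tendsto_atBot_add_const_left _ _
        (tendsto_neg_atTop_atBot.comp (hre.atTop_mul_const (by positivity)))
    exact h1.const_mul_atBot (by positivity)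
  have hP : Tendsto (fun z => relPhase z v - 2 * Real.pi * Complex.I * lineAt (lineShift z) v ^ 2)
      saddleFilter (𝓝 0) := by
    have hb : ∀ᶠ z in saddleFilter, ‖relPhase z v -
        2 * Real.pi * Complex.I * lineAt (lineShift z) v ^ 2‖
        ≤ 2 * Real.pi * (1 / 2 + |v|) ^ 3 / z.re := by
      filter_upwards [eventually_saddleRegion, hre.eventually_ge_atTop (1 + 2 * |v|)] with z hz hz2
      have h1 := norm_lineAt_shift_le hz v
      have h2 := Complex.re_le_norm z
      have h3 := hz.one_le_re
      refine (norm_relPhase_sub_le hz.im_pos (by linarith)).trans ?_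
      gcongr
    refine squeeze_zero_norm' hb ?_
    exact hre.const_div_atTop _
  have hR : Tendsto (fun z => Complex.exp (relPhase z v -
      2 * Real.pi * Complex.I * lineAt (lineShift z) v ^ 2) /
      (1 + Complex.exp (-(2 * Real.pi * Complex.I * rot * (v - z.re * √2 : ℝ)))) - 1)
      saddleFilter (𝓝 0) := by
    have h1 := (Complex.continuous_exp.tendsto 0).comp hP
    have h2 := (h1.div (hE.const_add 1) (by simp)).sub_const 1
    simpa using h2
  have hprod : Tendsto (fun z => Real.exp (80 - 1 / 2 * v ^ 2) *
      ‖Complex.exp (relPhase z v -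
      2 * Real.pi * Complex.I * lineAt (lineShift z) v ^ 2) /
      (1 + Complex.exp (-(2 * Real.pi * Complex.I * rot * (v - z.re * √2 : ℝ)))) - 1‖)
      saddleFilter (𝓝 0) := by
    simpa using hR.norm.const_mul (Real.exp (80 - 1 / 2 * v ^ 2))
  refine squeeze_zero_norm' ?_ hprod
  filter_upwards [eventually_saddleRegion] with z hz
  have e : saddleRatio z v - saddleGauss z v = saddleGauss z v * (Complex.exp (relPhase z v -
      2 * Real.pi * Complex.I * lineAt (lineShift z) v ^ 2) /
      (1 + Complex.exp (-(2 * Real.pi * Complex.I * rot * (v - z.re * √2 : ℝ)))) - 1) := by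
    have : Complex.exp (relPhase z v - Real.pi * Complex.I * lineAt (lineShift z) v) * rot
        = saddleGauss z v * Complex.exp (relPhase z v -
      2 * Real.pi * Complex.I * lineAt (lineShift z) v ^ 2) := by
      rw [saddleGauss, mul_right_comm (Complex.exp _) rot, ← Complex.exp_add]; ring_nf
    rw [saddleRatio_eq hz, this]; ring
  rw [e, norm_mul]
  exact mul_le_mul_of_nonneg_right (norm_saddleGauss_le hz v) (norm_nonneg _)

theorem continuous_saddleRatio (z : ℂ) : Continuous (saddleRatio z) := by
  have h := (continuous_auxIntegrand_half (sOf z) ⌊z.re + z.im⌋₊).comp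
    (continuous_id.sub (continuous_const (y := z.re * √2)))
  exact (h.mul continuous_const).div_const _

theorem continuous_saddleGauss (z : ℂ) : Continuous (saddleGauss z) := by
  have := continuous_lineAt (lineShift z)
  unfold saddleGauss
  fun_prop

theorem tendsto_lineInt_div :
    Tendsto (fun z => lineInt (sOf z) (⌊z.re + z.im⌋₊ + 1 / 2) /
      Complex.exp (2 * Real.pi * Complex.I * phase z)) saddleFilter (𝓝 saddleConst) := by
  have h := tendsto_integral_filter_of_dominated_convergence (μ := volume)
    (F := fun z v => saddleRatio z v - saddleGauss z v) (f := fun _ => 0) (l := saddleFilter)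
    (fun v : ℝ => 3 * Real.exp (80 - 1 / 2 * v ^ 2))
    (Eventually.of_forall fun z =>
      ((continuous_saddleRatio z).sub (continuous_saddleGauss z)).aestronglyMeasurable)
    (by
      filter_upwards [eventually_saddleRegion] with z hz
      refine Eventually.of_forall fun v => (norm_sub_le _ _).trans ?_
      linarith [norm_saddleRatio_le hz v, norm_saddleGauss_le hz v])
    integrable_saddleBound (Eventually.of_forall tendsto_saddleRatio_sub)
  rw [integral_zero] at h
  have h' := h.add_const saddleConst
  rw [zero_add] at h'
  refine h'.congr' ?_
  filter_upwards [eventually_saddleRegion] with z hz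
  have i1 : Integrable (saddleRatio z) := by
    refine integrable_saddleBound.mono' (continuous_saddleRatio z).aestronglyMeasurable
      (Eventually.of_forall fun v => (norm_saddleRatio_le hz v).trans ?_)
    linarith [Real.exp_pos (80 - 1 / 2 * v ^ 2)]
  have i2 : Integrable (saddleGauss z) := by
    refine integrable_saddleBound.mono' (continuous_saddleGauss z).aestronglyMeasurable
      (Eventually.of_forall fun v => (norm_saddleGauss_le hz v).trans ?_)
    linarith [Real.exp_pos (80 - 1 / 2 * v ^ 2)]
  rw [integral_sub i1 i2, integral_saddleGauss, sub_add_cancel, lineInt]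
  simp_rw [saddleRatio]
  rw [MeasureTheory.integral_div, integral_sub_right_eq_self fun u =>
    auxIntegrand (sOf z) (lineAt (⌊z.re + z.im⌋₊ + 1 / 2) u) * rot]

end SaddleLimit

/-! ### Holomorphy and the asymptotic form -/

section AuxForm

open MeasureTheory Topology

theorem abs_exp_le_two_mul_bound {S : ℕ} (u : ℝ) :
    (|u| + 6) * (2 * Real.exp (S * (|u| + 6) - 3 * u ^ 2))
      ≤ 2 * Real.exp ((S + 2) ^ 2 + 6 * (S + 1)) * Real.exp (-|u|) := by
  have h1 : |u| + 6 ≤ Real.exp (|u| + 6) := by linarith [Real.add_one_le_exp (|u| + 6)]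
  calc (|u| + 6) * (2 * Real.exp (S * (|u| + 6) - 3 * u ^ 2))
      ≤ Real.exp (|u| + 6) * (2 * Real.exp (S * (|u| + 6) - 3 * u ^ 2)) := by gcongr
    _ = 2 * Real.exp (|u| + 6 + (S * (|u| + 6) - 3 * u ^ 2)) := by rw [Real.exp_add (|u| + 6)]; ring
    _ ≤ 2 * Real.exp ((S + 2) ^ 2 + 6 * (S + 1) + -|u|) := by
        have h2 : |u| + 6 + (S * (|u| + 6) - 3 * u ^ 2) ≤ (S + 2) ^ 2 + 6 * (S + 1) + -|u| := by
          rw [← sq_abs u]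
          nlinarith [sq_nonneg (|u| - (S + 2) / 2), sq_nonneg |u|, sq_nonneg ((S : ℝ) + 2)]
        have := Real.exp_le_exp.2 h2
        linarith
    _ = _ := by rw [Real.exp_add]; ring

theorem continuous_log_lineAt {c : ℝ} (hc : 0 < c) :
    Continuous fun u : ℝ => Complex.log (lineAt c u) :=
  (continuous_lineAt c).clog fun u => lineAt_mem_slitPlane hc u

theorem differentiable_riemannAux : Differentiable ℂ riemannAux := by
  intro s
  obtain ⟨S, hS⟩ := exists_nat_ge (‖s‖ + 1)
  have hb : ∀ u : ℝ, ∀ w ∈ Metric.ball s 1,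
      ‖-Complex.log (lineAt (1 / 2) u) * auxKernel w u‖
        ≤ 2 * Real.exp ((S + 2) ^ 2 + 6 * (S + 1)) * Real.exp (-|u|) := by
    intro u w hw
    have hwS : ‖w‖ ≤ S := by
      have h1 := norm_sub_norm_le w s
      rw [Metric.mem_ball, dist_eq_norm] at hw
      linarith
    refine le_trans ?_ (abs_exp_le_two_mul_bound u)
    rw [norm_mul, norm_neg]
    have h1 := norm_log_lineAt_le (le_refl (1 / 2 : ℝ)) u
    refine mul_le_mul (by linarith) ((norm_auxKernel_le w u).trans ?_) (norm_nonneg _)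
      (by positivity)
    gcongr
  have hc : Continuous fun u : ℝ => -Complex.log (lineAt (1 / 2) u) * auxKernel s u :=
    (continuous_log_lineAt (by norm_num)).neg.mul (continuous_auxKernel s)
  have hS' : ‖s‖ ≤ S := by linarith
  have hi := (norm_integral_sub_interval_le (continuous_auxKernel s)
    (norm_auxKernel_le_auxBound hS') le_rfl).1
  have hg : Integrable fun u : ℝ =>
      2 * Real.exp ((S + 2) ^ 2 + 6 * (S + 1)) * Real.exp (-|u|) := by
    refine Integrable.const_mul ?_ _
    have := (norm_integral_sub_interval_le (f := fun u => ((Real.exp (-|u|) : ℝ) : ℂ)) (L := 1)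
      (by fun_prop) (fun u => by
        rw [Complex.norm_real, Real.norm_eq_abs, abs_of_pos (Real.exp_pos _), one_mul])
      le_rfl).1.re
    exact this.congr (Eventually.of_forall fun u => Complex.ofReal_re _)
  have h := (hasDerivAt_integral_of_dominated_loc_of_deriv_le (μ := volume)
    (F := auxKernel) (x₀ := s) (Metric.ball_mem_nhds s one_pos)
    (Eventually.of_forall fun w => (continuous_auxKernel w).aestronglyMeasurable) hi
    (F' := fun w u => -Complex.log (lineAt (1 / 2) u) * auxKernel w u)
    hc.aestronglyMeasurable (Eventually.of_forall hb) hg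
    (Eventually.of_forall fun u w _ => by
      have h1 := ((((hasDerivAt_id w).neg.mul_const (Complex.log (lineAt (1 / 2) u))).sub_const
        (Real.pi * (u : ℂ) ^ 2)).cexp).div_const
          (1 + Complex.exp (-(2 * Real.pi * Complex.I * rot * u)))
      refine h1.congr_deriv ?_
      rw [auxKernel, Pi.neg_apply, id]
      ring)).2
  have h2 := h.differentiableAt.neg
  refine h2.congr_of_eventuallyEq (Eventually.of_forall fun w => ?_)
  rw [riemannAux_eq]; rfl

theorem sOf_re (z : ℂ) : (sOf z).re = 4 * Real.pi * (z.re * z.im) := by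
  have : sOf z = ((2 * Real.pi : ℝ) : ℂ) * (-Complex.I * z ^ 2) := by
    rw [sOf]; push_cast; ring
  rw [this, Complex.re_ofReal_mul]; simp [sq]; ring

theorem sOf_im (z : ℂ) : (sOf z).im = -2 * Real.pi * (z.re ^ 2 - z.im ^ 2) := by
  have : sOf z = ((2 * Real.pi : ℝ) : ℂ) * (-Complex.I * z ^ 2) := by
    rw [sOf]; push_cast; ring
  rw [this, Complex.im_ofReal_mul]; simp [sq]; ring

/-- For n ≥ 2, n^(-σ) ≤ 2^(2-σ) n^(-2); this is uniform in N, which varies with z. -/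
theorem norm_sum_cpow_sub_one_le {s : ℂ} (hs : 2 ≤ s.re) (N : ℕ) :
    ‖∑ n ∈ Finset.range (N + 1), ((n + 1 : ℕ) : ℂ) ^ (-s) - 1‖
      ≤ (2 : ℝ) ^ (2 - s.re) * ∑' n : ℕ, 1 / ((n + 2 : ℕ) : ℝ) ^ 2 := by
  have hsum : Summable fun n : ℕ => 1 / ((n + 2 : ℕ) : ℝ) ^ 2 :=
    (summable_nat_add_iff 2).2 (Real.summable_one_div_nat_pow.2 one_lt_two)
  rw [Finset.sum_range_succ']
  simp only [zero_add, Nat.cast_one, Complex.one_cpow, add_sub_cancel_right]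
  refine (norm_sum_le _ _).trans ?_
  calc _ ≤ ∑ n ∈ Finset.range N, (2 : ℝ) ^ (2 - s.re) * (1 / ((n + 2 : ℕ) : ℝ) ^ 2) := by
        refine Finset.sum_le_sum fun n _ => ?_
        have hn : (0 : ℝ) < ((n + 2 : ℕ) : ℝ) := by positivity
        rw [show n + 1 + 1 = n + 2 from rfl, ← Complex.ofReal_natCast,
          Complex.norm_cpow_eq_rpow_re_of_pos hn]
        have e : (-s).re = (2 - s.re) + -2 := by rw [Complex.neg_re]; ring
        rw [e, Real.rpow_add hn, Real.rpow_neg hn.le, Real.rpow_two, one_div]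
        gcongr ?_ * _
        exact Real.rpow_le_rpow_of_nonpos two_pos (by push_cast; linarith) (by linarith)
    _ = (2 : ℝ) ^ (2 - s.re) * ∑ n ∈ Finset.range N, (1 / ((n + 2 : ℕ) : ℝ) ^ 2) := by
        rw [Finset.mul_sum]
    _ ≤ _ := by
        gcongr
        exact hsum.sum_le_tsum _ fun n _ => by positivity

/-- The phase at which the main term is `1`. -/
noncomputable def phaseConst : ℂ :=
  -((Complex.log (2⁻¹) * 2⁻¹ + Real.pi * Complex.I / 8) / (2 * Real.pi * Complex.I))

theorem saddleConst_mul_exp : saddleConst * Complex.exp (2 * Real.pi * Complex.I * phaseConst) = 1 := by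
  have hp : (Real.pi : ℂ) ≠ 0 := Complex.ofReal_ne_zero.2 Real.pi_ne_zero
  rw [saddleConst, Complex.cpow_def_of_ne_zero (by norm_num), rot, ← Complex.exp_add,
    ← Complex.exp_add, ← Complex.exp_add, Complex.exp_eq_one_iff]
  refine ⟨0, ?_⟩
  rw [phaseConst]
  field_simp
  push_cast
  ring

theorem saddleConst_ne_zero : saddleConst ≠ 0 := fun h => by
  have := saddleConst_mul_exp
  rw [h, zero_mul] at this
  exact zero_ne_one this

/-- The filter along which both error terms are small. -/
noncomputable def formFilter : Filter ℂ := saddleFilter ⊓ comap (fun z => (sOf z).re) atTop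

/-- The exponent of the main term, normalised at the `n`-th zero. -/
noncomputable def mainExponent (n : ℕ) (z : ℂ) : ℂ :=
  2 * Real.pi * Complex.I * (phase z - n - phaseConst)

theorem tendsto_sum_cpow_sub_one :
    Tendsto (fun z => (∑ n ∈ Finset.range (⌊z.re + z.im⌋₊), ((n + 1 : ℕ) : ℂ) ^ (-sOf z)) - 1)
      formFilter (𝓝 0) := by
  have hre : Tendsto (fun z => (sOf z).re) formFilter atTop := tendsto_comap.mono_left inf_le_right
  have h0 : Tendsto (fun z => (2 : ℝ) ^ (2 - (sOf z).re) * ∑' n : ℕ, 1 / ((n + 2 : ℕ) : ℝ) ^ 2)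
      formFilter (𝓝 0) := by
    have h1 : Tendsto (fun z => Real.log 2 * (2 - (sOf z).re)) formFilter atBot :=
      (tendsto_atBot_add_const_left _ _ (tendsto_neg_atTop_atBot.comp hre)).const_mul_atBot
        (Real.log_pos one_lt_two)
    have h2 := (Real.tendsto_exp_atBot.comp h1).mul_const (∑' n : ℕ, 1 / ((n + 2 : ℕ) : ℝ) ^ 2)
    rw [zero_mul] at h2
    refine h2.congr fun z => ?_
    rw [Function.comp_apply, Real.rpow_def_of_pos two_pos]
  refine squeeze_zero_norm' ?_ h0
  filter_upwards [hre.eventually_ge_atTop 2,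
    (eventually_saddleRegion.filter_mono inf_le_left : ∀ᶠ z in formFilter, _)] with z hz hs
  have h1 : 1 ≤ ⌊z.re + z.im⌋₊ := Nat.one_le_floor_iff _ |>.2 (by linarith [hs.one_le_re, hs.im_pos])
  obtain ⟨N, hN⟩ := Nat.exists_eq_add_of_le' h1
  rw [hN]
  exact norm_sum_cpow_sub_one_le hz N

/-- R is 1 + o(1) - E(1 + o(1)) with E = exp(`mainExponent n z`). The restriction on the phase keeps
|E| ≤ e^{2π}, so the relative error is an absolute one; the integer n is free since e^{2πin} = 1. -/
theorem eventually_riemannAux_form {ε : ℝ} (hε : 0 < ε) :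
    ∀ᶠ z in formFilter, ∀ n : ℕ, ‖phase z - n - phaseConst‖ ≤ 1 →
      ‖riemannAux (sOf z) - (1 - Complex.exp (mainExponent n z))‖ ≤ ε := by
  have h1 := tendsto_sum_cpow_sub_one
  have h2 := ((tendsto_lineInt_div.mono_left inf_le_left : Tendsto _ formFilter _).div_const
    saddleConst).sub_const 1
  rw [div_self saddleConst_ne_zero, sub_self] at h2
  have hε2 : 0 < ε / 2 := by positivity
  have hε3 : 0 < ε / 2 / Real.exp (2 * Real.pi) := by positivity
  filter_upwards [(Metric.tendsto_nhds.1 h1) _ hε2, (Metric.tendsto_nhds.1 h2) _ hε3] with z a b n hn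
  rw [dist_zero_right] at a b
  set E := Complex.exp (mainExponent n z) with hE
  have e1 : Complex.exp (2 * Real.pi * Complex.I * phase z) = saddleConst⁻¹ * E := by
    rw [eq_inv_mul_iff_mul_eq₀ saddleConst_ne_zero, hE, mainExponent]
    have : 2 * Real.pi * Complex.I * phase z = 2 * Real.pi * Complex.I * (phase z - n - phaseConst)
      + n * (2 * Real.pi * Complex.I) + 2 * Real.pi * Complex.I * phaseConst := by ring
    rw [this, Complex.exp_add, Complex.exp_add, Complex.exp_nat_mul_two_pi_mul_I]
    linear_combination Complex.exp (2 * Real.pi * Complex.I * (phase z - n - phaseConst)) *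
      saddleConst_mul_exp
  have hE0 : E ≠ 0 := Complex.exp_ne_zero _
  have e2 : lineInt (sOf z) (⌊z.re + z.im⌋₊ + 1 / 2) = E * (lineInt (sOf z) (⌊z.re + z.im⌋₊ + 1 / 2) /
      Complex.exp (2 * Real.pi * Complex.I * phase z) / saddleConst) := by
    rw [e1]; field_simp [saddleConst_ne_zero]
  have hEn : ‖E‖ ≤ Real.exp (2 * Real.pi) := by
    rw [hE, Complex.norm_exp]
    refine Real.exp_le_exp.2 ((Complex.re_le_norm _).trans ?_)
    rw [mainExponent, norm_mul, norm_mul, norm_mul, Complex.norm_I, Complex.norm_ofNat,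
      Complex.norm_real, Real.norm_eq_abs, abs_of_pos Real.pi_pos]
    nlinarith [Real.pi_pos]
  rw [riemannAux_eq_sum_sub_lineInt (sOf z) ⌊z.re + z.im⌋₊]
  set X := lineInt (sOf z) (⌊z.re + z.im⌋₊ + 1 / 2) /
      Complex.exp (2 * Real.pi * Complex.I * phase z) / saddleConst with hX
  rw [e2]
  calc _ = ‖((∑ n ∈ Finset.range (⌊z.re + z.im⌋₊), ((n + 1 : ℕ) : ℂ) ^ (-sOf z)) - 1)
        - E * (X - 1)‖ := by congr 1; ring
    _ ≤ _ := norm_sub_le _ _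
    _ ≤ ε / 2 + Real.exp (2 * Real.pi) * (ε / 2 / Real.exp (2 * Real.pi)) := by
        rw [norm_mul]; gcongr
    _ = ε := by field_simp; ring

theorem compC_phaseConst {α : Type*} [Primcodable α] : CompC fun _ : α => phaseConst := by
  have h2 : CompC fun _ : α => (2⁻¹ : ℂ) :=
    (CompC.const_ofNat 2).inv fun _ => two_ne_zero
  have h8 : CompC fun _ : α => (8 : ℂ) := CompC.const_ofNat 8
  have hpI : CompC fun _ : α => (Real.pi * Complex.I : ℂ) := compC_pi.mul CompC.const_I
  have hd : CompC fun _ : α => (2 * Real.pi * Complex.I : ℂ) :=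
    ((CompC.const_ofNat 2).mul compC_pi).mul CompC.const_I
  exact ((((h2.log fun _ => by norm_num).mul h2).add (hpI.div h8 fun _ => by norm_num)).div hd
    fun _ => Complex.two_pi_I_ne_zero).neg

end AuxForm

/-! ### The phase function -/

section Phase

open Topology

/-- The derivative of the phase. -/
noncomputable def derivPhase (z : ℂ) : ℂ :=
  2 * z * Complex.log z - Real.pi * Complex.I * z + Complex.I / 2

theorem hasDerivAt_phase {z : ℂ} (hz : 0 < z.re) : HasDerivAt phase (derivPhase z) z := by
  have hs : z ∈ Complex.slitPlane := Or.inl hz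
  have hz0 := Complex.slitPlane_ne_zero hs
  have h1 := ((hasDerivAt_id z).pow 2).mul
    (((Complex.hasDerivAt_log hs).sub_const (1 / 2)).sub_const (Complex.I * Real.pi / 2))
  have h2 := h1.add ((hasDerivAt_id z).const_mul (Complex.I / 2))
  refine h2.congr_deriv ?_
  rw [derivPhase]
  simp only [id, Nat.cast_ofNat, Pi.pow_apply]
  field_simp
  ring

/-- The real part is 2 Re z log|z| - Im z (2 arg z - π). The last term is at most 4πt, and 4π < 13 ≤
log t leaves t log t. -/
theorem le_re_derivPhase {z : ℂ} {t : ℝ} (h1 : t ≤ z.re) (h2 : ‖z‖ ≤ 2 * t) (ht : 0 < t)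
    (hl : 13 ≤ Real.log t) : t * Real.log t ≤ (derivPhase z).re := by
  have hre : 0 < z.re := by linarith
  have harg := abs_le.1 (Complex.abs_arg_lt_pi_div_two_iff.2 (Or.inl hre)).le
  have hlog : Real.log t ≤ Real.log ‖z‖ := Real.log_le_log ht (h1.trans (Complex.re_le_norm z))
  have him := abs_le.1 ((Complex.abs_im_le_norm z).trans h2)
  have e : (derivPhase z).re = 2 * (z.re * Real.log ‖z‖ - z.im * z.arg) + Real.pi * z.im := by
    simp [derivPhase, Complex.log_re, Complex.log_im]; ring
  rw [e]
  have h3 : t * Real.log t ≤ z.re * Real.log ‖z‖ := by gcongr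
  have h4 : z.im * (2 * z.arg - Real.pi) ≤ 2 * t * (2 * Real.pi) := by
    have a1 : |z.im * (2 * z.arg - Real.pi)| ≤ 2 * t * (2 * Real.pi) := by
      rw [abs_mul]
      gcongr
      · exact abs_le.2 him
      · rw [abs_le]; constructor <;> linarith [Real.pi_pos]
    exact (le_abs_self _).trans a1
  nlinarith [Real.pi_lt_d2]

theorem norm_log_le {z : ℂ} (h : 1 ≤ ‖z‖) (hre : 0 < z.re) :
    ‖Complex.log z‖ ≤ Real.log ‖z‖ + Real.pi / 2 := by
  refine (Complex.norm_le_abs_re_add_abs_im _).trans ?_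
  rw [Complex.log_re, Complex.log_im, abs_of_nonneg (Real.log_nonneg h)]
  gcongr
  exact (Complex.abs_arg_lt_pi_div_two_iff.2 (Or.inl hre)).le

theorem norm_pi_mul_I : ‖(Real.pi * Complex.I : ℂ)‖ = Real.pi := by
  rw [norm_mul, Complex.norm_I, Complex.norm_real, Real.norm_eq_abs, abs_of_pos Real.pi_pos,
    mul_one]

theorem norm_derivPhase_le {z : ℂ} {t : ℝ} (h1 : t ≤ z.re) (h2 : ‖z‖ ≤ 2 * t) (ht : 0 < t)
    (hl : 13 ≤ Real.log t) : ‖derivPhase z‖ ≤ 6 * (t * Real.log t) := by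
  have hre : 0 < z.re := by linarith
  have ht1 : 1 < t := by
    rw [← Real.log_pos_iff ht.le]; linarith
  have hz1 : t ≤ ‖z‖ := h1.trans (Complex.re_le_norm z)
  have hz0 : 0 < ‖z‖ := by linarith
  have hlz : Real.log ‖z‖ ≤ Real.log t + 1 := by
    have := Real.log_le_log hz0 h2
    rw [Real.log_mul two_ne_zero ht.ne'] at this
    linarith [Real.log_two_lt_d9]
  have hlog := norm_log_le (by linarith) hre
  have hhalf : ‖Complex.I / 2‖ = 1 / 2 := by simp
  have h3 : ‖derivPhase z‖ ≤ 2 * ‖z‖ * ‖Complex.log z‖ + Real.pi * ‖z‖ + 1 / 2 := by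
    refine (norm_add_le _ _).trans ?_
    rw [hhalf]
    gcongr
    refine (norm_sub_le _ _).trans ?_
    rw [norm_mul, norm_mul, norm_mul _ z, norm_pi_mul_I, Complex.norm_ofNat]
  have h4 : ‖z‖ * ‖Complex.log z‖ ≤ 2 * t * (Real.log t + 1 + Real.pi / 2) := by
    gcongr; linarith
  have h5 : Real.pi * ‖z‖ ≤ Real.pi * (2 * t) := by gcongr
  nlinarith [Real.pi_lt_d2]

/-- Quantitative Noshiro–Warschawski: the real part of conj(z - w) f grows at rate at least c|z -
w|² along the segment from w to z. -/
theorem mul_norm_sub_le_of_le_re {s : Set ℂ} (hs : Convex ℝ s) {f f' : ℂ → ℂ}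
    (hf : ∀ z ∈ s, HasDerivAt f (f' z) z) {c : ℝ} (hc : ∀ z ∈ s, c ≤ (f' z).re) {z w : ℂ}
    (hz : z ∈ s) (hw : w ∈ s) : c * ‖z - w‖ ≤ ‖f z - f w‖ := by
  rcases eq_or_ne z w with rfl | hne
  · simp
  have hpos : 0 < ‖z - w‖ := norm_pos_iff.2 (sub_ne_zero.2 hne)
  set g : ℝ → ℝ := fun t =>
    ((starRingEnd ℂ) (z - w) * f (w + t * (z - w))).re - c * ‖z - w‖ ^ 2 * t with hg
  have hmem : ∀ t ∈ Set.Icc (0 : ℝ) 1, w + t * (z - w) ∈ s := fun t ht => by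
    have := hs.add_smul_sub_mem hw hz ht
    rwa [Complex.real_smul] at this
  have hd : ∀ t ∈ Set.Icc (0 : ℝ) 1, HasDerivAt g
      (‖z - w‖ ^ 2 * (f' (w + t * (z - w))).re - c * ‖z - w‖ ^ 2) t := by
    intro t ht
    have hl : HasDerivAt (fun t : ℝ => w + (t : ℂ) * (z - w)) (z - w) t := by
      simpa using ((Complex.ofRealCLM.hasDerivAt (x := t)).mul_const (z - w)).const_add w
    have h1 := ((hf _ (hmem t ht)).comp t hl).const_mul ((starRingEnd ℂ) (z - w))
    have h2 := (Complex.reCLM.hasFDerivAt.comp_hasDerivAt t h1).sub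
      ((hasDerivAt_id t).const_mul (c * ‖z - w‖ ^ 2))
    refine h2.congr_deriv ?_
    have e : (starRingEnd ℂ) (z - w) * (f' (w + t * (z - w)) * (z - w))
        = ((‖z - w‖ ^ 2 : ℝ) : ℂ) * f' (w + t * (z - w)) := by
      rw [Complex.sq_norm, Complex.normSq_eq_conj_mul_self]; ring
    rw [e, Complex.reCLM_apply, Complex.re_ofReal_mul, mul_one]
  have hmono : MonotoneOn g (Set.Icc 0 1) := by
    refine monotoneOn_of_deriv_nonneg (convex_Icc 0 1)
      (fun t ht => (hd t ht).continuousAt.continuousWithinAt)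
      (fun t ht => (hd t (interior_subset ht)).differentiableAt.differentiableWithinAt)
      fun t ht => ?_
    have ht' := interior_subset ht
    rw [(hd t ht').deriv]
    nlinarith [hc _ (hmem t ht'), sq_nonneg ‖z - w‖]
  have h := hmono (Set.left_mem_Icc.2 zero_le_one) (Set.right_mem_Icc.2 zero_le_one) zero_le_one
  simp only [hg, Complex.ofReal_zero, zero_mul, add_zero, mul_zero, sub_zero, Complex.ofReal_one,
    one_mul, add_sub_cancel, mul_one] at h
  have h2 : ((starRingEnd ℂ) (z - w) * (f z - f w)).re ≤ ‖z - w‖ * ‖f z - f w‖ := by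
    refine (Complex.re_le_norm _).trans ?_
    rw [norm_mul, Complex.norm_conj]
  rw [mul_sub, Complex.sub_re] at h2
  have h3 : ‖z - w‖ * (c * ‖z - w‖) ≤ ‖z - w‖ * ‖f z - f w‖ := by nlinarith
  exact le_of_mul_le_mul_left h3 hpos

/-- On the bounding circle |f z - f z₀| ≥ cr; the quantitative open mapping theorem then gives a
ball of half that radius in the image. -/
theorem ball_subset_image_of_le_re {f f' : ℂ → ℂ} {z₀ : ℂ} {r c : ℝ}
    (hf : ∀ z ∈ Metric.closedBall z₀ r, HasDerivAt f (f' z) z) (hr : 0 < r) (hc0 : 0 < c)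
    (hc : ∀ z ∈ Metric.closedBall z₀ r, c ≤ (f' z).re) :
    Metric.ball (f z₀) (c * r / 2) ⊆ f '' Metric.closedBall z₀ r := by
  have hlow : ∀ z ∈ Metric.closedBall z₀ r, c * ‖z - z₀‖ ≤ ‖f z - f z₀‖ := fun z hz =>
    mul_norm_sub_le_of_le_re (convex_closedBall z₀ r) hf hc hz (Metric.mem_closedBall_self hr.le)
  have hdc : DiffContOnCl ℂ f (Metric.ball z₀ r) :=
    DifferentiableOn.diffContOnCl_ball (U := Metric.closedBall z₀ r)
      (fun z hz => (hf z hz).differentiableAt.differentiableWithinAt) subset_rfl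
  refine hdc.ball_subset_image_closedBall hr (fun z hz => ?_) ?_
  · have := hlow z (Metric.sphere_subset_closedBall hz)
    rwa [mem_sphere_iff_norm.1 hz] at this
  · have h1 : ∃ᶠ z in 𝓝 z₀, z ≠ z₀ :=
      (eventually_mem_nhdsWithin (s := {z₀}ᶜ)).frequently.filter_mono nhdsWithin_le_nhds
    refine (h1.and_eventually (Metric.closedBall_mem_nhds z₀ hr)).mono fun z hz h => ?_
    have h2 := hlow z hz.2
    rw [h, sub_self, norm_zero] at h2
    have : 0 < ‖z - z₀‖ := norm_pos_iff.2 (sub_ne_zero.2 hz.1)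
    nlinarith

/-- The sector around the positive real axis in which the saddle points are located. -/
def sector (A : ℝ) : Set ℂ := {z | A < z.re ∧ |z.im| < z.re}

theorem convex_sector (A : ℝ) : Convex ℝ (sector A) := by
  intro z hz w hw a b ha hb hab
  obtain ⟨h1, h2⟩ := hz
  obtain ⟨h3, h4⟩ := hw
  rw [abs_lt] at h2 h4
  refine ⟨?_, ?_⟩
  · simp only [Complex.add_re, Complex.real_smul, Complex.re_ofReal_mul]
    rcases ha.eq_or_lt with rfl | ha'
    · have : b = 1 := by linarith
      subst this; linarith
    · nlinarith
  · simp only [Complex.add_re, Complex.add_im, Complex.real_smul, Complex.re_ofReal_mul,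
      Complex.im_ofReal_mul]
    rw [abs_lt]
    rcases ha.eq_or_lt with rfl | ha'
    · have : b = 1 := by linarith
      subst this; constructor <;> linarith
    · constructor <;> nlinarith

theorem norm_le_of_mem_sector {A : ℝ} {z : ℂ} (hz : z ∈ sector A) : ‖z‖ ≤ 3 / 2 * z.re := by
  have h := hz.2
  have h0 : 0 < z.re := (abs_nonneg _).trans_lt h
  refine abs_le_of_sq_le_sq' ?_ (by positivity) |>.2
  rw [Complex.sq_norm, Complex.normSq_apply]
  nlinarith [abs_lt.1 h]

theorem mul_log_le_re_derivPhase {A : ℝ} {z : ℂ} (hz : z ∈ sector A) (h : 13 ≤ Real.log z.re) :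
    z.re * Real.log z.re ≤ (derivPhase z).re := by
  have h0 : 0 < z.re := (abs_nonneg _).trans_lt hz.2
  exact le_re_derivPhase le_rfl (by linarith [norm_le_of_mem_sector hz]) h0 h

theorem norm_sub_le_norm_phase_sub {A : ℝ} (hA0 : 1 ≤ A) (hA : 13 ≤ Real.log A) {z w : ℂ}
    (hz : z ∈ sector A) (hw : w ∈ sector A) : ‖z - w‖ ≤ ‖phase z - phase w‖ := by
  have h := mul_norm_sub_le_of_le_re (convex_sector A) (f := phase) (f' := derivPhase) (c := 1)
    (fun x hx => hasDerivAt_phase (by linarith [hx.1])) (fun x hx => ?_) hz hw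
  · rwa [one_mul] at h
  · have h1 : Real.log A ≤ Real.log x.re := Real.log_le_log (by linarith) hx.1.le
    have h2 := mul_log_le_re_derivPhase hx (hA.trans h1)
    nlinarith [hx.1]

theorem exists_sq_mul_log_eq (X : ℝ) (hX : 1 ≤ X) : ∃ N : ℕ, ∀ n : ℕ, N ≤ n →
    ∃ a : ℝ, X ≤ a ∧ a ^ 2 * Real.log a = n := by
  obtain ⟨N, hN⟩ := exists_nat_ge (X ^ 2 * Real.log X)
  refine ⟨N, fun n hn => ?_⟩
  have hn' : X ^ 2 * Real.log X ≤ n := hN.trans (by exact_mod_cast hn)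
  have ht : Tendsto (fun a : ℝ => a ^ 2 * Real.log a) atTop atTop :=
    (tendsto_pow_atTop two_ne_zero).atTop_mul_atTop₀ Real.tendsto_log_atTop
  obtain ⟨b, hb, hXb⟩ := ((ht.eventually_ge_atTop (n : ℝ)).and (eventually_ge_atTop X)).exists
  have hc : ContinuousOn (fun a : ℝ => a ^ 2 * Real.log a) (Set.Icc X b) := by
    refine (continuous_pow 2).continuousOn.mul (Real.continuousOn_log.mono fun x hx => ?_)
    have : 0 < x := by linarith [hx.1]
    exact this.ne'
  obtain ⟨a, ha, h⟩ := intermediate_value_Icc hXb hc ⟨hn', hb⟩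
  exact ⟨a, ha.1, h⟩

/-- Start from the real a with a² log a = n. There the phase misses the target by about (1 +
πi)a²/2, and the derivative, of size a log a, allows a correction within a distance O(a / log a). -/
theorem exists_phase_eq (A : ℝ) : ∃ N : ℕ, ∀ n : ℕ, N ≤ n →
    ∃ w ∈ sector A, |w.im| ≤ w.re / 2 ∧ phase w = n + phaseConst := by
  set X : ℝ := Real.exp 32 + 2 * |A| + ‖phaseConst‖ with hX
  have hE : 32 ≤ Real.exp 32 := by linarith [Real.add_one_le_exp 32]
  obtain ⟨N, hN⟩ := exists_sq_mul_log_eq X (by linarith [abs_nonneg A, norm_nonneg phaseConst])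
  refine ⟨N, fun n hn => ?_⟩
  obtain ⟨a, haX, ha⟩ := hN n hn
  have hAa := abs_nonneg A
  have hAle := le_abs_self A
  have hk := norm_nonneg phaseConst
  have ha0 : 32 ≤ a := by linarith
  have hapos : 0 < a := by linarith
  have hL : 32 ≤ Real.log a := by
    rw [Real.le_log_iff_exp_le hapos]; linarith
  set L := Real.log a with hLdef
  have hLpos : 0 < L := by linarith
  -- With derivative at least (5/8)aL, this radius makes the image cover a ball of radius 5a²/2,
  -- more than the defect (1 + π)a²/2 + a/2 + |`phaseConst`|. The bound L ≥ 32 gives r ≤ a/4.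
  set r := 8 * a / L with hr
  have hrpos : 0 < r := by positivity
  have hr4 : r ≤ a / 4 := by
    rw [hr, div_le_iff₀ hLpos]; nlinarith
  have hball : ∀ z ∈ Metric.closedBall (a : ℂ) r, 3 / 4 * a ≤ z.re ∧ ‖z‖ ≤ 5 / 4 * a ∧
      |z.im| ≤ a / 4 := by
    intro z hz
    rw [Metric.mem_closedBall, dist_eq_norm] at hz
    have h1 := (abs_le.1 ((Complex.abs_re_le_norm (z - a)).trans (hz.trans hr4))).1
    have h2 := (Complex.abs_im_le_norm (z - a)).trans (hz.trans hr4)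
    have h3 := norm_sub_norm_le z (a : ℂ)
    rw [Complex.norm_real, Real.norm_eq_abs, abs_of_pos hapos] at h3
    simp only [Complex.sub_re, Complex.ofReal_re, Complex.sub_im, Complex.ofReal_im,
      sub_zero] at h1 h2
    exact ⟨by linarith, by linarith, h2⟩
  have ht : 0 < 3 / 4 * a := by positivity
  have hlt : L - 1 / 3 ≤ Real.log (3 / 4 * a) := by
    rw [Real.log_mul (by norm_num) hapos.ne']
    have := Real.log_le_sub_one_of_pos (show (0 : ℝ) < 4 / 3 by norm_num)
    rw [show (4 / 3 : ℝ) = (3 / 4)⁻¹ by norm_num, Real.log_inv] at this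
    norm_num at this
    linarith
  have hd : ∀ z ∈ Metric.closedBall (a : ℂ) r, HasDerivAt phase (derivPhase z) z := fun z hz =>
    hasDerivAt_phase (by linarith [(hball z hz).1])
  have hm : ∀ z ∈ Metric.closedBall (a : ℂ) r, 5 / 8 * (a * L) ≤ (derivPhase z).re := by
    intro z hz
    obtain ⟨h1, h2, -⟩ := hball z hz
    have := le_re_derivPhase h1 (by linarith) ht (by linarith)
    nlinarith
  have hsub := ball_subset_image_of_le_re hd hrpos (by positivity) hm
  have hval : (n : ℂ) + phaseConst ∈ Metric.ball (phase a) (5 / 8 * (a * L) * r / 2) := by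
    have hrad : 5 / 8 * (a * L) * r / 2 = 5 * a ^ 2 / 2 := by rw [hr]; field_simp
    rw [mem_ball_iff_norm', hrad]
    have hna : (n : ℂ) = (a : ℂ) ^ 2 * (L : ℂ) := by
      rw [← Complex.ofReal_natCast, ← ha]; push_cast; rfl
    have e : phase a - ((n : ℂ) + phaseConst) = -(((a ^ 2 / 2 : ℝ) : ℂ))
        - ((a ^ 2 / 2 : ℝ) : ℂ) * (Real.pi * Complex.I) + ((a / 2 : ℝ) : ℂ) * Complex.I
        - phaseConst := by
      rw [hna, phase, ← Complex.ofReal_log hapos.le]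
      push_cast; ring
    rw [e]
    calc _ ≤ a ^ 2 / 2 + a ^ 2 / 2 * Real.pi + a / 2 + ‖phaseConst‖ := by
          refine (norm_sub_le _ _).trans (add_le_add ((norm_add_le _ _).trans (add_le_add
            ((norm_sub_le _ _).trans (add_le_add ?_ ?_)) ?_)) le_rfl)
          · rw [norm_neg, Complex.norm_real, Real.norm_eq_abs, abs_of_pos (by positivity)]
          · rw [norm_mul, norm_pi_mul_I, Complex.norm_real, Real.norm_eq_abs,
              abs_of_pos (by positivity)]
          · rw [norm_mul, Complex.norm_I, Complex.norm_real, Real.norm_eq_abs,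
              abs_of_pos (by positivity), mul_one]
      _ < _ := by nlinarith [Real.pi_lt_d2]
  obtain ⟨w, hw, hwe⟩ := hsub hval
  obtain ⟨h1, -, h3⟩ := hball w hw
  exact ⟨w, ⟨by linarith, by linarith⟩, by linarith, hwe⟩

end Phase

/-! ### Asymptotics of points with prescribed phase -/

section PhaseAsymptotics

open Topology

/-- The filter of pairs `(n, z)` with `n → ∞` and `z` a point with phase close to `n`. -/
noncomputable def phaseFilter (A K : ℝ) : Filter (ℕ × ℂ) :=
  comap Prod.fst atTop ⊓ 𝓟 {p | p.2 ∈ sector A ∧ ‖phase p.2 - p.1 - phaseConst‖ ≤ K}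

variable {A K : ℝ}

theorem tendsto_fst_phaseFilter : Tendsto Prod.fst (phaseFilter A K) atTop :=
  tendsto_comap.mono_left inf_le_left

theorem tendsto_fst_cast_phaseFilter :
    Tendsto (fun p : ℕ × ℂ => (p.1 : ℝ)) (phaseFilter A K) atTop :=
  tendsto_natCast_atTop_atTop.comp tendsto_fst_phaseFilter

theorem eventually_mem_phaseFilter : ∀ᶠ p in phaseFilter A K,
    p.2 ∈ sector A ∧ ‖phase p.2 - p.1 - phaseConst‖ ≤ K :=
  (eventually_principal.2 fun _ h => h).filter_mono inf_le_right

theorem re_pos_of_mem_sector {z : ℂ} (hz : z ∈ sector A) : 0 < z.re := (abs_nonneg _).trans_lt hz.2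

theorem norm_phase_le {z : ℂ} (hz : 1 ≤ ‖z‖) (hre : 0 < z.re) :
    ‖phase z‖ ≤ ‖z‖ ^ 2 * (‖z‖ + 4) + ‖z‖ := by
  have h1 := norm_log_le hz hre
  have h2 := Real.log_le_sub_one_of_pos (show 0 < ‖z‖ by linarith)
  have h3 : ‖Complex.I / 2 * z‖ ≤ ‖z‖ := by
    rw [norm_mul]; simp; linarith
  have h4 : ‖Complex.I * Real.pi / 2‖ = Real.pi / 2 := by
    rw [norm_div, mul_comm, norm_pi_mul_I, Complex.norm_ofNat]
  have h5 : ‖Complex.log z - 1 / 2 - Complex.I * Real.pi / 2‖ ≤ ‖z‖ + 4 := by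
    refine (norm_sub_le _ _).trans ?_
    rw [h4]
    have := norm_sub_le (Complex.log z) (1 / 2)
    have h6 : ‖(1 / 2 : ℂ)‖ = 1 / 2 := by simp
    rw [h6] at this
    linarith [Real.pi_lt_d2]
  refine (norm_add_le _ _).trans (add_le_add ?_ h3)
  rw [norm_mul, norm_pow]
  gcongr

/-- The phase is bounded on bounded parts of the sector, so n → ∞ forces |z| → ∞. -/
theorem tendsto_norm_phaseFilter (hA : 1 ≤ A) :
    Tendsto (fun p : ℕ × ℂ => ‖p.2‖) (phaseFilter A K) atTop := by
  refine tendsto_atTop.2 fun M => ?_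
  set B := max M 1 with hB
  filter_upwards [eventually_mem_phaseFilter, tendsto_fst_cast_phaseFilter.eventually_gt_atTop
    (B ^ 2 * (B + 4) + B + K + ‖phaseConst‖)] with p hp hn
  by_contra! hlt
  have hz1 : 1 ≤ ‖p.2‖ := by linarith [hp.1.1, Complex.re_le_norm p.2]
  have h1 := norm_phase_le hz1 (re_pos_of_mem_sector hp.1)
  have h2 : ‖(p.1 : ℂ)‖ ≤ ‖phase p.2‖ + K + ‖phaseConst‖ := by
    have e : (p.1 : ℂ) = phase p.2 - (phase p.2 - p.1 - phaseConst) - phaseConst := by ring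
    rw [e]
    exact (norm_sub_le _ _).trans (by gcongr; exact (norm_sub_le _ _).trans (by gcongr; exact hp.2))
  rw [Complex.norm_natCast] at h2
  have hzB : ‖p.2‖ ≤ B := hlt.le.trans (le_max_left _ _)
  have h3 : ‖p.2‖ ^ 2 * (‖p.2‖ + 4) + ‖p.2‖ ≤ B ^ 2 * (B + 4) + B := by gcongr
  linarith

theorem tendsto_re_phaseFilter (hA : 1 ≤ A) :
    Tendsto (fun p : ℕ × ℂ => p.2.re) (phaseFilter A K) atTop := by
  refine tendsto_atTop_mono' _ ?_ ((tendsto_norm_phaseFilter hA).const_mul_atTop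
    (show (0 : ℝ) < 2 / 3 by norm_num))
  filter_upwards [eventually_mem_phaseFilter] with p hp
  linarith [norm_le_of_mem_sector hp.1]

theorem tendsto_log_phaseFilter (hA : 1 ≤ A) :
    Tendsto (fun p : ℕ × ℂ => Real.log ‖p.2‖) (phaseFilter A K) atTop :=
  Real.tendsto_log_atTop.comp (tendsto_norm_phaseFilter hA)

/-- The deviation from the approximation `z² (log z - 1/2 - iπ/2) = n`. -/
noncomputable def phaseError (p : ℕ × ℂ) : ℂ := phase p.2 - p.1 - Complex.I / 2 * p.2

theorem sq_mul_eq (p : ℕ × ℂ) :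
    p.2 ^ 2 * (Complex.log p.2 - 1 / 2 - Complex.I * Real.pi / 2) = p.1 + phaseError p := by
  rw [phaseError, phase]; ring

theorem tendsto_phaseError (hA : 1 ≤ A) :
    Tendsto (fun p : ℕ × ℂ => ‖phaseError p‖ / ‖p.2‖ ^ 2) (phaseFilter A K) (𝓝 0) := by
  have hx := tendsto_norm_phaseFilter (K := K) hA
  have h1 : Tendsto (fun p : ℕ × ℂ => (K + ‖phaseConst‖) * (‖p.2‖⁻¹ * ‖p.2‖⁻¹) + ‖p.2‖⁻¹)
      (phaseFilter A K) (𝓝 0) := by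
    have := hx.inv_tendsto_atTop
    simpa using ((this.mul this).const_mul (K + ‖phaseConst‖)).add this
  refine squeeze_zero' (Eventually.of_forall fun p => by positivity) ?_ h1
  filter_upwards [eventually_mem_phaseFilter, hx.eventually_gt_atTop 0] with p hp h0
  have h2 : ‖phaseError p‖ ≤ K + ‖phaseConst‖ + ‖p.2‖ := by
    have e : phaseError p = (phase p.2 - p.1 - phaseConst) + phaseConst - Complex.I / 2 * p.2 := by
      rw [phaseError]; ring
    rw [e]
    refine (norm_sub_le _ _).trans (add_le_add ((norm_add_le _ _).trans (by gcongr; exact hp.2)) ?_)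
    rw [norm_mul]; simp; linarith
  calc _ ≤ (K + ‖phaseConst‖ + ‖p.2‖) / ‖p.2‖ ^ 2 := by gcongr
    _ = _ := by field_simp

/-- Divide `sq_mul_eq` by z² log|z|: arg z and the constants are bounded, and the error is o(|z|²).
-/
theorem tendsto_sq_mul_log_div (hA : 1 ≤ A) :
    Tendsto (fun p : ℕ × ℂ => p.2 ^ 2 * ((Real.log ‖p.2‖ / p.1 : ℝ) : ℂ)) (phaseFilter A K)
      (𝓝 1) := by
  have hL := tendsto_log_phaseFilter (K := K) hA
  have hx := tendsto_norm_phaseFilter (K := K) hA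
  have hv : Tendsto (fun p : ℕ × ℂ => (p.1 : ℂ) / (p.2 ^ 2 * (Real.log ‖p.2‖ : ℂ)))
      (phaseFilter A K) (𝓝 1) := by
    rw [tendsto_iff_norm_sub_tendsto_zero]
    have h1 : Tendsto (fun p : ℕ × ℂ => (4 + ‖phaseError p‖ / ‖p.2‖ ^ 2) / Real.log ‖p.2‖)
        (phaseFilter A K) (𝓝 0) :=
      ((tendsto_phaseError hA).const_add 4).div_atTop hL
    refine squeeze_zero' (Eventually.of_forall fun p => norm_nonneg _) ?_ h1
    filter_upwards [eventually_mem_phaseFilter, hL.eventually_gt_atTop 0,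
      hx.eventually_gt_atTop 0] with p hp hL0 h0
    have hz0 : p.2 ≠ 0 := norm_pos_iff.1 h0
    have hLc : (Real.log ‖p.2‖ : ℂ) ≠ 0 := Complex.ofReal_ne_zero.2 hL0.ne'
    have e : (p.1 : ℂ) / (p.2 ^ 2 * (Real.log ‖p.2‖ : ℂ)) - 1
        = ((Complex.log p.2 - Real.log ‖p.2‖ - 1 / 2 - Complex.I * Real.pi / 2)
          - phaseError p / p.2 ^ 2) / (Real.log ‖p.2‖ : ℂ) := by
      have := sq_mul_eq p
      have h5 : (p.1 : ℂ) = p.2 ^ 2 * (Complex.log p.2 - 1 / 2 - Complex.I * Real.pi / 2)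
        - phaseError p := by rw [this]; ring
      rw [h5]; field_simp; ring
    rw [e, norm_div, Complex.norm_real, Real.norm_eq_abs, abs_of_pos hL0]
    gcongr
    refine (norm_sub_le _ _).trans (add_le_add ?_ (by rw [norm_div, norm_pow]))
    have e2 : Complex.log p.2 - Real.log ‖p.2‖ - 1 / 2 - Complex.I * Real.pi / 2
        = ((p.2.arg - Real.pi / 2 : ℝ) : ℂ) * Complex.I - ((1 / 2 : ℝ) : ℂ) := by
      rw [Complex.log]; push_cast; ring
    rw [e2]
    refine (norm_sub_le _ _).trans ?_
    rw [norm_mul, Complex.norm_I, Complex.norm_real, Complex.norm_real, mul_one, Real.norm_eq_abs,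
      Real.norm_eq_abs]
    have harg := abs_le.1 (Complex.abs_arg_lt_pi_div_two_iff.2
      (Or.inl (re_pos_of_mem_sector hp.1))).le
    have : |p.2.arg - Real.pi / 2| ≤ Real.pi := by
      rw [abs_le]; constructor <;> linarith [Real.pi_pos]
    norm_num
    linarith [Real.pi_lt_d2]
  have h := hv.inv₀ one_ne_zero
  rw [inv_one] at h
  refine h.congr fun p => ?_
  rw [inv_div]; push_cast; ring

/-- A positive multiple of z² tends to 1, and arg(z²) = 2 arg z in the right half plane. -/
theorem tendsto_arg_phaseFilter (hA : 1 ≤ A) :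
    Tendsto (fun p : ℕ × ℂ => p.2.arg) (phaseFilter A K) (𝓝 0) := by
  have h1 := ((Complex.continuousAt_arg (x := 1) (Or.inl one_pos)).tendsto.comp
    (tendsto_sq_mul_log_div (K := K) hA)).div_const 2
  rw [Complex.arg_one, zero_div] at h1
  refine h1.congr' ?_
  filter_upwards [eventually_mem_phaseFilter,
    (tendsto_log_phaseFilter (K := K) hA).eventually_gt_atTop 0,
    tendsto_fst_cast_phaseFilter.eventually_gt_atTop 0] with p hp hL hn
  have hre := re_pos_of_mem_sector hp.1
  have hz0 : p.2 ≠ 0 := by intro h; rw [h] at hre; simp at hre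
  have harg := abs_lt.1 (Complex.abs_arg_lt_pi_div_two_iff.2 (Or.inl hre))
  rw [Function.comp_apply, mul_comm, Complex.arg_real_mul _ (div_pos hL hn), sq,
    (Complex.arg_mul_eq_add_arg_iff hz0 hz0).2 ⟨by linarith, by linarith⟩]
  ring

/-- The leading term gives only arg z → 0. The imaginary part of `sq_mul_eq` gives the next order:
Im(z²)(log|z| - 1/2) = Re(z²)(π/2 - arg z) + Im(error), where n has dropped out. -/
theorem tendsto_im_sq_mul_log_sq_div (hA : 1 ≤ A) :
    Tendsto (fun p : ℕ × ℂ => (p.2 ^ 2).im * (Real.log ‖p.2‖ ^ 2 / p.1)) (phaseFilter A K)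
      (𝓝 (Real.pi / 2)) := by
  have hL := tendsto_log_phaseFilter (K := K) hA
  have hx := tendsto_norm_phaseFilter (K := K) hA
  have hu := tendsto_sq_mul_log_div (K := K) hA
  have hre : Tendsto (fun p : ℕ × ℂ => (p.2 ^ 2).re * (Real.log ‖p.2‖ / p.1)) (phaseFilter A K)
      (𝓝 1) := by
    have := (Complex.continuous_re.tendsto 1).comp hu
    refine this.congr fun p => ?_
    rw [Function.comp_apply, mul_comm, Complex.re_ofReal_mul, mul_comm]
  have hn : Tendsto (fun p : ℕ × ℂ => ‖p.2‖ ^ 2 * |Real.log ‖p.2‖ / p.1|) (phaseFilter A K)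
      (𝓝 1) := by
    have := hu.norm
    rw [norm_one] at this
    refine this.congr fun p => ?_
    rw [norm_mul, norm_pow, Complex.norm_real, Real.norm_eq_abs]
  have he : Tendsto (fun p : ℕ × ℂ => (phaseError p).im * (Real.log ‖p.2‖ / p.1))
      (phaseFilter A K) (𝓝 0) := by
    have h1 := (tendsto_phaseError (K := K) hA).mul hn
    rw [zero_mul] at h1
    refine squeeze_zero_norm' ?_ h1
    filter_upwards [hx.eventually_gt_atTop 0] with p h0
    rw [norm_mul, Real.norm_eq_abs, Real.norm_eq_abs, ← mul_assoc,
      div_mul_cancel₀ _ (by positivity)]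
    gcongr
    exact Complex.abs_im_le_norm _
  have harg := tendsto_arg_phaseFilter (K := K) hA
  have h1 := (hre.mul (harg.const_sub (Real.pi / 2))).add he
  have h2 : Tendsto (fun p : ℕ × ℂ => 1 - 1 / 2 / Real.log ‖p.2‖) (phaseFilter A K) (𝓝 1) := by
    simpa using (hL.const_div_atTop (1 / 2)).const_sub 1
  have h3 := h1.div h2 one_ne_zero
  rw [one_mul, sub_zero, add_zero, div_one] at h3
  refine h3.congr' ?_
  filter_upwards [hL.eventually_gt_atTop 1, tendsto_fst_cast_phaseFilter.eventually_gt_atTop 0]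
    with p hL1 hn0
  have h4 := congrArg Complex.im (sq_mul_eq p)
  have e : Complex.log p.2 - 1 / 2 - Complex.I * Real.pi / 2
      = ((Real.log ‖p.2‖ - 1 / 2 : ℝ) : ℂ) + ((p.2.arg - Real.pi / 2 : ℝ) : ℂ) * Complex.I := by
    rw [Complex.log]; push_cast; ring
  rw [e, Complex.mul_im, Complex.add_im p.1, Complex.natCast_im, zero_add] at h4
  simp only [Complex.add_im, Complex.add_re, Complex.ofReal_re, Complex.ofReal_im,
    Complex.re_ofReal_mul, Complex.im_ofReal_mul, Complex.I_re, Complex.I_im, mul_zero, mul_one,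
    add_zero, zero_add] at h4
  rw [Pi.div_apply, div_eq_iff]
  · rw [← h4]
    have : Real.log ‖p.2‖ ≠ 0 := by positivity
    field_simp
    ring
  · have : 1 / 2 / Real.log ‖p.2‖ < 1 := by
      rw [div_lt_one (by linarith)]; linarith
    linarith

/-- Take logarithms in |z|² log|z| / n → 1 and divide by log|z|. -/
theorem tendsto_log_div_log (hA : 1 ≤ A) :
    Tendsto (fun p : ℕ × ℂ => Real.log p.1 / Real.log ‖p.2‖) (phaseFilter A K) (𝓝 2) := by
  have hL := tendsto_log_phaseFilter (K := K) hA
  have hx := tendsto_norm_phaseFilter (K := K) hA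
  have hu := (tendsto_sq_mul_log_div (K := K) hA).norm
  rw [norm_one] at hu
  have h1 := (((Real.continuousAt_log one_ne_zero).tendsto.comp hu).div_atTop hL)
  have h2 : Tendsto (fun p : ℕ × ℂ => Real.log (Real.log ‖p.2‖) / Real.log ‖p.2‖)
      (phaseFilter A K) (𝓝 0) :=
    (Real.isLittleO_log_id_atTop.tendsto_div_nhds_zero).comp hL
  have h3 := (h2.const_add 2).sub h1
  rw [add_zero, sub_zero] at h3
  refine h3.congr' ?_
  filter_upwards [hL.eventually_gt_atTop 0, hx.eventually_gt_atTop 0,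
    tendsto_fst_cast_phaseFilter.eventually_gt_atTop 0] with p hL0 h0 hn
  rw [Function.comp_apply, norm_mul, norm_pow, Complex.norm_real, Real.norm_eq_abs,
    abs_of_pos (div_pos hL0 hn), Real.log_mul (by positivity) (by positivity), Real.log_pow,
    Real.log_div hL0.ne' hn.ne']
  push_cast
  field_simp
  ring

theorem tendsto_re_sOf_div (hA : 1 ≤ A) :
    Tendsto (fun p : ℕ × ℂ => (sOf p.2).re / (4 * Real.pi ^ 2 * p.1 / Real.log p.1 ^ 2))
      (phaseFilter A K) (𝓝 1) := by
  have h1 := ((tendsto_im_sq_mul_log_sq_div (K := K) hA).mul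
    ((tendsto_log_div_log (K := K) hA).pow 2)).div_const (2 * Real.pi)
  have e : Real.pi / 2 * 2 ^ 2 / (2 * Real.pi) = 1 := by
    have := Real.pi_ne_zero
    field_simp
  rw [e] at h1
  refine h1.congr' ?_
  filter_upwards [(tendsto_log_phaseFilter (K := K) hA).eventually_gt_atTop 0] with p hL0
  have e2 : (sOf p.2).re = 2 * Real.pi * (p.2 ^ 2).im := by
    rw [sOf_re]; simp [sq]; ring
  rw [e2]
  have := Real.pi_ne_zero
  field_simp
  norm_num

theorem tendsto_im_sOf_div (hA : 1 ≤ A) :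
    Tendsto (fun p : ℕ × ℂ => (sOf p.2).im / -(4 * Real.pi * p.1 / Real.log p.1))
      (phaseFilter A K) (𝓝 1) := by
  have h0 := (Complex.continuous_re.tendsto 1).comp (tendsto_sq_mul_log_div (K := K) hA)
  have h1 := (h0.mul (tendsto_log_div_log (K := K) hA)).div_const 2
  rw [Complex.one_re, one_mul, div_self two_ne_zero] at h1
  refine h1.congr' ?_
  filter_upwards [(tendsto_log_phaseFilter (K := K) hA).eventually_gt_atTop 0] with p hL0
  have e2 : (sOf p.2).im = -(2 * Real.pi) * (p.2 ^ 2).re := by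
    rw [sOf_im]; simp [sq]
  rw [e2, Function.comp_apply, mul_comm (p.2 ^ 2), Complex.re_ofReal_mul]
  have := Real.pi_ne_zero
  field_simp
  norm_num

theorem tendsto_natCast_div_log_sq :
    Tendsto (fun n : ℕ => 4 * Real.pi ^ 2 * n / Real.log n ^ 2) atTop atTop := by
  have h1 : Tendsto (fun x : ℝ => Real.log x ^ 2 / x) atTop (𝓝[>] 0) := by
    refine tendsto_nhdsWithin_iff.2
      ⟨(Real.isLittleO_pow_log_id_atTop (n := 2)).tendsto_div_nhds_zero, ?_⟩
    filter_upwards [eventually_gt_atTop 1] with x hx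
    have := Real.log_pos hx
    exact Set.mem_Ioi.2 (by positivity)
  have h2 := (h1.inv_tendsto_nhdsGT_zero.comp (tendsto_natCast_atTop_atTop (R := ℝ))).const_mul_atTop
    (show 0 < 4 * Real.pi ^ 2 by positivity)
  refine h2.congr fun n => ?_
  simp only [Function.comp_apply, Pi.inv_apply, inv_div]
  ring

theorem tendsto_re_sOf (hA : 1 ≤ A) :
    Tendsto (fun p : ℕ × ℂ => (sOf p.2).re) (phaseFilter A K) atTop := by
  have h := (tendsto_re_sOf_div (K := K) hA).pos_mul_atTop one_pos
    (tendsto_natCast_div_log_sq.comp tendsto_fst_phaseFilter)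
  refine h.congr' ?_
  filter_upwards [(tendsto_natCast_div_log_sq.comp (tendsto_fst_phaseFilter (A := A)
    (K := K))).eventually_gt_atTop 0] with p hp
  exact div_mul_cancel₀ _ hp.ne'

/-- Re s = 4π Re z Im z → ∞ forces Im z > 0, so points of the symmetric sector end up in the saddle
region. -/
theorem tendsto_snd_formFilter (hA : 1 ≤ A) :
    Tendsto Prod.snd (phaseFilter A K) formFilter := by
  have hs := tendsto_re_sOf (K := K) hA
  refine tendsto_inf.2 ⟨tendsto_inf.2 ⟨tendsto_comap_iff.2 (tendsto_re_phaseFilter hA),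
    tendsto_principal.2 ?_⟩, tendsto_comap_iff.2 hs⟩
  filter_upwards [eventually_mem_phaseFilter, hs.eventually_gt_atTop 0] with p hp h0
  have hre := re_pos_of_mem_sector hp.1
  rw [sOf_re] at h0
  refine ⟨by linarith [hp.1.1], ?_, (abs_lt.1 hp.1.2).2.le⟩
  by_contra! hcon
  have : p.2.re * p.2.im ≤ 0 := mul_nonpos_of_nonneg_of_nonpos hre.le hcon
  nlinarith [Real.pi_pos]

end PhaseAsymptotics

/-! ### Zeros near the points with prescribed phase -/

section LocalZero

open Topology

/-- Cauchy's estimate turns closeness of F to 1 - e^{2πi(H - H(w))} into closeness of (i/2π)F' to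
H'. Thus (i/2π)F also has derivative with large real part, and the expansion and covering lemmas
above apply to it. -/
theorem exists_zero_of_near_one_sub_exp {H H' F : ℂ → ℂ} {w : ℂ} {m : ℝ} (hm : 0 < m)
    (hH : ∀ z ∈ Metric.closedBall w (1 / (10 * m)), HasDerivAt H (H' z) z)
    (hre : ∀ z ∈ Metric.closedBall w (1 / (10 * m)), m ≤ (H' z).re)
    (hn : ∀ z ∈ Metric.closedBall w (1 / (10 * m)), ‖H' z‖ ≤ 6 * m)
    (hF : Differentiable ℂ F)
    (hE : ∀ z ∈ Metric.closedBall w (1 / (10 * m)),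
      ‖F z - (1 - Complex.exp (2 * Real.pi * Complex.I * (H z - H w)))‖ ≤ 1 / 10000) :
    ∃ z₀ ∈ Metric.closedBall w (1 / (10000 * m)), F z₀ = 0 ∧
      ∀ z ∈ Metric.closedBall w (1 / (1000 * m)), 3 * m * ‖z - z₀‖ ≤ ‖F z‖ := by
  have hpi := Real.pi_pos
  have hpic : (Real.pi : ℂ) ≠ 0 := Complex.ofReal_ne_zero.2 Real.pi_ne_zero
  have hnc : ‖Complex.I / (2 * Real.pi)‖ = 1 / (2 * Real.pi) := by
    rw [norm_div, norm_mul, Complex.norm_I, Complex.norm_real, Real.norm_eq_abs, abs_of_pos hpi,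
      Complex.norm_ofNat]
  have hsub : ∀ {c d : ℝ}, 0 < d → d ≤ c → 1 / (c * m) ≤ 1 / (d * m) := fun hd hcd => by gcongr
  have hsmall : Metric.closedBall w (1 / (1000 * m)) ⊆ Metric.closedBall w (1 / (10 * m)) :=
    Metric.closedBall_subset_closedBall (hsub (by norm_num) (by norm_num))
  have hder : ∀ z ∈ Metric.closedBall w (1 / (1000 * m)),
      m / 2 ≤ (Complex.I / (2 * Real.pi) * deriv F z).re := by
    intro z hz
    have hzb := hsmall hz
    set q : ℂ → ℂ := fun z => 2 * Real.pi * Complex.I * (H z - H w) with hq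
    set E : ℂ → ℂ := fun z => F z - (1 - Complex.exp (q z)) with hEdef
    have hEd : ∀ x ∈ Metric.closedBall w (1 / (10 * m)), HasDerivAt E
        (deriv F x + Complex.exp (q x) * (2 * Real.pi * Complex.I * H' x)) x := by
      intro x hx
      have h1 := (hF x).hasDerivAt.sub
        ((((hH x hx).sub_const (H w)).const_mul (2 * Real.pi * Complex.I)).cexp.const_sub 1)
      refine h1.congr_deriv ?_
      rw [sub_neg_eq_add]
    have hball : Metric.closedBall z (1 / (20 * m)) ⊆ Metric.closedBall w (1 / (10 * m)) := by
      refine Metric.closedBall_subset_closedBall' ?_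
      rw [Metric.mem_closedBall] at hz
      have : 1 / (20 * m) + 1 / (1000 * m) ≤ 1 / (10 * m) := by
        field_simp; norm_num
      linarith
    have hcauchy : ‖deriv E z‖ ≤ 1 / 10000 / (1 / (20 * m)) :=
      Complex.norm_deriv_le_of_forall_mem_sphere_norm_le (by positivity)
        (DifferentiableOn.diffContOnCl_ball (U := Metric.closedBall z (1 / (20 * m)))
          (fun x hx => (hEd x (hball hx)).differentiableAt.differentiableWithinAt) subset_rfl)
        fun x hx => hE x (hball (Metric.sphere_subset_closedBall hx))
    have hHz : ‖H z - H w‖ ≤ 6 * m * ‖z - w‖ :=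
      (convex_closedBall w (1 / (10 * m))).norm_image_sub_le_of_norm_hasDerivWithin_le
        (fun x hx => (hH x hx).hasDerivWithinAt) hn
        (Metric.mem_closedBall_self (by positivity)) hzb
    rw [mem_closedBall_iff_norm] at hz
    have hHz2 : ‖H z - H w‖ ≤ 6 / 1000 := by
      refine hHz.trans ?_
      calc _ ≤ 6 * m * (1 / (1000 * m)) := by gcongr
        _ = _ := by field_simp
    have hqn : ‖q z‖ ≤ 38 / 1000 := by
      rw [hq]
      simp only
      rw [mul_assoc 2, norm_mul, norm_mul, norm_pi_mul_I, Complex.norm_ofNat]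
      nlinarith [Real.pi_lt_d2, norm_nonneg (H z - H w)]
    have hexp := Complex.norm_exp_sub_one_le (x := q z) (by linarith)
    have e : Complex.I / (2 * Real.pi) * deriv F z = Complex.I / (2 * Real.pi) * deriv E z
        + H' z + (Complex.exp (q z) - 1) * H' z := by
      rw [(hEd z hzb).deriv]
      field_simp
      linear_combination (-(2 * Real.pi * H' z * Complex.exp (q z))) * Complex.I_sq
    have h1 : ‖Complex.I / (2 * Real.pi) * deriv E z‖ ≤ m / 1000 := by
      rw [norm_mul, hnc]
      calc _ ≤ 1 / (2 * 3) * (1 / 10000 / (1 / (20 * m))) := by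
            gcongr; exact Real.pi_gt_three.le
        _ ≤ _ := by field_simp; norm_num
    have h2 : ‖(Complex.exp (q z) - 1) * H' z‖ ≤ 76 / 1000 * (6 * m) := by
      rw [norm_mul]
      gcongr
      · linarith
      · exact hn z hzb
    -- The losses m/1000 and 0.456 m leave more than m/2.
    rw [e, Complex.add_re, Complex.add_re]
    have h3 := abs_le.1 ((Complex.abs_re_le_norm _).trans h1)
    have h4 := abs_le.1 ((Complex.abs_re_le_norm _).trans h2)
    linarith [hre z hzb]
  have hf : ∀ z, HasDerivAt (fun z => Complex.I / (2 * Real.pi) * F z)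
      (Complex.I / (2 * Real.pi) * deriv F z) z := fun z => (hF z).hasDerivAt.const_mul _
  have hsmall' : Metric.closedBall w (1 / (10000 * m)) ⊆ Metric.closedBall w (1 / (1000 * m)) :=
    Metric.closedBall_subset_closedBall (hsub (by norm_num) (by norm_num))
  have himg := ball_subset_image_of_le_re (f := fun z => Complex.I / (2 * Real.pi) * F z)
    (r := 1 / (10000 * m)) (c := m / 2) (fun z _ => hf z) (by positivity) (by positivity)
    fun z hz => hder z (hsmall' hz)
  have h0 : (0 : ℂ) ∈ Metric.ball (Complex.I / (2 * Real.pi) * F w)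
      (m / 2 * (1 / (10000 * m)) / 2) := by
    have hw := hE w (Metric.mem_closedBall_self (by positivity))
    rw [sub_self, mul_zero, Complex.exp_zero, sub_self, sub_zero] at hw
    rw [mem_ball_iff_norm', sub_zero, norm_mul, hnc]
    have e1 : m / 2 * (1 / (10000 * m)) / 2 = 1 / 40000 := by field_simp; norm_num
    have e2 : 1 / (2 * Real.pi) ≤ 1 / 6 :=
      one_div_le_one_div_of_le (by norm_num) (by linarith [Real.pi_gt_three])
    have e3 : 0 < 1 / (2 * Real.pi) := by positivity
    rw [e1]
    nlinarith [norm_nonneg (F w)]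
  obtain ⟨z₀, hz₀, hz₀'⟩ := himg h0
  have hne : Complex.I / (2 * Real.pi) ≠ 0 := by
    rw [← norm_ne_zero_iff, hnc]; positivity
  have hFz₀ : F z₀ = 0 := (mul_eq_zero.1 hz₀').resolve_left hne
  refine ⟨z₀, hz₀, hFz₀, fun z hz => ?_⟩
  -- The factor m/2 for (i/2π)F becomes πm ≥ 3m for F.
  have h := mul_norm_sub_le_of_le_re (convex_closedBall w (1 / (1000 * m)))
    (f := fun z => Complex.I / (2 * Real.pi) * F z) (fun z _ => hf z) hder hz (hsmall' hz₀)
  simp only [hFz₀, mul_zero, sub_zero] at h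
  rw [norm_mul, hnc, one_div_mul_eq_div, le_div_iff₀ (by positivity)] at h
  have : 0 ≤ m * ‖z - z₀‖ := by positivity
  nlinarith [Real.pi_gt_three]

theorem eventually_phaseFilter_iff {A K : ℝ} {P : ℕ × ℂ → Prop} :
    (∀ᶠ p in phaseFilter A K, P p) ↔ ∃ N, ∀ n : ℕ, N ≤ n → ∀ z ∈ sector A,
      ‖phase z - n - phaseConst‖ ≤ K → P (n, z) := by
  rw [phaseFilter, eventually_inf_principal, eventually_comap, eventually_atTop]
  constructor
  · rintro ⟨N, h⟩
    exact ⟨N, fun n hn z hz hp => h n hn (n, z) rfl ⟨hz, hp⟩⟩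
  · rintro ⟨N, h⟩
    refine ⟨N, ?_⟩
    rintro n hn ⟨_, z⟩ rfl hp
    exact h _ hn z hp.1 hp.2

/-- The region that isolates the `n`-th zero. -/
def zeroRegion (A : ℝ) (n : ℕ) : Set ℂ :=
  {z | z ∈ sector A ∧ ‖phase z - n - phaseConst‖ < 1 / 1000}

/-- Expansion of the phase places the whole region within 1/(1000m) of the point w of exact phase,
where |R| ≥ 3m|z - z₀|. This beats the Lipschitz constant of `sOf`. -/
theorem exists_isolated_zeros {A : ℝ} (hA1 : 8 ≤ A) (hA : 13 ≤ Real.log A) :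
    ∃ N : ℕ, ∀ n : ℕ, N ≤ n → ∃ z₀ ∈ zeroRegion A n, riemannAux (sOf z₀) = 0 ∧
      ∀ z ∈ zeroRegion A n, ‖sOf z₀ - sOf z‖ ≤ ‖riemannAux (sOf z)‖ := by
  -- The margin A + 1, together with |Im w| ≤ Re w / 2, keeps the unit disc about w inside `sector
  -- A`.
  obtain ⟨N₁, h₁⟩ := exists_phase_eq (A + 1)
  obtain ⟨N₂, h₂⟩ := eventually_phaseFilter_iff.1
    ((tendsto_snd_formFilter (A := A) (K := 1) (by linarith)).eventually
      (eventually_riemannAux_form (ε := 1 / 10000) (by norm_num)))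
  refine ⟨max N₁ N₂, fun n hn => ?_⟩
  obtain ⟨w, hw, hwim, hwe⟩ := h₁ n ((le_max_left _ _).trans hn)
  have h₂' := h₂ n ((le_max_right _ _).trans hn)
  set t := w.re - 1 with ht
  have htA : A ≤ t := by linarith [hw.1]
  have ht0 : 0 < t := by linarith
  have hlog : 13 ≤ Real.log t := hA.trans (Real.log_le_log (by linarith) htA)
  set m := t * Real.log t with hmdef
  have hm1 : 13 * t ≤ m := by nlinarith
  have hm : 0 < m := by linarith
  have hball : ∀ z, ‖z - w‖ ≤ 1 → z ∈ sector A ∧ t ≤ z.re ∧ ‖z‖ ≤ 2 * t := by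
    intro z hz
    have a1 := abs_le.1 ((Complex.abs_re_le_norm (z - w)).trans hz)
    have a2 := (Complex.abs_im_le_norm (z - w)).trans hz
    rw [Complex.sub_re] at a1
    rw [Complex.sub_im] at a2
    have a3 := norm_le_of_mem_sector hw
    have a4 := norm_sub_norm_le z w
    have a5 : |z.im| ≤ |w.im| + 1 := by
      have := abs_sub_abs_le_abs_sub z.im w.im
      linarith
    exact ⟨⟨by linarith [hw.1], by linarith⟩, by linarith, by linarith⟩
  have hrad : ∀ c : ℝ, 1 ≤ c → 1 / (c * m) ≤ 1 := fun c hc => by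
    rw [div_le_one (by positivity)]; nlinarith
  have hw1 : ∀ c : ℝ, 1 ≤ c → ∀ z ∈ Metric.closedBall w (1 / (c * m)), ‖z - w‖ ≤ 1 :=
    fun c hc z hz => (mem_closedBall_iff_norm.1 hz).trans (hrad c hc)
  have hd : ∀ c : ℝ, 1 ≤ c → ∀ z ∈ Metric.closedBall w (1 / (c * m)),
      HasDerivAt phase (derivPhase z) z :=
    fun c hc z hz => hasDerivAt_phase (re_pos_of_mem_sector (hball z (hw1 c hc z hz)).1)
  have hnorm : ∀ c : ℝ, 1 ≤ c → ∀ z ∈ Metric.closedBall w (1 / (c * m)),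
      ‖derivPhase z‖ ≤ 6 * m := fun c hc z hz => by
    obtain ⟨-, b1, b2⟩ := hball z (hw1 c hc z hz)
    exact norm_derivPhase_le b1 b2 ht0 hlog
  have hphase : ∀ c : ℝ, 1 ≤ c → ∀ z ∈ Metric.closedBall w (1 / (c * m)),
      ‖phase z - n - phaseConst‖ ≤ 6 / c := fun c hc z hz => by
    have := (convex_closedBall w (1 / (c * m))).norm_image_sub_le_of_norm_hasDerivWithin_le
        (fun x hx => (hd c hc x hx).hasDerivWithinAt) (hnorm c hc)
        (Metric.mem_closedBall_self (by positivity)) hz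
    rw [hwe, ← sub_sub] at this
    refine this.trans ?_
    rw [mem_closedBall_iff_norm] at hz
    calc _ ≤ 6 * m * (1 / (c * m)) := by gcongr
      _ = _ := by field_simp
  obtain ⟨z₀, hz₀, hz₀0, hlow⟩ := exists_zero_of_near_one_sub_exp (H := phase) (H' := derivPhase)
    (F := fun z => riemannAux (sOf z)) (w := w) hm (hd 10 (by norm_num))
    (fun z hz => by
      obtain ⟨-, b1, b2⟩ := hball z (hw1 10 (by norm_num) z hz)
      exact le_re_derivPhase b1 b2 ht0 hlog) (hnorm 10 (by norm_num))
    (differentiable_riemannAux.comp (by unfold sOf; fun_prop))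
    (fun z hz => by
      have b1 := hphase 10 (by norm_num) z hz
      have b2 := h₂' z (hball z (hw1 10 (by norm_num) z hz)).1 (by linarith) n
        (show ‖phase z - n - phaseConst‖ ≤ 1 by linarith)
      rw [mainExponent] at b2
      rwa [hwe, ← sub_sub])
  have hz₀b := hw1 10000 (by norm_num) z₀ hz₀
  refine ⟨z₀, ⟨(hball z₀ hz₀b).1, ?_⟩, hz₀0, fun z hz => ?_⟩
  · have := hphase 10000 (by norm_num) z₀ hz₀
    linarith
  · have hws : w ∈ sector A := (hball w (by simp)).1
    have hpw : ‖phase z - phase w‖ ≤ 1 / 1000 := by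
      rw [hwe, ← sub_sub]; exact hz.2.le
    have h1 : ‖z - w‖ ≤ 1 :=
      (norm_sub_le_norm_phase_sub (by linarith) hA hz.1 hws).trans (hpw.trans (by norm_num))
    have h2 : m * ‖z - w‖ ≤ ‖phase z - phase w‖ :=
      mul_norm_sub_le_of_le_re (convex_closedBall w 1) (f := phase) (f' := derivPhase)
        (fun x hx => hasDerivAt_phase
          (re_pos_of_mem_sector (hball x (mem_closedBall_iff_norm.1 hx)).1))
        (fun x hx => by
          obtain ⟨-, b1, b2⟩ := hball x (mem_closedBall_iff_norm.1 hx)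
          exact le_re_derivPhase b1 b2 ht0 hlog)
        (mem_closedBall_iff_norm.2 h1) (Metric.mem_closedBall_self zero_le_one)
    have h3 : z ∈ Metric.closedBall w (1 / (1000 * m)) := by
      rw [mem_closedBall_iff_norm, le_div_iff₀ (by positivity)]
      nlinarith
    refine le_trans ?_ (hlow z h3)
    have e : sOf z₀ - sOf z = 2 * (Real.pi * Complex.I) * (z + z₀) * (z - z₀) := by
      rw [sOf, sOf]; ring
    rw [e, norm_mul, norm_mul, norm_mul, norm_pi_mul_I, Complex.norm_ofNat]
    -- The factor is at most 2π · 4t, and 8π < 39 while 39t ≤ 3m.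
    refine mul_le_mul_of_nonneg_right ?_ (norm_nonneg _)
    have b1 := (hball z h1).2.2
    have b2 := (hball z₀ hz₀b).2.2
    have b3 := norm_add_le z z₀
    nlinarith [Real.pi_lt_d2, Real.pi_pos]

end LocalZero

/-! ### The order of the zeros -/

section Order

open Topology

theorem norm_log_sub_log_le {s : Set ℂ} (hs : Convex ℝ s) {t : ℝ} (ht : 0 < t)
    (h : ∀ z ∈ s, t ≤ z.re) {x y : ℂ} (hx : x ∈ s) (hy : y ∈ s) :
    ‖Complex.log y - Complex.log x‖ ≤ t⁻¹ * ‖y - x‖ :=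
  hs.norm_image_sub_le_of_norm_hasDerivWithin_le (f' := fun z => z⁻¹)
    (fun z hz => (Complex.hasDerivAt_log (Or.inl (ht.trans_le (h z hz)))).hasDerivWithinAt)
    (fun z hz => by
      rw [norm_inv]
      exact inv_anti₀ ht ((h z hz).trans (Complex.re_le_norm z))) hx hy

/-- P equals (PK) conj(K) / |K|² with PK near 1, so Re P has the sign of Re K as long as Im K is not
too large. -/
theorem re_pos_of_norm_mul_sub_one_le {P K : ℂ} (h : ‖P * K - 1‖ ≤ 1 / 10) (hre : 1 ≤ K.re)
    (him : |K.im| ≤ 4 * K.re) : 0 < P.re := by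
  have h1 := abs_le.1 ((Complex.abs_re_le_norm _).trans h)
  have h2 := (Complex.abs_im_le_norm _).trans h
  rw [Complex.sub_re, Complex.one_re] at h1
  rw [Complex.sub_im, Complex.one_im, sub_zero] at h2
  have e : P.re * Complex.normSq K = (P * K).re * K.re + (P * K).im * K.im := by
    rw [Complex.normSq_apply, Complex.mul_re, Complex.mul_im]; ring
  have h3 : |(P * K).im * K.im| ≤ 1 / 10 * (4 * K.re) := by
    rw [abs_mul]; gcongr
  have h4 := (abs_le.1 h3).1
  have h5 : 9 / 10 * K.re ≤ (P * K).re * K.re := by gcongr; linarith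
  have h6 : 0 < P.re * Complex.normSq K := by rw [e]; linarith
  exact pos_of_mul_pos_left h6 (Complex.normSq_nonneg K)

/-- The phases differ by nearly 1 and |y - x| is O(1/(t log t)), so (y² - x²)K is nearly 1 with K =
log y - 1/2 - iπ/2, whose real part dominates. Hence Re y² > Re x², and Im s = -2π Re z². -/
theorem im_sOf_lt_of_mem_zeroRegion {A : ℝ} (hA1 : 8 ≤ A) (hA : 13 ≤ Real.log A) :
    ∃ N : ℕ, ∀ n : ℕ, N ≤ n → ∀ x ∈ zeroRegion A n, ∀ y ∈ zeroRegion A (n + 1),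
      (sOf y).im < (sOf x).im := by
  obtain ⟨N, hN⟩ := eventually_phaseFilter_iff.1
    ((tendsto_re_phaseFilter (A := A) (K := 1) (by linarith)).eventually_ge_atTop
      (Real.exp 100 + 2))
  refine ⟨N, fun n hn x hx y hy => ?_⟩
  have hxre : Real.exp 100 + 2 ≤ x.re := hN n hn x hx.1 (hx.2.le.trans (by norm_num))
  have hdiff : ‖phase y - phase x - 1‖ ≤ 2 / 1000 := by
    have e : phase y - phase x - 1
        = (phase y - (n + 1 : ℕ) - phaseConst) - (phase x - n - phaseConst) := by
      push_cast; ring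
    rw [e]
    refine (norm_sub_le _ _).trans ?_
    linarith [hx.2, hy.2]
  have hdiff' : ‖phase y - phase x‖ ≤ 1002 / 1000 := by
    have := norm_sub_norm_le (phase y - phase x) 1
    rw [norm_one] at this
    linarith
  have hyx : ‖y - x‖ ≤ 2 :=
    (norm_sub_le_norm_phase_sub (by linarith) hA hy.1 hx.1).trans (hdiff'.trans (by norm_num))
  set t := x.re - 2 with ht
  have htE : Real.exp 100 ≤ t := by linarith
  have ht100 : 101 ≤ t := by linarith [Real.add_one_le_exp 100]
  have ht0 : 0 < t := by linarith
  have hlog : 100 ≤ Real.log t := (Real.le_log_iff_exp_le ht0).2 htE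
  set s := sector A ∩ Metric.closedBall x 2 with hs
  have hsc : Convex ℝ s := (convex_sector A).inter (convex_closedBall x 2)
  have hsb : ∀ z ∈ s, t ≤ z.re ∧ ‖z‖ ≤ 2 * t := by
    intro z hz
    have a1 := abs_le.1 ((Complex.abs_re_le_norm (z - x)).trans (mem_closedBall_iff_norm.1 hz.2))
    rw [Complex.sub_re] at a1
    exact ⟨by linarith, by linarith [norm_le_of_mem_sector hz.1]⟩
  have hxs : x ∈ s := ⟨hx.1, Metric.mem_closedBall_self (by norm_num)⟩
  have hys : y ∈ s := ⟨hy.1, mem_closedBall_iff_norm.2 hyx⟩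
  have hm : t * Real.log t * ‖y - x‖ ≤ 1002 / 1000 :=
    (mul_norm_sub_le_of_le_re hsc (f := phase) (f' := derivPhase)
      (fun z hz => hasDerivAt_phase (ht0.trans_le (hsb z hz).1))
      (fun z hz => le_re_derivPhase (hsb z hz).1 (hsb z hz).2 ht0 (by linarith)) hys hxs).trans
      hdiff'
  have hty : t * ‖y - x‖ ≤ 11 / 1000 := by
    have : 100 * (t * ‖y - x‖) ≤ Real.log t * (t * ‖y - x‖) := by gcongr
    linarith
  have hlogs := norm_log_sub_log_le hsc ht0 (fun z hz => (hsb z hz).1) hxs hys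
  set K := Complex.log y - 1 / 2 - Complex.I * Real.pi / 2 with hK
  have hPK : ‖(y ^ 2 - x ^ 2) * K - 1‖ ≤ 1 / 10 := by
    have e : (y ^ 2 - x ^ 2) * K - 1 = (phase y - phase x - 1)
        - x ^ 2 * (Complex.log y - Complex.log x) - Complex.I / 2 * (y - x) := by
      rw [hK, phase, phase]; ring
    have b1 : ‖x ^ 2 * (Complex.log y - Complex.log x)‖ ≤ 44 / 1000 := by
      rw [norm_mul, norm_pow]
      calc _ ≤ (2 * t) ^ 2 * (t⁻¹ * ‖y - x‖) := by gcongr; exact (hsb x hxs).2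
        _ = 4 * (t * ‖y - x‖) := by field_simp; ring
        _ ≤ _ := by linarith
    have b2 : ‖Complex.I / 2 * (y - x)‖ ≤ 11 / 1000 := by
      rw [norm_mul]
      have : ‖y - x‖ ≤ t * ‖y - x‖ := le_mul_of_one_le_left (norm_nonneg _) (by linarith)
      simp
      linarith
    rw [e]
    refine (norm_sub_le _ _).trans ?_
    have := norm_sub_le (phase y - phase x - 1) (x ^ 2 * (Complex.log y - Complex.log x))
    linarith
  have hyre : 0 < y.re := ht0.trans_le (hsb y hys).1
  have hKre : K.re = Real.log ‖y‖ - 1 / 2 := by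
    simp [hK, Complex.log_re]
  have hKim : K.im = y.arg - Real.pi / 2 := by
    simp [hK, Complex.log_im]
  have hKre' : 99 ≤ K.re := by
    rw [hKre]
    have := Real.log_le_log ht0 ((hsb y hys).1.trans (Complex.re_le_norm y))
    linarith
  have harg := abs_lt.1 (Complex.abs_arg_lt_pi_div_two_iff.2 (Or.inl hyre))
  have hKim' : |K.im| ≤ 4 := by
    rw [hKim, abs_le]; constructor <;> linarith [Real.pi_lt_d2, Real.pi_pos]
  have hP := re_pos_of_norm_mul_sub_one_le hPK (by linarith) (by linarith)
  have e2 : ∀ z : ℂ, (sOf z).im = -(2 * Real.pi) * (z ^ 2).re := fun z => by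
    rw [sOf_im]; simp [sq]
  rw [Complex.sub_re] at hP
  rw [e2, e2]
  nlinarith [Real.pi_pos]

end Order

/-! ### Computability of the zeros -/

section ComputableZeros

open Topology

variable {α : Type*} [Primcodable α]

theorem CompC.phase {z : α → ℂ} (hz : CompC z) (h0 : ∀ a, 0 < (z a).re) :
    CompC fun a => phase (z a) := by
  have h2 : CompC fun _ : α => (2 : ℂ) := CompC.const_ofNat 2
  have hI : CompC fun _ : α => (Complex.I / 2 : ℂ) := CompC.const_I.div h2 fun _ => two_ne_zero
  have hp : CompC fun _ : α => (Complex.I * Real.pi / 2 : ℂ) :=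
    (CompC.const_I.mul compC_pi).div h2 fun _ => two_ne_zero
  have h1 : CompC fun _ : α => (1 / 2 : ℂ) := CompC.const_one.div h2 fun _ => two_ne_zero
  exact (hz.pow_two.mul (((hz.log h0).sub h1).sub hp)).add (hI.mul hz)

theorem CompC.sOf {z : α → ℂ} (hz : CompC z) : CompC fun a => sOf (z a) :=
  ((((CompC.const_ofNat 2).mul compC_pi).mul CompC.const_I).neg).mul hz.pow_two

/-- A map of the plane onto the half plane `1 ≤ re z`. -/
noncomputable def toHalfPlane (w : ℂ) : ℂ :=
  ((w + (starRingEnd ℂ) w) / 2) ^ 2 + (w - (starRingEnd ℂ) w) / 2 + 1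

theorem toHalfPlane_eq (w : ℂ) : toHalfPlane w = ((w.re ^ 2 + 1 : ℝ) : ℂ) + w.im * Complex.I := by
  rw [toHalfPlane, Complex.add_conj, Complex.sub_conj]
  push_cast; ring

/-- `CompC.phase` needs positive real part for every member of the family, also for rejected
candidates. Composing with `toHalfPlane` makes every dyadic point admissible. -/
theorem toHalfPlane_re_pos (w : ℂ) : 0 < (toHalfPlane w).re := by
  rw [toHalfPlane_eq, Complex.add_re, Complex.ofReal_re, Complex.re_ofReal_mul, Complex.I_re,
    mul_zero, add_zero]
  positivity

theorem exists_toHalfPlane_eq {z : ℂ} (hz : 1 ≤ z.re) : ∃ w, toHalfPlane w = z := by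
  refine ⟨⟨√(z.re - 1), z.im⟩, ?_⟩
  rw [toHalfPlane_eq]
  rw [Real.sq_sqrt (show 0 ≤ z.re - 1 by linarith), sub_add_cancel, Complex.re_add_im]

theorem continuous_toHalfPlane : Continuous toHalfPlane := by
  unfold toHalfPlane
  have := Complex.continuous_conj
  fun_prop

theorem CompC.toHalfPlane {z : α → ℂ} (hz : CompC z) : CompC fun a => toHalfPlane (z a) := by
  have h2 : CompC fun _ : α => (2 : ℂ) := CompC.const_ofNat 2
  exact (((hz.add hz.conj).div h2 fun _ => two_ne_zero).pow_two.add
    ((hz.sub hz.conj).div h2 fun _ => two_ne_zero)).add CompC.const_one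

/-- Each condition becomes positivity of a real part or a norm below 1, the two forms that are
semidecidable; |Im z| < Re z is Re(z ± iz) > 0. -/
theorem mem_zeroRegion_iff {A : ℕ} {n : ℕ} {z : ℂ} : z ∈ zeroRegion A n ↔
    ((0 < (z - A).re ∧ 0 < (z + Complex.I * z).re) ∧ 0 < (z - Complex.I * z).re) ∧
      ‖1000 * (phase z - n - phaseConst)‖ < 1 := by
  have h1 : ‖1000 * (phase z - n - phaseConst)‖ < 1 ↔ ‖phase z - n - phaseConst‖ < 1 / 1000 := by
    rw [norm_mul, Complex.norm_ofNat, lt_div_iff₀ (by norm_num), mul_comm]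
  have h2 : ((0 < (z - A).re ∧ 0 < (z + Complex.I * z).re) ∧ 0 < (z - Complex.I * z).re) ↔
      z ∈ sector A := by
    simp only [Complex.sub_re, Complex.add_re, Complex.I_mul_re, Complex.natCast_re, sector,
      Set.mem_ofPred_eq, abs_lt]
    constructor
    · rintro ⟨⟨a, b⟩, c⟩; exact ⟨by linarith, by linarith, by linarith⟩
    · rintro ⟨a, b, c⟩; exact ⟨⟨by linarith, by linarith⟩, by linarith⟩
  rw [h1, h2]; rfl

/-- A candidate passes if it lies in the region and |R| < 2^(-k) there. Openness and continuity at
the zero provide one, and `hiso` turns a small value into a small distance. A and N are fixed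
numbers, so their mere existence suffices for the algorithm. -/
theorem compC_isolated_zeros {A N : ℕ} (hA : 1 ≤ A) {ζ : ℕ → ℂ}
    (hζ : ∀ n, ζ n ∈ zeroRegion A (n + N)) (h0 : ∀ n, riemannAux (sOf (ζ n)) = 0)
    (hiso : ∀ n, ∀ z ∈ zeroRegion A (n + N), ‖sOf (ζ n) - sOf z‖ ≤ ‖riemannAux (sOf z)‖) :
    CompC fun n => sOf (ζ n) := by
  have hd : CompC fun p : (ℕ × ℕ) × ℕ => toHalfPlane (dyadic p.2) :=
    (compC_dyadic Computable.snd).toHalfPlane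
  have hR := hd.sOf.riemannAux
  have hk : CompC fun p : (ℕ × ℕ) × ℕ => (2 : ℂ) ^ p.1.2 :=
    CompC.two_pow (Computable.snd.comp Computable.fst)
  have hn : CompC fun p : (ℕ × ℕ) × ℕ => ((p.1.1 + N : ℕ) : ℂ) :=
    CompC.natCast (Computable.nat_add' (Computable.fst.comp Computable.fst) (Computable.const N))
  have hI : CompC fun p : (ℕ × ℕ) × ℕ => Complex.I * toHalfPlane (dyadic p.2) :=
    CompC.const_I.mul hd
  have hph : CompC fun p : (ℕ × ℕ) × ℕ =>
      1000 * (phase (toHalfPlane (dyadic p.2)) - ((p.1.1 + N : ℕ) : ℂ) - phaseConst) :=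
    (CompC.const_ofNat 1000).mul
      (((hd.phase fun _ => toHalfPlane_re_pos _).sub hn).sub compC_phaseConst)
  refine CompC.of_search (P := fun p =>
    ((((0 < (toHalfPlane (dyadic p.2) - A).re ∧
      0 < (toHalfPlane (dyadic p.2) + Complex.I * toHalfPlane (dyadic p.2)).re) ∧
      0 < (toHalfPlane (dyadic p.2) - Complex.I * toHalfPlane (dyadic p.2)).re) ∧
      ‖1000 * (phase (toHalfPlane (dyadic p.2)) - ((p.1.1 + N : ℕ) : ℂ) - phaseConst)‖ < 1) ∧
      ‖2 ^ p.1.2 * riemannAux (sOf (toHalfPlane (dyadic p.2)))‖ < 1)) hd.sOf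
    (((((hd.sub (CompC.const_natCast A)).semiDec_re_pos.and (hd.add hI).semiDec_re_pos).and
      (hd.sub hI).semiDec_re_pos).and hph.semiDec_norm_lt_one).and
      (hk.mul hR).semiDec_norm_lt_one) ?_ ?_
  · intro n k
    have hre : 1 ≤ (ζ n).re := by
      have h1 := (hζ n).1.1
      have h2 : (1 : ℝ) ≤ A := by exact_mod_cast hA
      linarith
    obtain ⟨w, hw⟩ := exists_toHalfPlane_eq hre
    have hmem := mem_zeroRegion_iff.1 (hζ n)
    refine exists_dyadic_of_eventually (z := w) (p := fun w =>
      ((((0 < (toHalfPlane w - A).re ∧ 0 < (toHalfPlane w + Complex.I * toHalfPlane w).re) ∧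
      0 < (toHalfPlane w - Complex.I * toHalfPlane w).re) ∧
      ‖1000 * (phase (toHalfPlane w) - ((n + N : ℕ) : ℂ) - phaseConst)‖ < 1) ∧
      ‖2 ^ k * riemannAux (sOf (toHalfPlane w))‖ < 1)) ?_
    have ht := continuous_toHalfPlane
    have hcR : Continuous fun w => 2 ^ k * riemannAux (sOf (toHalfPlane w)) := by
      have := differentiable_riemannAux.continuous
      unfold sOf
      fun_prop
    have hcP : ContinuousAt (fun w => 1000 * (phase (toHalfPlane w) - ((n + N : ℕ) : ℂ)
        - phaseConst)) w := by
      have h1 : ContinuousAt (fun w => phase (toHalfPlane w)) w :=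
        (hasDerivAt_phase (toHalfPlane_re_pos w)).continuousAt.comp ht.continuousAt
      exact continuousAt_const.mul ((h1.sub continuousAt_const).sub continuousAt_const)
    have c1 : Continuous fun w => (toHalfPlane w - A).re := by fun_prop
    have c2 : Continuous fun w => (toHalfPlane w + Complex.I * toHalfPlane w).re := by fun_prop
    have c3 : Continuous fun w => (toHalfPlane w - Complex.I * toHalfPlane w).re := by fun_prop
    rw [← hw] at hmem
    exact ((((c1.continuousAt.eventually_const_lt hmem.1.1.1).and
      (c2.continuousAt.eventually_const_lt hmem.1.1.2)).and
      (c3.continuousAt.eventually_const_lt hmem.1.2)).and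
      (hcP.norm.eventually_lt_const hmem.2)).and
      (hcR.norm.continuousAt.eventually_lt_const (by simp only [hw, h0]; simp))
  · intro n k q hq
    have h1 := hiso n _ (mem_zeroRegion_iff.2 hq.1)
    exact h1.trans (norm_two_pow_mul_lt_one.1 hq.2).le

end ComputableZeros

/-! ### The main theorem -/

section Conclusion

open Topology

theorem isEquivalent_of_tendsto_div {α : Type*} {l : Filter α} {u v : α → ℝ}
    (hv : ∀ᶠ x in l, v x ≠ 0) (h : Tendsto (fun x => u x / v x) l (𝓝 1)) : u ~[l] v :=
  (isEquivalent_iff_tendsto_one hv).2 h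

theorem isEquivalent_of_re_im {α : Type*} {l : Filter α} {u v : α → ℂ}
    (hre : (fun x => (u x).re) ~[l] fun x => (v x).re)
    (him : (fun x => (u x).im) ~[l] fun x => (v x).im) : u ~[l] v := by
  have h1 : (fun x => (((u x).re - (v x).re : ℝ) : ℂ)) =o[l] v := by
    have := hre.isLittleO.trans_isBigO (IsBigO.of_bound 1 (g := v)
      (Eventually.of_forall fun x => by
        rw [one_mul, Real.norm_eq_abs]; exact Complex.abs_re_le_norm _))
    exact (IsLittleO.of_norm_left (this.norm_left.congr_left fun x => by
      rw [Complex.norm_real]; rfl))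
  have h2 : (fun x => (((u x).im - (v x).im : ℝ) : ℂ) * Complex.I) =o[l] v := by
    have := him.isLittleO.trans_isBigO (IsBigO.of_bound 1 (g := v)
      (Eventually.of_forall fun x => by
        rw [one_mul, Real.norm_eq_abs]; exact Complex.abs_im_le_norm _))
    exact (IsLittleO.of_norm_left (this.norm_left.congr_left fun x => by
      rw [norm_mul, Complex.norm_I, mul_one, Complex.norm_real]; rfl))
  refine (h1.add h2).congr_left fun x => ?_
  apply Complex.ext <;> simp

end Conclusion

theorem mainTheorem10 :
    ∃ ρ : ℕ → ℂ,
      (∀ n : ℕ, 1 ≤ n → riemannAux (ρ n) = 0 ∧ 0 < (ρ n).re ∧ (ρ n).im < 0) ∧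
      StrictAntiOn (fun n : ℕ => (ρ n).im) (Set.Ici 1) ∧
      IsComputableSeq (fun n : ℕ => ρ (n + 1)) ∧
      (fun n : ℕ => ρ n) ~[atTop]
        (fun n : ℕ => (4 * (Real.pi : ℂ) ^ 2 * n / ((Real.log n : ℝ) : ℂ) ^ 2
          - 4 * (Real.pi : ℂ) * Complex.I * n / ((Real.log n : ℝ) : ℂ))) ∧
      (fun n : ℕ => (ρ n).re) ~[atTop]
        (fun n : ℕ => 4 * Real.pi ^ 2 * n / Real.log n ^ 2) ∧
      (fun n : ℕ => (ρ n).im) ~[atTop]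
        (fun n : ℕ => -(4 * Real.pi * n / Real.log n)) := by
  obtain ⟨A, hAexp⟩ := exists_nat_ge (Real.exp 13)
  have hA8 : (8 : ℝ) ≤ A := by linarith [Real.add_one_le_exp 13]
  have hAlog : 13 ≤ Real.log A := (Real.le_log_iff_exp_le (by linarith)).2 hAexp
  have hA1 : (1 : ℝ) ≤ A := by linarith
  obtain ⟨N₁, h₁⟩ := exists_isolated_zeros hA8 hAlog
  obtain ⟨N₂, h₂⟩ := im_sOf_lt_of_mem_zeroRegion hA8 hAlog
  obtain ⟨N₃, h₃⟩ := eventually_phaseFilter_iff.1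
    ((tendsto_re_sOf (K := 1) hA1).eventually_gt_atTop 0)
  obtain ⟨N, hN₁, hN₂, hN₃⟩ : ∃ N, N₁ ≤ N ∧ N₂ ≤ N ∧ N₃ ≤ N :=
    ⟨max N₁ (max N₂ N₃), le_max_left _ _, (le_max_left _ _).trans (le_max_right _ _),
      (le_max_right _ _).trans (le_max_right _ _)⟩
  choose ζ hζ h0 hiso using fun n : ℕ => h₁ (n + N) (by omega)
  -- The phase of `ζ n` is near n + N; letting the tolerance be N + 1 absorbs the shift, so the
  -- asymptotics come out directly in n.
  have hl : Tendsto (fun n : ℕ => (n, ζ n)) atTop (phaseFilter A (N + 1)) := by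
    refine tendsto_inf.2 ⟨tendsto_comap_iff.2 tendsto_id, tendsto_principal.2
      (Eventually.of_forall fun n => ⟨(hζ n).1, ?_⟩)⟩
    have e : phase (ζ n) - n - phaseConst = (phase (ζ n) - (n + N : ℕ) - phaseConst) + N := by
      push_cast; ring
    rw [e]
    refine (norm_add_le _ _).trans ?_
    rw [Complex.norm_natCast]
    linarith [(hζ n).2]
  have hre : (fun n : ℕ => (sOf (ζ n)).re) ~[atTop]
      (fun n : ℕ => 4 * Real.pi ^ 2 * n / Real.log n ^ 2) := by
    have h := (tendsto_re_sOf_div hA1).comp hl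
    refine isEquivalent_of_tendsto_div ?_ h
    filter_upwards [tendsto_natCast_div_log_sq.eventually_gt_atTop 0] with n hn using hn.ne'
  have him : (fun n : ℕ => (sOf (ζ n)).im) ~[atTop]
      (fun n : ℕ => -(4 * Real.pi * n / Real.log n)) := by
    have h := (tendsto_im_sOf_div hA1).comp hl
    refine isEquivalent_of_tendsto_div ?_ h
    filter_upwards [eventually_ge_atTop 2] with n hn
    have h2 : (1 : ℝ) < n := by exact_mod_cast hn
    have h3 := Real.log_pos h2
    have : 0 < 4 * Real.pi * n / Real.log n := by positivity
    linarith
  refine ⟨fun n => sOf (ζ n), fun n _ => ⟨h0 n, ?_, ?_⟩, ?_, ?_, ?_, hre, him⟩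
  · exact (h₃ (n + N) (by omega) (ζ n) (hζ n).1 ((hζ n).2.le.trans (by norm_num)))
  · obtain ⟨h1, h2⟩ := (hζ n).1
    rw [sOf_im]
    have := abs_lt.1 h2
    have h3 : 0 < (ζ n).re ^ 2 - (ζ n).im ^ 2 := by nlinarith
    nlinarith [Real.pi_pos]
  · refine (strictAnti_nat_of_succ_lt fun n => ?_).strictAntiOn _
    refine h₂ (n + N) (by omega) _ (hζ n) _ ?_
    rw [show n + N + 1 = n + 1 + N by omega]
    exact hζ (n + 1)
  -- `ζ` is indexed from 0 while the computable sequence begins with index 1.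
  · exact (compC_isolated_zeros (by exact_mod_cast hA1) hζ h0 hiso).comp Computable.succ
  · have e : ∀ n : ℕ, (4 * (Real.pi : ℂ) ^ 2 * n / ((Real.log n : ℝ) : ℂ) ^ 2
        - 4 * (Real.pi : ℂ) * Complex.I * n / ((Real.log n : ℝ) : ℂ))
        = ((4 * Real.pi ^ 2 * n / Real.log n ^ 2 : ℝ) : ℂ)
          + ((-(4 * Real.pi * n / Real.log n) : ℝ) : ℂ) * Complex.I := fun n => by
      push_cast; ring
    refine isEquivalent_of_re_im (hre.congr_right (Eventually.of_forall fun n => ?_))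
      (him.congr_right (Eventually.of_forall fun n => ?_))
    · simp only [e, Complex.add_re, Complex.ofReal_re, Complex.re_ofReal_mul, Complex.I_re,
        mul_zero, add_zero]
    · simp only [e, Complex.add_im, Complex.ofReal_im, Complex.im_ofReal_mul, Complex.I_im,
        mul_one, zero_add]
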